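/- Let $[m]=(q^m-q^{-m})/(q-q^{-1})$. For $N\ge 1$ let $\mathrm{TL}^D_N$ be the $\mathbb{C}(q)$-algebra with generators $E_0,\dots,E_{N-1}$ and relations $E_i^2=-[2]E_i$; $E_iE_jE_i=E_i$ if $i,j$ are adjacent, and $E_iE_j=E_jE_i$ otherwise, in the Dynkin diagram $D_N$ (nodes $1,2,\dots,N-1$ form a path, and node $0$ is joined to node $2$ only). The Jones–Wenzl projections $Q_n\in\mathrm{TL}^D_{n+1}$ ($n\ge 0$) are the unique elements with $Q_n\ne 0$, $Q_nQ_i=Q_iQ_n=Q_n$ for $0\le i\le n$, and $E_iQ_n=Q_nE_i=0$ for $0\le i\le n$ (they exist and are unique). An $N$-strand diagram of type $A$ consists of $N$ non-crossing strands joining $N$ marked points on the top and $N$ on the bottom; a strand is a cup (joining two top points), a cap (joining two bottom points) or a vertical strand. $\mathbf 1$ is the diagram of $N$ vertical strands. A cup or cap is outer-most if no larger cup or cap lies outside it and no vertical strand lies to its left. An $N$-strand diagram of type $D$ is such a diagram with at most one dot on each strand, where either the number of dots is even and all dots are on outer-most cups, outer-most caps or the left-most vertical strand, or there is exactly one dot,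 which is on the strand containing the left-most bottom point; $\mathbf 1$ carries no dots. It is a lift of the diagram of type $A$ obtained by deleting its dots. The generator $E_i$, $i\ge1$, is depicted by the undotted diagram with a cup and a cap joining the points $i,i+1$ and vertical strands elsewhere; $E_0$ is depicted as $E_1$ with a dot on both the cup and the cap. A reduced word (one that is not a scalar multiple of a shorter word) is depicted by stacking the pictures of its letters, the first one on top, deleting closed loops together with their dots, and, whenever the number of dots is odd, replacing them by one dot on the strand containing the left-most bottom point. For a diagram $D$ of type $D$ with $n+1$ strands, $\mathrm{coef}_n(D)$ is the coefficient in $Q_n$, written as a linear combination of reduced words, of the word depicted by $D$. For a diagram $D^A$ of type $A$ with $n+1$ strands put $$c_n(D^A):=\sum_{D'\in\mathcal D^e(D^A)}\mathrm{coef}_n(D')-[2]\,\mathrm{coef}_n(D^{\mathrm{odd}}),$$ where $\mathcal D^e(D^A)$ is the set of lifts of $D^A$ with an even number of dots and $D^{\mathrm{odd}}$ is the unique lift with exactly one dot; if $D^A=\mathbf 1$ there is no such lift and the last term is $0$. Let $I(D^A)$ be the set of positions of inner-most caps of $D^A$: it contains $i\in\{1,\dots,n\}$ if a cap joins the bottom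 points $i$ and $i+1$, and it contains $n+1$ if a vertical strand joins the right-most top and bottom points. For $i\in I(D^A)$ let $D^A_i$ be the $n$-strand diagram obtained by removing this cap; when $i\le n$, the right-most top point thereby becomes the right-most bottom point. **Proposition.** For every $n\ge1$ and every diagram $D^A$ of type $A$ with $n+1$ strands, $$c_n(D^A)=\sum_{i\in I(D^A)}\frac{[i]}{[n+1]}\,c_{n-1}(D^A_i).$$ -/

import Mathlib

/-! # Temperley–Lieb algebras of type D, their Jones–Wenzl projections, and dotted diagrams -/

/-! ## Scalars -/

/-- The ground field `ℂ(q)`. -/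
abbrev Kq : Type := RatFunc ℂ

/-- The indeterminate `q`. -/
noncomputable def qvar : Kq := RatFunc.X

/-- The quantum integer `[m] = (q^m - q^{-m}) / (q - q^{-1})`. -/
noncomputable def qint (m : ℕ) : Kq :=
  (qvar ^ m - (qvar ^ m)⁻¹) / (qvar - qvar⁻¹)

/-! ## The Temperley–Lieb algebra of type `D_N` -/

/-- Adjacency in the Dynkin diagram `D_N` with nodes `0, 1, …, N - 1`: the nodes `1, 2, …, N - 1`
form a path, and the node `0` is joined to the node `2` only. -/
def DAdj {N : ℕ} (i j : Fin N) : Prop :=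
  (i.val = 0 ∧ j.val = 2) ∨ (i.val = 2 ∧ j.val = 0) ∨
    (1 ≤ i.val ∧ j.val = i.val + 1) ∨ (1 ≤ j.val ∧ i.val = j.val + 1)

/-- The defining relations of the Temperley–Lieb algebra of type `D_N`. -/
inductive TLDRel (N : ℕ) : FreeAlgebra Kq (Fin N) → FreeAlgebra Kq (Fin N) → Prop
  | sq (i : Fin N) :
      TLDRel N (FreeAlgebra.ι Kq i * FreeAlgebra.ι Kq i) (-qint 2 • FreeAlgebra.ι Kq i)
  | braid (i j : Fin N) (h : DAdj i j) :
      TLDRel N (FreeAlgebra.ι Kq i * FreeAlgebra.ι Kq j * FreeAlgebra.ι Kq i) (FreeAlgebra.ι Kq i)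
  | comm (i j : Fin N) (h : ¬ DAdj i j) :
      TLDRel N (FreeAlgebra.ι Kq i * FreeAlgebra.ι Kq j) (FreeAlgebra.ι Kq j * FreeAlgebra.ι Kq i)

/-- The Temperley–Lieb algebra of type `D_N`, by generators `E_0, …, E_{N-1}` and relations. -/
abbrev TLD (N : ℕ) : Type := RingQuot (TLDRel N)

/-- The generator `E_i`. -/
noncomputable def genE {N : ℕ} (i : Fin N) : TLD N :=
  RingQuot.mkAlgHom Kq (TLDRel N) (FreeAlgebra.ι Kq i)

/-- The word `E_{s_1} E_{s_2} ⋯ E_{s_l}`. -/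
noncomputable def wordE {N : ℕ} (w : List (Fin N)) : TLD N := (w.map genE).prod

theorem genE_sq {N : ℕ} (i : Fin N) : genE i * genE i = -qint 2 • genE i := by
  have h := RingQuot.mkAlgHom_rel Kq (TLDRel.sq i)
  rwa [map_mul, map_smul] at h

theorem genE_braid {N : ℕ} {i j : Fin N} (h : DAdj i j) :
    genE i * genE j * genE i = genE i := by
  simpa [genE] using RingQuot.mkAlgHom_rel Kq (TLDRel.braid i j h)

theorem genE_comm {N : ℕ} {i j : Fin N} (h : ¬ DAdj i j) :
    genE i * genE j = genE j * genE i := by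
  simpa [genE] using RingQuot.mkAlgHom_rel Kq (TLDRel.comm i j h)

/-- The homomorphism `TL^D_M → TL^D_N` for `M ≤ N` that sends each `E_i` to `E_i`. -/
noncomputable def inclTLD {M N : ℕ} (h : M ≤ N) : TLD M →ₐ[Kq] TLD N :=
  RingQuot.liftAlgHom Kq
    ⟨FreeAlgebra.lift Kq (fun i : Fin M => genE (Fin.castLE h i)), by
      intro a b hab
      cases hab with
      | sq i =>
        rw [map_mul, map_smul, FreeAlgebra.lift_ι_apply]
        exact genE_sq (Fin.castLE h i)
      | braid i j hij =>
        have : DAdj (Fin.castLE h i) (Fin.castLE h j) := hij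
        simpa using genE_braid this
      | comm i j hij =>
        have : ¬ DAdj (Fin.castLE h i) (Fin.castLE h j) := hij
        simpa using genE_comm this⟩

/-- `Q n ∈ TL^D_{n+1}`, `n = 0, 1, 2, …`, are the Jones–Wenzl projections of type `D`:
`Q_n ≠ 0`, `Q_n Q_i = Q_i Q_n = Q_n` for `0 ≤ i ≤ n`, and `E_i Q_n = Q_n E_i = 0` for
`0 ≤ i ≤ n`. -/
def IsJonesWenzlD (Q : (n : ℕ) → TLD (n + 1)) : Prop :=
  ∀ n : ℕ, Q n ≠ 0 ∧
    (∀ (i : ℕ) (h : i ≤ n),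
      Q n * inclTLD (Nat.succ_le_succ h) (Q i) = Q n ∧
      inclTLD (Nat.succ_le_succ h) (Q i) * Q n = Q n) ∧
    (∀ i : Fin (n + 1), genE i * Q n = 0 ∧ Q n * genE i = 0)

/-! ## Reduced expressions -/

/-- A word is reduced if the element it represents is not (a scalar multiple of) a shorter word. -/
def IsReducedWord {N : ℕ} (w : List (Fin N)) : Prop :=
  ∀ (w' : List (Fin N)) (c : Kq), wordE w = c • wordE w' → w.length ≤ w'.length

/-- The reduced words in `E_0, …, E_{N-1}`. -/
abbrev ReducedWord (N : ℕ) : Type := {w : List (Fin N) // IsReducedWord w}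

theorem wordE_mem_span {N : ℕ} (w : List (Fin N)) :
    wordE w ∈ Submodule.span Kq (Set.range fun v : ReducedWord N => wordE v.1) := by
  induction h : w.length using Nat.strong_induction_on generalizing w with
  | _ l ih =>
    by_cases hw : IsReducedWord w
    · exact Submodule.subset_span ⟨⟨w, hw⟩, rfl⟩
    · unfold IsReducedWord at hw
      push Not at hw
      obtain ⟨w', c, hc, hl⟩ := hw
      rw [hc]
      exact Submodule.smul_mem _ _ (ih w'.length (h ▸ hl) w' rfl)

/-- Every element of `TL^D_N` is a linear combination of reduced words. -/
theorem exists_reducedExpansion {N : ℕ} (x : TLD N) :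
    ∃ y : ReducedWord N →₀ Kq, (y.sum fun v a => a • wordE v.1) = x := by
  rw [← Finsupp.mem_span_range_iff_exists_finsupp]
  set S := Submodule.span Kq (Set.range fun v : ReducedWord N => wordE v.1) with hS
  have key : ∀ a : FreeAlgebra Kq (Fin N), ∀ s ∈ S,
      RingQuot.mkAlgHom Kq (TLDRel N) a * s ∈ S := by
    intro a
    induction a using FreeAlgebra.induction with
    | grade0 r =>
      intro s hs
      rw [AlgHom.commutes, ← Algebra.smul_def]
      exact S.smul_mem r hs
    | grade1 i =>
      intro s hs
      induction hs using Submodule.span_induction with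
      | mem z hz =>
        obtain ⟨v, rfl⟩ := hz
        have : RingQuot.mkAlgHom Kq (TLDRel N) (FreeAlgebra.ι Kq i) * wordE v.1
            = wordE (i :: v.1) := by simp [wordE, genE]
        simp only [this]
        exact wordE_mem_span _
      | zero => simp
      | add z z' _ _ h h' => rw [mul_add]; exact S.add_mem h h'
      | smul r z _ h => rw [mul_smul_comm]; exact S.smul_mem r h
    | mul a b ha hb =>
      intro s hs
      rw [map_mul, mul_assoc]
      exact ha _ (hb _ hs)
    | add a b ha hb =>
      intro s hs
      rw [map_add, add_mul]
      exact S.add_mem (ha _ hs) (hb _ hs)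
  obtain ⟨a, rfl⟩ := RingQuot.mkAlgHom_surjective Kq (TLDRel N) x
  have h1 : (1 : TLD N) ∈ S := wordE_mem_span ([] : List (Fin N))
  simpa using key a 1 h1

/-! ## Diagrams of type A

The `2N` marked points of an `N`-strand diagram are numbered `0, …, 2N - 1` along the boundary:
the top points from left to right, followed by the bottom points from right to left. So the
`k`-th top point from the left (`1 ≤ k ≤ N`) is the point `k - 1`, and the `k`-th bottom point
from the left is the point `2N - k`. -/

/-- An `N`-strand Temperley–Lieb diagram without dots: a non-crossing perfect matching of the
marked points. -/
@[ext] structure TLDiagram (N : ℕ) where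
  /-- The other end of the strand at a marked point. -/
  mate : Fin (2 * N) → Fin (2 * N)
  mate_mate : ∀ x, mate (mate x) = x
  mate_ne : ∀ x, mate x ≠ x
  noncrossing : ∀ x y, x < y → y < mate x → mate y < mate x

namespace TLDiagram

variable {N : ℕ}

/-- The identity diagram: `N` vertical strands. -/
def one (N : ℕ) : TLDiagram N where
  mate := Fin.rev
  mate_mate := Fin.rev_rev
  mate_ne := by
    intro x h
    have := congrArg Fin.val h
    rw [Fin.val_rev] at this
    omega
  noncrossing := by
    intro x y h _
    exact Fin.rev_lt_rev.mpr h

/-- The strand at the point `x` is accessible from the left border: no other strand separates it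
from the border. For a cup (cap) this says that no larger cup (cap) lies outside it and no vertical
strand lies to the left of it, i.e. that it is outer-most; for a vertical strand it says that the
strand is the left-most one. -/
def Exposed (D : TLDiagram N) (x : Fin (2 * N)) : Prop :=
  ∀ y, ¬ (y < x ∧ y < D.mate x ∧ x < D.mate y ∧ D.mate x < D.mate y)

/-- There is an inner-most cap at position `i`. For `1 ≤ i < N` this is a cap joining the `i`-th
and the `(i+1)`-st bottom points; for `i = N` it is a vertical strand joining the right-most top and
bottom points. With the numbering of the marked points, both mean that the points `2N - 1 - i` and
`2N - i` are joined. -/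
def HasInnermostCap (D : TLDiagram N) (i : ℕ) : Prop :=
  1 ≤ i ∧ i ≤ N ∧ ∃ x, x.val + i + 1 = 2 * N ∧ (D.mate x).val = x.val + 1

open Classical in
/-- The set `I(D)` of positions of inner-most caps. -/
noncomputable def capPositions (D : TLDiagram N) : Finset ℕ :=
  (Finset.Icc 1 N).filter D.HasInnermostCap

theorem hasInnermostCap_of_mem {D : TLDiagram N} {i : ℕ} (h : i ∈ D.capPositions) :
    D.HasInnermostCap i := by
  classical
  exact (Finset.mem_filter.mp h).2

/-- The increasing map from `2N` points to `2N + 2` points that skips the points `p` and `p + 1`. -/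
def skip (p : ℕ) (x : Fin (2 * N)) : Fin (2 * (N + 1)) :=
  ⟨if x.val < p then x.val else x.val + 2, by split <;> omega⟩

/-- The left inverse of `skip p` (with an irrelevant value at `p` and `p + 1`). -/
def unskip (p : ℕ) (hp : p ≤ 2 * N) (hN : 0 < N) (x : Fin (2 * (N + 1))) : Fin (2 * N) :=
  ⟨if x.val < p then min x.val (2 * N - 1) else x.val - 2, by split <;> omega⟩

theorem skip_unskip {p : ℕ} (hp : p ≤ 2 * N) (hN : 0 < N) {x : Fin (2 * (N + 1))}
    (h : x.val ≠ p) (h' : x.val ≠ p + 1) : skip p (unskip p hp hN x) = x := by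
  apply Fin.ext
  simp only [skip, unskip]
  split_ifs <;> omega

theorem skip_lt_skip {p : ℕ} {x y : Fin (2 * N)} : skip p x < skip p y ↔ x < y := by
  simp only [skip, Fin.lt_def]
  split_ifs <;> omega

theorem skip_injective {p : ℕ} : Function.Injective (skip (N := N) p) := by
  intro x y h
  apply Fin.ext
  have := congrArg Fin.val h
  simp only [skip] at this
  split_ifs at this <;> omega

theorem skip_ne {p : ℕ} (x : Fin (2 * N)) : (skip p x).val ≠ p ∧ (skip p x).val ≠ p + 1 := by
  simp only [skip]
  split_ifs <;> omega

theorem skip_unskip_mate {D : TLDiagram (N + 1)} {i : ℕ} (h : D.HasInnermostCap i)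
    (hN : 0 < N) (x : Fin (2 * N)) :
    skip (2 * N + 1 - i) (unskip (2 * N + 1 - i) (by have := h.1; omega) hN
      (D.mate (skip (2 * N + 1 - i) x))) = D.mate (skip (2 * N + 1 - i) x) := by
  obtain ⟨h1, h2, z, hz, hz'⟩ := h
  have hzp : z.val = 2 * N + 1 - i := by omega
  have hx := skip_ne (p := 2 * N + 1 - i) x
  apply skip_unskip
  · intro he
    have he' : D.mate (skip (2 * N + 1 - i) x) = z := Fin.ext (by omega)
    have hm := D.mate_mate (skip (2 * N + 1 - i) x)
    rw [he'] at hm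
    have := congrArg Fin.val hm
    omega
  · intro he
    have he' : D.mate (skip (2 * N + 1 - i) x) = D.mate z := Fin.ext (by omega)
    have hm := D.mate_mate (skip (2 * N + 1 - i) x)
    rw [he', D.mate_mate] at hm
    have := congrArg Fin.val hm
    omega

/-- The diagram `D_i` with one strand less, obtained from `D` by removing the inner-most cap at
position `i`: delete its two end points, keep all other strands, and renumber the remaining `2N`
points along the boundary. (If `i ≤ N`, the right-most top point of `D` thereby becomes the
right-most bottom point of `D_i`.) -/
def remove (D : TLDiagram (N + 1)) (i : ℕ) (h : D.HasInnermostCap i) : TLDiagram N where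
  mate x := unskip (2 * N + 1 - i) (by have := h.1; omega) (by have := x.2; omega)
    (D.mate (skip (2 * N + 1 - i) x))
  mate_mate := by
    intro x
    have hN : 0 < N := by have := x.2; omega
    apply skip_injective (p := 2 * N + 1 - i)
    rw [skip_unskip_mate h hN, skip_unskip_mate h hN, D.mate_mate]
  mate_ne := by
    intro x hx
    have hN : 0 < N := by have := x.2; omega
    have := congrArg (skip (2 * N + 1 - i)) hx
    rw [skip_unskip_mate h hN] at this
    exact D.mate_ne _ this
  noncrossing := by
    intro x y hxy hy
    have hN : 0 < N := by have := x.2; omega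
    rw [← skip_lt_skip (p := 2 * N + 1 - i), skip_unskip_mate h hN] at hy ⊢
    rw [skip_unskip_mate h hN]
    exact D.noncrossing _ _ (skip_lt_skip.mpr hxy) hy

theorem skip_remove_mate (D : TLDiagram (N + 1)) (i : ℕ) (h : D.HasInnermostCap i)
    (x : Fin (2 * N)) :
    skip (2 * N + 1 - i) ((D.remove i h).mate x) = D.mate (skip (2 * N + 1 - i) x) :=
  skip_unskip_mate h (by have := x.2; omega) x

end TLDiagram

/-! ## Pictures of words and dotted diagrams -/

/-- A picture with dots, before any condition is imposed: `mate` gives the other end of the strand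
at a marked point, and `dot` tells whether the strand at a marked point carries a dot. -/
@[ext] structure Picture (N : ℕ) where
  mate : Fin (2 * N) → Fin (2 * N)
  dot : Fin (2 * N) → Bool

namespace Picture

variable {N : ℕ}

/-- The number of dotted strands; each strand is counted at its first end point. -/
def numDots (P : Picture N) : ℕ :=
  (Finset.univ.filter fun x => x < P.mate x ∧ P.dot x = true).card

/-- The picture of the empty word: `N` vertical strands without dots. -/
def one (N : ℕ) : Picture N where
  mate := Fin.rev
  dot := fun _ => false

/-- The strand at `x` contains the left-most bottom point. -/
def AtBottomLeft (mate : Fin (2 * N) → Fin (2 * N)) (x : Fin (2 * N)) : Prop :=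
  x.val + 1 = 2 * N ∨ (mate x).val + 1 = 2 * N

instance (mate : Fin (2 * N) → Fin (2 * N)) : DecidablePred (AtBottomLeft mate) :=
  fun _ => inferInstanceAs (Decidable (_ ∨ _))

/-- If the number of dots is odd, replace them by a single dot on the strand that contains the
left-most bottom point. -/
def normalize (P : Picture N) : Picture N where
  mate := P.mate
  dot := if Odd P.numDots then fun x => decide (AtBottomLeft P.mate x) else P.dot

/-- Put the picture of the generator `E_i` on the top of `P`. The generator has a cup and a cap
joining the points `k, k + 1`, where `k = max i 1`, and these two carry a dot each if and only if
`i = 0`. The result has the cup of `E_i`, and the cap of `E_i` connects the strands of `P` that end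
at the top points `k` and `k + 1`. If these belong to one cup of `P`, a closed loop arises, which is
deleted together with its dot. -/
def stack (i : Fin N) (P : Picture N) : Picture N :=
  let a : Fin (2 * N) := ⟨max i.val 1 - 1, by omega⟩
  let b : Fin (2 * N) := ⟨max i.val 1, by omega⟩
  let e : Bool := decide (i.val = 0)
  normalize
    { mate := fun x =>
        if x = a then b else if x = b then a
        else if x = P.mate a then P.mate b else if x = P.mate b then P.mate a
        else P.mate x
      dot := fun x =>
        if x = a ∨ x = b then e
        else if x = P.mate a ∨ x = P.mate b then xor (xor (P.dot a) (P.dot b)) e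
        else P.dot x }

/-- The picture of a word `E_{s_1} ⋯ E_{s_l}`: the pictures of the generators stacked with `E_{s_1}`
at the top. It is used for reduced words only; for these no loop other than one with a single dot
arises, and no strand ever collects two dots. -/
def ofWord (w : List (Fin N)) : Picture N := w.foldr stack (one N)

end Picture

/-- An `N`-strand Temperley–Lieb diagram of type `D`: a diagram in which every strand carries at
most one dot, such that
* the number of dots is one or even;
* if it is even, dots are on outer-most caps, outer-most cups or the left-most vertical strand;
* if it is one, the dot is on the strand that contains the left-most bottom point, and this strand
  is a cap or a vertical strand;
* the diagram of `N` vertical strands has no dot. -/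
structure DottedDiagram (N : ℕ) where
  shape : TLDiagram N
  dot : Fin (2 * N) → Bool
  dot_mate : ∀ x, dot (shape.mate x) = dot x
  parity : (Picture.mk shape.mate dot).numDots = 1 ∨ Even (Picture.mk shape.mate dot).numDots
  even_exposed : Even (Picture.mk shape.mate dot).numDots → ∀ x, dot x = true → shape.Exposed x
  odd_bottomLeft : (Picture.mk shape.mate dot).numDots = 1 → ∀ x, dot x = true →
    Picture.AtBottomLeft shape.mate x
  one_undotted : shape = TLDiagram.one N → ∀ x, dot x = false

namespace DottedDiagram

variable {N : ℕ}

/-- The underlying picture. -/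
def toPicture (D : DottedDiagram N) : Picture N := ⟨D.shape.mate, D.dot⟩

/-- The number of dots. -/
def numDots (D : DottedDiagram N) : ℕ := D.toPicture.numDots

theorem toPicture_injective : Function.Injective (toPicture (N := N)) := by
  rintro ⟨⟨m, _, _, _⟩, d, _, _, _, _, _⟩ ⟨⟨m', _, _, _⟩, d', _, _, _, _, _⟩ h
  simp only [toPicture, Picture.mk.injEq] at h
  obtain ⟨rfl, rfl⟩ := h
  rfl

noncomputable instance : Fintype (DottedDiagram N) :=
  Fintype.ofInjective
    (fun D : DottedDiagram N => ((D.shape.mate, D.dot) :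
      (Fin (2 * N) → Fin (2 * N)) × (Fin (2 * N) → Bool)))
    (by
      intro D D' h
      apply toPicture_injective
      simp only [Prod.mk.injEq] at h
      simp only [toPicture, h.1, h.2])

end DottedDiagram

namespace TLDiagram

variable {N : ℕ}

open Classical in
/-- The type-D diagrams with an even number of dots that become `D` when all dots are forgotten. -/
noncomputable def evenLifts (D : TLDiagram N) : Finset (DottedDiagram N) :=
  Finset.univ.filter fun D' => D'.shape = D ∧ Even D'.numDots

theorem numDots_bottomLeft (D : TLDiagram N) (hN : 0 < N) :
    (Picture.mk D.mate fun x => decide (Picture.AtBottomLeft D.mate x)).numDots = 1 := by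
  rw [Picture.numDots, Finset.card_eq_one]
  let l : Fin (2 * N) := ⟨2 * N - 1, by omega⟩
  refine ⟨D.mate l, ?_⟩
  ext x
  simp only [Finset.mem_filter, Finset.mem_univ, true_and, decide_eq_true_eq,
    Finset.mem_singleton]
  unfold Picture.AtBottomLeft
  constructor
  · rintro ⟨h, h' | h'⟩
    · have := (D.mate x).2
      rw [Fin.lt_def] at h
      omega
    · have : D.mate x = l := Fin.ext (by simp only [l]; omega)
      rw [← this, D.mate_mate]
  · rintro rfl
    rw [D.mate_mate]
    refine ⟨?_, Or.inr (by simp only [l]; omega)⟩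
    have h1 : (D.mate l).val ≠ l.val := fun h => D.mate_ne l (Fin.ext h)
    have h2 := (D.mate l).2
    rw [Fin.lt_def]
    simp only [l] at h1 ⊢
    omega

theorem pos_of_ne_one {D : TLDiagram N} (h : D ≠ one N) : 0 < N := by
  rcases Nat.eq_zero_or_pos N with rfl | hN
  · exact absurd (TLDiagram.ext (funext fun x => absurd x.2 (by omega))) h
  · exact hN

/-- The unique single-dot lift `D^odd` of a diagram `D` other than the identity: the dot is on the
strand that contains the left-most bottom point. -/
def oddLift (D : TLDiagram N) (h : D ≠ one N) : DottedDiagram N where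
  shape := D
  dot x := decide (Picture.AtBottomLeft D.mate x)
  dot_mate x := by
    rw [decide_eq_decide]
    unfold Picture.AtBottomLeft
    rw [D.mate_mate]
    exact or_comm
  parity := Or.inl (numDots_bottomLeft D (pos_of_ne_one h))
  even_exposed he := by
    rw [numDots_bottomLeft D (pos_of_ne_one h)] at he
    exact absurd he (by decide)
  odd_bottomLeft _ x hx := by simpa using hx
  one_undotted hD := absurd hD h

end TLDiagram

/-! ## Coefficients of diagrams -/

open Classical in
/-- The coefficient of the diagram `D` in `x ∈ TL^D_N`: write `x` as a linear combination of reduced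
words, and add up the coefficients of those words whose picture is `D`. (Two reduced words have the
same picture if and only if they are equal in `TL^D_N`, and distinct elements of this form are
linearly independent.) -/
noncomputable def diagramCoef {N : ℕ} (x : TLD N) (D : DottedDiagram N) : Kq :=
  (exists_reducedExpansion x).choose.sum fun w a =>
    if Picture.ofWord w.1 = D.toPicture then a else 0

open Classical in
/-- The linear combination `∑_{D'} coef(D') - [2] coef(D^odd)` of coefficients in `x`, where `D'`
runs over the lifts of `D` with an even number of dots, and `D^odd` is the lift with a single dot;
the identity diagram has no lift of the latter kind, and the second term is absent. -/
noncomputable def liftCombination {N : ℕ} (x : TLD N) (D : TLDiagram N) : Kq :=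
  ∑ D' ∈ D.evenLifts, diagramCoef x D' -
    qint 2 * (if h : D = TLDiagram.one N then 0 else diagramCoef x (D.oddLift h))

/-! # Quantum integers -/

/-! Forgetting all dots is the homomorphism to the type A algebra that sends both `E_0` and `E_1` to
the type A generator at the first position. A word whose picture has no closed loop goes to its
underlying diagram. A word in which one loop with a single dot has been deleted goes to `-[2]` times
its diagram, and exactly these words are depicted with one dot. If no other reduced words exist,
then `c_n(D^A)` is the coefficient of `D^A` in the image of `Q_n` (`liftCombination_eq_repA`). This
image is killed by all generators and contains the identity diagram with coefficient 1, so it is the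
type A Jones–Wenzl projection, and the claim becomes the recursion for the coefficients of that
projection. The recursion is taken as the definition of a vector `jwA`. The work is to show that
`jwA` is killed by all cups on the top side (`capCup_jwA`), since a vector with this property and
identity coefficient 1 is unique (`eq_repA_jwD`).

That reduced words have at most one loop, and this one dotted, is
`IsReducedWord.isLoopless_or_hasDottedLoop`. Reducedness refers to the algebra given by generators
and relations, so a word with any other loop must be shortened there and not only in pictures. Two
kinds of representations on matchings with dots serve for this: without dots (`labA`), and with dots
from `E_0`, where a loop with one dot is zero (`labD`). A superfluous loop yields the factor `-[2]`
in both, and `jointlyFaithful` carries the identity over to the algebra.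

Joint faithfulness rests on the elements `F_m = E_m ⋯ E_2 (E_0 E_1) E_2 ⋯ E_m` (`forkElt`), which
are zero with the labels `labD` and equal `-[2] E_m` with the labels `labA`. The corner of `E_m` is
spanned by elements `u E_m` and `u F_m` with `u` in a smaller algebra (`IsTLDSystem.corner`), which
permits an induction. An element all of whose corners vanish is then zero by multiplication with the
Jones–Wenzl element.

The projections `Q_n` exist by a two-term recursion with summands `P E_m P` and `P F_m P` (`jwElt`).
They are unique because an element killed by all generators is multiplied by a scalar, the
augmentation. -/

theorem qvar_ne_zero : qvar ≠ 0 := RatFunc.X_ne_zero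

/-- Compare degrees of polynomials. With `c = ±1` this makes `q^m ± q^{-m}` nonzero, so that the
denominators below can be cancelled. -/
theorem qvar_pow_ne_C {k : ℕ} (hk : k ≠ 0) (c : ℂ) : qvar ^ k ≠ RatFunc.C c := by
  intro h
  rw [qvar, ← RatFunc.algebraMap_X, ← map_pow, ← RatFunc.algebraMap_C] at h
  have h' := RatFunc.algebraMap_injective ℂ h
  have := congrArg Polynomial.natDegree h'
  simp at this
  exact hk this

/-- The Laurent polynomial `q^m + q^{-m}`. -/
noncomputable def qcosh (m : ℕ) : Kq := qvar ^ m + (qvar ^ m)⁻¹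

theorem qcosh_ne_zero (m : ℕ) : qcosh m ≠ 0 := by
  intro h
  rcases Nat.eq_zero_or_pos m with rfl | hm
  · norm_num [qcosh] at h
  have hq := pow_ne_zero m qvar_ne_zero
  have : qvar ^ (2 * m) = RatFunc.C (-1) := by
    rw [qcosh] at h
    field_simp at h
    rw [map_neg, map_one, mul_comm 2 m, pow_mul]
    linear_combination h
  exact qvar_pow_ne_C (by omega) _ this

theorem qvar_pow_sub_inv_ne_zero {m : ℕ} (hm : m ≠ 0) : qvar ^ m - (qvar ^ m)⁻¹ ≠ 0 := by
  intro h
  have hq := pow_ne_zero m qvar_ne_zero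
  have : qvar ^ (2 * m) = RatFunc.C 1 := by
    field_simp at h
    rw [map_one, mul_comm 2 m, pow_mul]
    linear_combination h
  exact qvar_pow_ne_C (by omega) _ this

theorem qvar_sub_inv_ne_zero : qvar - qvar⁻¹ ≠ 0 := by
  simpa using qvar_pow_sub_inv_ne_zero one_ne_zero

theorem qint_ne_zero {m : ℕ} (hm : m ≠ 0) : qint m ≠ 0 :=
  div_ne_zero (qvar_pow_sub_inv_ne_zero hm) qvar_sub_inv_ne_zero

theorem qint_one : qint 1 = 1 := by
  simpa [qint] using div_self qvar_sub_inv_ne_zero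

theorem qint_two : qint 2 = qvar + qvar⁻¹ := by
  have h := qvar_sub_inv_ne_zero
  rw [qint, div_eq_iff h]
  have := qvar_ne_zero
  field_simp
  ring

theorem qint_two_ne_zero : qint 2 ≠ 0 := qint_ne_zero two_ne_zero

theorem qint_two_mul_qint (m : ℕ) : qint 2 * qint (m + 1) = qint (m + 2) + qint m := by
  have h := qvar_sub_inv_ne_zero
  have h0 := qvar_ne_zero
  have hm := pow_ne_zero m h0
  rw [qint_two, qint, qint, qint, ← mul_div_assoc, ← add_div]
  congr 1
  rw [pow_add, pow_add]
  field_simp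
  ring

/-- This is the three-term recursion of the quantum integers with other initial values. Therefore
`jwCoef` obeys the same recursion as the type A coefficients `[m]/[m+1]`. -/
theorem qint_two_mul_qcosh (m : ℕ) : qint 2 * qcosh (m + 1) = qcosh (m + 2) + qcosh m := by
  have h0 := qvar_ne_zero
  have hm := pow_ne_zero m h0
  rw [qint_two, qcosh, qcosh, qcosh, pow_add, pow_add]
  field_simp
  ring

theorem qcosh_zero : qcosh 0 = 2 := by norm_num [qcosh]

theorem qcosh_one : qcosh 1 = qint 2 := by rw [qint_two]; simp [qcosh]

/-! # Systems of elements satisfying the type D relations -/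

/-- Adjacency in the infinite Dynkin diagram `D_∞`. -/
def NAdj (i j : ℕ) : Prop :=
  (i = 0 ∧ j = 2) ∨ (i = 2 ∧ j = 0) ∨ (1 ≤ i ∧ j = i + 1) ∨ (1 ≤ j ∧ i = j + 1)

/-- The elements `E 0, …, E (N - 1)` satisfy the relations of the Temperley–Lieb algebra
of type `D_N`. -/
structure IsTLDSystem {B : Type*} [Ring B] [Algebra Kq B] (N : ℕ) (E : ℕ → B) : Prop where
  sq : ∀ i, i < N → E i * E i = -qint 2 • E i
  braid : ∀ i j, i < N → j < N → NAdj i j → E i * E j * E i = E i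
  comm : ∀ i j, i < N → j < N → ¬ NAdj i j → E i * E j = E j * E i

/-- The elements `E_k ⋯ E_2 (E_0 E_1) E_2 ⋯ E_k`; the value at `0` is `E_0 E_1`. -/
def forkElt {B : Type*} [Mul B] (E : ℕ → B) : ℕ → B
  | 0 => E 0 * E 1
  | 1 => E 0 * E 1
  | k + 2 => E (k + 2) * forkElt E (k + 1) * E (k + 2)

/-! ### Identities for the fork elements. -/

section Fork

attribute [local instance] Semiring.toNatAlgebra Ring.toIntAlgebra

variable {B : Type*} [Ring B] [Algebra Kq B] {N : ℕ} {E : ℕ → B}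

theorem forkElt_succ {B : Type*} [Mul B] (E : ℕ → B) {k : ℕ} (hk : 1 ≤ k) :
    forkElt E (k + 1) = E (k + 1) * forkElt E k * E (k + 1) := by
  obtain ⟨k, rfl⟩ := Nat.exists_eq_succ_of_ne_zero (by omega : k ≠ 0)
  rfl

namespace IsTLDSystem

/-- The relations are invariant under reversal of words. Right-handed versions of identities are
obtained from the left-handed ones in the opposite ring. -/
theorem op (h : IsTLDSystem N E) : IsTLDSystem N fun i => MulOpposite.op (E i) where
  sq i hi := by rw [← MulOpposite.op_mul, h.sq i hi, MulOpposite.op_smul]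
  braid i j hi hj hij := by
    rw [← MulOpposite.op_mul, ← MulOpposite.op_mul, ← mul_assoc, h.braid i j hi hj hij]
  comm i j hi hj hij := by
    rw [← MulOpposite.op_mul, ← MulOpposite.op_mul, h.comm i j hi hj hij]

theorem forkElt_op (h : IsTLDSystem N E) (hN : 2 ≤ N) (k : ℕ) :
    forkElt (fun i => MulOpposite.op (E i)) k = MulOpposite.op (forkElt E k) := by
  have hz : MulOpposite.op (E 0) * MulOpposite.op (E 1) = MulOpposite.op (E 0 * E 1) := by
    rw [← MulOpposite.op_mul, h.comm 0 1 (by omega) (by omega) (by unfold NAdj; omega)]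
  induction k with
  | zero => exact hz
  | succ k ih =>
    rcases Nat.eq_zero_or_pos k with rfl | hk
    · exact hz
    · rw [forkElt_succ _ hk, forkElt_succ _ hk, ih, ← MulOpposite.op_mul, ← MulOpposite.op_mul,
        mul_assoc]

theorem commute_forkElt (h : IsTLDSystem N E) {k m : ℕ} (hk : k + 2 ≤ m) (h3 : 3 ≤ m)
    (hm : m < N) : Commute (forkElt E k) (E m) := by
  have hc : ∀ i, i + 2 ≤ m → Commute (E i) (E m) := fun i hi =>
    h.comm i m (by omega) hm (by unfold NAdj; omega)
  have hz : Commute (E 0 * E 1) (E m) := (hc 0 (by omega)).mul_left (hc 1 (by omega))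
  induction k with
  | zero => exact hz
  | succ k ih =>
    rcases Nat.eq_zero_or_pos k with rfl | hk0
    · exact hz
    · rw [forkElt_succ _ hk0]
      exact ((hc _ (by omega)).mul_left (ih (by omega))).mul_left (hc _ (by omega))

theorem mul_forkElt_self (h : IsTLDSystem N E) (hN : 2 ≤ N) {k : ℕ} (hk : k < N) :
    E k * forkElt E k = -qint 2 • forkElt E k := by
  have h01 := h.comm 0 1 (by omega) (by omega) (by unfold NAdj; omega)
  match k with
  | 0 => rw [forkElt, ← mul_assoc, h.sq 0 hk, smul_mul_assoc]
  | 1 => rw [forkElt, h01, ← mul_assoc, h.sq 1 hk, smul_mul_assoc]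
  | k + 2 =>
    rw [forkElt, ← mul_assoc, ← mul_assoc, h.sq _ hk, smul_mul_assoc, smul_mul_assoc]

/-- By hypothesis `x` is a multiple of `E i * x`, so the braid relation applies to `E i * E j * E i
* x`, and the scalar `-[2]` cancels. -/
theorem mul_mul_of_mul_eq (h : IsTLDSystem N E) {i j : ℕ} (hi : i < N) (hj : j < N)
    (hij : NAdj i j) {x : B} (hx : E i * x = -qint 2 • x) : E i * (E j * x) = x := by
  have hs := qint_two_ne_zero
  have : -qint 2 • (E i * (E j * x)) = -qint 2 • x := by
    rw [← hx, ← mul_smul_comm, ← mul_smul_comm, ← hx, ← mul_assoc, ← mul_assoc,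
      h.braid i j hi hj hij]
  exact smul_right_injective B (neg_ne_zero.mpr hs) this

/-- The factor `E_0 E_1` inside `F_m` is a mark that can be moved to the distant factor `E_i`. The
smallest `m` is `j + 2` with `j = max i 1`, since `F_0 = F_1`; there `E_i E_{i+1} F_i` collapses
(for `i = 0` with `E_2` in the middle). Larger `m` follow from `E_{m+1} E_m E_{m+1} = E_{m+1}`. -/
theorem mul_forkElt (h : IsTLDSystem N E) {i m : ℕ} (h3 : 3 ≤ m) (him : i + 2 ≤ m) (hm : m < N) :
    E i * forkElt E m = forkElt E i * E m := by
  have key : ∀ m' j, 1 ≤ j → (j = i ∨ i = 0 ∧ j = 1) → m' = j + 2 → m' < N →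
      E i * forkElt E m' = forkElt E i * E m' := by
    rintro _ j hj hji rfl hN
    have hF : forkElt E j = forkElt E i := by rcases hji with rfl | ⟨rfl, rfl⟩ <;> rfl
    have hc : E i * E (j + 2) = E (j + 2) * E i :=
      h.comm i (j + 2) (by omega) hN (by unfold NAdj; omega)
    have e : E i * (E (j + 1) * forkElt E i) = forkElt E i :=
      h.mul_mul_of_mul_eq (by omega) (by omega) (by unfold NAdj; omega)
        (h.mul_forkElt_self (by omega) (by omega))
    have hcF : forkElt E i * E (j + 2) = E (j + 2) * forkElt E i :=
      h.commute_forkElt (by omega) (by omega) hN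
    have hb := h.braid (j + 2) (j + 1) hN (by omega) (by unfold NAdj; omega)
    calc E i * forkElt E (j + 2)
        = E i * E (j + 2) * (E (j + 1) * forkElt E j * E (j + 1)) * E (j + 2) := by
          rw [forkElt_succ E (by omega : 1 ≤ j + 1), forkElt_succ E hj]; simp only [mul_assoc]
      _ = E (j + 2) * (E i * (E (j + 1) * forkElt E i)) * (E (j + 1) * E (j + 2)) := by
          rw [hc, hF]; simp only [mul_assoc]
      _ = forkElt E i * (E (j + 2) * E (j + 1) * E (j + 2)) := by
          rw [e, ← hcF]; simp only [mul_assoc]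
      _ = _ := by rw [hb]
  obtain ⟨d, rfl⟩ := Nat.exists_eq_add_of_le h3
  have hstep : ∀ m, 3 ≤ m → i + 2 ≤ m → m + 1 < N → E i * forkElt E m = forkElt E i * E m →
      E i * forkElt E (m + 1) = forkElt E i * E (m + 1) := by
    intro m h3 him hm ih
    have hc : E i * E (m + 1) = E (m + 1) * E i :=
      h.comm i (m + 1) (by omega) hm (by unfold NAdj; omega)
    have hcF : forkElt E i * E (m + 1) = E (m + 1) * forkElt E i :=
      h.commute_forkElt (by omega) (by omega) hm
    have hb := h.braid (m + 1) m hm (by omega) (by unfold NAdj; omega)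
    rw [forkElt_succ E (by omega), ← mul_assoc, ← mul_assoc, hc, mul_assoc (E (m + 1)), ih,
      ← mul_assoc (E (m + 1)), ← hcF, mul_assoc, mul_assoc, ← mul_assoc (E (m + 1)), hb]
  have main : ∀ m, max i 1 + 2 ≤ m → m < N → E i * forkElt E m = forkElt E i * E m := by
    intro m h
    induction m, h using Nat.le_induction with
    | base => intro hN; exact key _ (max i 1) (by omega) (by omega) rfl hN
    | succ m hm ih => intro hN; exact hstep m (by omega) (by omega) hN (ih (by omega))
  exact main _ (by omega) hm

theorem forkElt_mul (h : IsTLDSystem N E) {i m : ℕ} (h3 : 3 ≤ m) (him : i + 2 ≤ m) (hm : m < N) :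
    forkElt E m * E i = E m * forkElt E i := by
  have := h.op.mul_forkElt h3 him hm
  rw [h.forkElt_op (by omega), h.forkElt_op (by omega), ← MulOpposite.op_mul,
    ← MulOpposite.op_mul] at this
  exact MulOpposite.op_injective this

/-- Both products equal `F_i E_m`. So `F_m` behaves like `E_m` towards all generators of index at
most `m - 2`. -/
theorem commute_forkElt_low (h : IsTLDSystem N E) {i m : ℕ} (h3 : 3 ≤ m) (him : i + 2 ≤ m)
    (hm : m < N) : Commute (E i) (forkElt E m) := by
  rw [Commute, SemiconjBy, h.mul_forkElt h3 him hm, h.forkElt_mul h3 him hm]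
  exact h.commute_forkElt him h3 hm

theorem forkElt_mul_mul_forkElt (h : IsTLDSystem N E) {k : ℕ} (hk : 1 ≤ k) (hN : k + 1 < N) :
    forkElt E k * E (k + 1) * forkElt E k = -qint 2 • forkElt E k := by
  induction k, hk using Nat.le_induction with
  | base =>
    have h01 := h.comm 0 1 (by omega) (by omega) (by unfold NAdj; omega)
    calc E 0 * E 1 * E 2 * (E 0 * E 1) = E 0 * (E 1 * E 2 * E 1) * E 0 := by
          conv_lhs => enter [2]; rw [h01]
          simp only [mul_assoc]
      _ = E 0 * E 0 * E 1 := by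
          rw [h.braid 1 2 (by omega) (by omega) (by unfold NAdj; omega), mul_assoc, ← h01,
            mul_assoc]
      _ = _ := by rw [h.sq 0 (by omega), smul_mul_assoc]; rfl
  | succ k hk ih =>
    have hb := h.braid (k + 1) (k + 2) (by omega) hN (by unfold NAdj; omega)
    rw [forkElt_succ E hk]
    calc _ = E (k + 1) * forkElt E k * (E (k + 1) * E (k + 2) * E (k + 1)) * forkElt E k
          * E (k + 1) := by simp only [mul_assoc]
      _ = E (k + 1) * (forkElt E k * E (k + 1) * forkElt E k) * E (k + 1) := by
          rw [hb]; simp only [mul_assoc]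
      _ = _ := by rw [ih (by omega), mul_smul_comm, smul_mul_assoc]

theorem mul_forkElt_mul_forkElt (h : IsTLDSystem N E) {k : ℕ} (hk : 1 ≤ k) (hN : k + 1 < N) :
    E (k + 1) * forkElt E k * forkElt E (k + 1) = -qint 2 • forkElt E (k + 1) := by
  rw [forkElt_succ E hk]
  calc _ = E (k + 1) * (forkElt E k * E (k + 1) * forkElt E k) * E (k + 1) := by
        simp only [mul_assoc]
    _ = _ := by rw [h.forkElt_mul_mul_forkElt hk hN, mul_smul_comm, smul_mul_assoc]

theorem mul_mul_forkElt_succ (h : IsTLDSystem N E) {k : ℕ} (hk : 1 ≤ k) (hN : k + 1 < N) :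
    E (k + 1) * E k * forkElt E (k + 1) = forkElt E (k + 1) := by
  rw [mul_assoc]
  exact h.mul_mul_of_mul_eq hN (by omega) (by unfold NAdj; omega)
    (h.mul_forkElt_self (by omega) hN)

theorem forkElt_sq (h : IsTLDSystem N E) {m : ℕ} (hm : 1 ≤ m) (hN : m + 1 < N) :
    forkElt E (m + 1) * forkElt E (m + 1) = (qint 2 * qint 2) • forkElt E (m + 1) := by
  conv_lhs => enter [1]; rw [forkElt_succ E hm]
  rw [mul_assoc, h.mul_forkElt_self (by omega) hN, mul_smul_comm,
    h.mul_forkElt_mul_forkElt hm hN, smul_smul, neg_mul_neg]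

/-- A second mark is worth only a scalar: evaluate both sides of `F_i E_m F_m = E_i F_m F_m` and
cancel `-[2]`. -/
theorem forkElt_mul_forkElt (h : IsTLDSystem N E) {i m : ℕ} (h3 : 3 ≤ m) (him : i + 2 ≤ m)
    (hm : m < N) : forkElt E i * forkElt E m = -qint 2 • (E i * forkElt E m) := by
  have hs := qint_two_ne_zero
  have h1 : forkElt E i * (E m * forkElt E m) = E i * (forkElt E m * forkElt E m) := by
    rw [← mul_assoc, ← h.mul_forkElt h3 him hm, mul_assoc]
  obtain ⟨m, rfl⟩ := Nat.exists_eq_succ_of_ne_zero (by omega : m ≠ 0)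
  rw [h.mul_forkElt_self (by omega) hm, Nat.succ_eq_add_one, h.forkElt_sq (by omega) hm,
    mul_smul_comm, mul_smul_comm] at h1
  have h2 := congrArg (fun y => (-qint 2)⁻¹ • y) h1
  simp only [smul_smul] at h2
  rw [inv_mul_cancel₀ (neg_ne_zero.mpr hs), one_smul] at h2
  rw [h2]
  congr 1
  field_simp

end IsTLDSystem

/-! ## Jones–Wenzl elements -/

/-- The coefficient of `P E_m P` in the recursion for the Jones–Wenzl elements of type `D`. -/
noncomputable def jwCoef (m : ℕ) : Kq := qcosh (m - 1) / qcosh m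

/-- The coefficient of `P F_m P` in the recursion for the Jones–Wenzl elements of type `D`, where
`F_m` is `forkElt E m`. -/
noncomputable def jwForkCoef (m : ℕ) : Kq := (jwCoef m - qint m / qint (m + 1)) / qint 2

/-- The Jones–Wenzl elements of type `D`. -/
noncomputable def jwElt (E : ℕ → B) : ℕ → B
  | 0 => 1 + (qint 2)⁻¹ • E 0
  | 1 => (1 + (qint 2)⁻¹ • E 0) * (1 + (qint 2)⁻¹ • E 1)
  | n + 2 => jwElt E (n + 1) + jwCoef (n + 2) • (jwElt E (n + 1) * E (n + 2) * jwElt E (n + 1)) +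
      jwForkCoef (n + 2) • (jwElt E (n + 1) * forkElt E (n + 2) * jwElt E (n + 1))

theorem jwElt_succ (E : ℕ → B) {n : ℕ} (hn : 1 ≤ n) :
    jwElt E (n + 1) = jwElt E n + jwCoef (n + 1) • (jwElt E n * E (n + 1) * jwElt E n) +
      jwForkCoef (n + 1) • (jwElt E n * forkElt E (n + 1) * jwElt E n) := by
  obtain ⟨k, rfl⟩ := Nat.exists_eq_succ_of_ne_zero (by omega : n ≠ 0)
  rfl

/-- This is the vanishing of the coefficient of `E_{m+2} P` when `E_{m+2}` is multiplied by the next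
Jones–Wenzl element, see `IsTLDSystem.mul_jwElt`. -/
theorem jwCoef_rec (m : ℕ) : 1 + jwCoef (m + 2) * (jwCoef (m + 1) - qint 2) = 0 := by
  have h0 := qcosh_ne_zero (m + 2)
  have h1 := qcosh_ne_zero (m + 1)
  have h := qint_two_mul_qcosh m
  simp only [jwCoef, Nat.add_sub_cancel, show m + 2 - 1 = m + 1 from rfl]
  field_simp
  linear_combination -h

theorem qint_div_rec (m : ℕ) :
    1 + qint (m + 2) / qint (m + 3) * (qint (m + 1) / qint (m + 2) - qint 2) = 0 := by
  have h0 := qint_ne_zero (m := m + 3) (by omega)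
  have h1 := qint_ne_zero (m := m + 2) (by omega)
  have h := qint_two_mul_qint (m + 1)
  field_simp
  linear_combination -h

/-- The coefficient of `F_{m+2} P` vanishes by the difference of the two preceding recursions. When
dots are forgotten, `F_m` becomes `-[2] E_m`, so `jwCoef m - [2] * jwForkCoef m` has to be the type
A coefficient `[m]/[m+1]`. -/
theorem jwForkCoef_rec (m : ℕ) :
    jwCoef (m + 2) * jwForkCoef (m + 1) +
      jwForkCoef (m + 2) * (jwCoef (m + 1) - qint 2 - qint 2 * jwForkCoef (m + 1)) = 0 := by
  have hs := qint_two_ne_zero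
  have h1 := jwCoef_rec m
  have h2 := qint_div_rec m
  simp only [jwForkCoef, add_assoc, Nat.reduceAdd]
  rw [show m + 1 + 1 = m + 2 from rfl, show m + 2 + 1 = m + 3 from rfl]
  generalize qint (m + 2) / qint (m + 3) = u at *
  generalize qint (m + 1) / qint (m + 2) = v at *
  field_simp
  linear_combination h1 - h2

theorem commute_jwElt {y : B} {k : ℕ} (hy : ∀ i ≤ k, Commute y (E i)) : Commute y (jwElt E k) := by
  have hF : ∀ j, 1 ≤ j → j ≤ k → Commute y (forkElt E j) := by
    intro j hj
    induction j, hj using Nat.le_induction with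
    | base => intro hk; exact (hy 0 (by omega)).mul_right (hy 1 hk)
    | succ j hj ih =>
      intro hk
      rw [forkElt_succ E hj]
      exact ((hy _ hk).mul_right (ih (by omega))).mul_right (hy _ hk)
  have h0 : Commute y (1 + (qint 2)⁻¹ • E 0) :=
    (Commute.one_right y).add_right ((hy 0 (by omega)).smul_right _)
  have main : ∀ j, j ≤ k → Commute y (jwElt E j) := by
    intro j
    induction j with
    | zero => intro _; exact h0
    | succ j ih =>
      intro hj
      rcases Nat.eq_zero_or_pos j with rfl | hj0
      · exact h0.mul_right ((Commute.one_right y).add_right ((hy 1 hj).smul_right _))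
      · have := ih (by omega)
        rw [jwElt_succ E hj0]
        exact (this.add_right (((this.mul_right (hy _ hj)).mul_right this).smul_right _)).add_right
          (((this.mul_right (hF _ (by omega) hj)).mul_right this).smul_right _)
  exact main k le_rfl

theorem jwElt_mul_of_kill {k : ℕ} {x : B} (hx : ∀ i ≤ k, E i * x = 0) : jwElt E k * x = x := by
  have hF : ∀ j, 1 ≤ j → j ≤ k → forkElt E j * x = 0 := by
    intro j hj hk
    obtain ⟨j, rfl⟩ := Nat.exists_eq_succ_of_ne_zero (by omega : j ≠ 0)
    rcases Nat.eq_zero_or_pos j with rfl | hj0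
    · rw [forkElt, mul_assoc, hx 1 hk, mul_zero]
    · rw [Nat.succ_eq_add_one, forkElt_succ E hj0, mul_assoc, hx _ hk, mul_zero]
  have main : ∀ j, j ≤ k → jwElt E j * x = x := by
    intro j
    induction j with
    | zero =>
      intro hj
      rw [jwElt, add_mul, smul_mul_assoc, hx 0 hj, smul_zero, one_mul, add_zero]
    | succ j ih =>
      intro hj
      rcases Nat.eq_zero_or_pos j with rfl | hj0
      · rw [jwElt, mul_assoc, add_mul _ _ x, smul_mul_assoc, hx 1 hj, smul_zero, one_mul, add_zero,
          add_mul, smul_mul_assoc, hx 0 (by omega), smul_zero, one_mul, add_zero]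
      · rw [jwElt_succ E hj0, add_mul, add_mul, smul_mul_assoc, smul_mul_assoc, mul_assoc,
          mul_assoc,
          mul_assoc (_ * forkElt _ _), mul_assoc _ (forkElt _ _), ih (by omega), hx _ hj,
          hF _ (by omega) hj, mul_zero, smul_zero, smul_zero, add_zero,
          add_zero]
  exact main k le_rfl

/-- This replaces the partial trace formula. Expand the left `P` in terms of the previous element
`R`, slide `E_{m+2}` past `R`, absorb `R` by `R P = P`, and evaluate the middle by the braid and
fork identities. For `m = 0` the previous element does not commute with `E_2`, so the product is
expanded directly. -/
theorem IsTLDSystem.mul_jwElt_succ (h : IsTLDSystem N E) {m : ℕ} (hm : m + 2 < N)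
    (hkill : ∀ i ≤ m + 1, E i * jwElt E (m + 1) = 0) :
    E (m + 2) * jwElt E (m + 1) * E (m + 2) * jwElt E (m + 1) =
      ((jwCoef (m + 1) - qint 2) • E (m + 2) + jwForkCoef (m + 1) • forkElt E (m + 2)) *
        jwElt E (m + 1) ∧
    E (m + 2) * jwElt E (m + 1) * forkElt E (m + 2) * jwElt E (m + 1) =
      (jwCoef (m + 1) - qint 2 - qint 2 * jwForkCoef (m + 1)) • forkElt E (m + 2) *
        jwElt E (m + 1) := by
  have hs := qint_two_ne_zero
  have hEE := h.sq (m + 2) hm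
  have hEF := h.mul_forkElt_self (by omega) hm
  rcases Nat.eq_zero_or_pos m with rfl | hm0
  · have hc1 : jwCoef 1 = 2 * (qint 2)⁻¹ := by
      rw [jwCoef, qcosh_one, qcosh_zero, div_eq_mul_inv]
    have hf1 : jwForkCoef 1 = (qint 2)⁻¹ * (qint 2)⁻¹ := by
      rw [jwForkCoef, hc1, qint_one]; field_simp; ring
    have hJ : jwElt E 1 = 1 + (qint 2)⁻¹ • E 0 + (qint 2)⁻¹ • E 1 +
        ((qint 2)⁻¹ * (qint 2)⁻¹) • (E 0 * E 1) := by
      rw [jwElt, add_mul, mul_add, mul_add, smul_mul_smul_comm, one_mul, one_mul, mul_one]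
      abel
    have e0 := h.braid 2 0 hm (by omega) (by unfold NAdj; omega)
    have e1 := h.braid 2 1 hm (by omega) (by unfold NAdj; omega)
    have f0 : E 2 * E 0 * forkElt E 2 = forkElt E 2 := by
      rw [mul_assoc]
      exact h.mul_mul_of_mul_eq hm (by omega) (by unfold NAdj; omega) hEF
    have f1 : E 2 * E 1 * forkElt E 2 = forkElt E 2 := h.mul_mul_forkElt_succ le_rfl hm
    have f2 : E 2 * (E 0 * E 1) * forkElt E 2 = -qint 2 • forkElt E 2 :=
      h.mul_forkElt_mul_forkElt le_rfl hm
    have f3 : E 2 * (E 0 * E 1) * E 2 = forkElt E 2 := rfl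
    simp only [Nat.zero_add] at hEE hEF ⊢
    have l1 : E 2 * jwElt E 1 * E 2 = (jwCoef 1 - qint 2) • E 2 + jwForkCoef 1 • forkElt E 2 := by
      rw [hJ, mul_add, mul_add, mul_add, add_mul, add_mul, add_mul, mul_one]
      simp only [mul_smul_comm, smul_mul_assoc]
      rw [hEE, e0, e1, f3, hc1, hf1]
      module
    have l2 : E 2 * jwElt E 1 * forkElt E 2 =
        (jwCoef 1 - qint 2 - qint 2 * jwForkCoef 1) • forkElt E 2 := by
      rw [hJ, mul_add, mul_add, mul_add, add_mul, add_mul, add_mul, mul_one]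
      simp only [mul_smul_comm, smul_mul_assoc]
      rw [hEF, f0, f1, f2, hc1, hf1]
      module
    rw [l1, l2]
    exact ⟨rfl, rfl⟩
  · set R := jwElt E m with hR
    set P := jwElt E (m + 1) with hP
    have hPR : P = R + jwCoef (m + 1) • (R * E (m + 1) * R) +
      jwForkCoef (m + 1) • (R * forkElt E (m + 1) * R) := jwElt_succ E hm0
    have hRP : R * P = P := jwElt_mul_of_kill fun i hi => hkill i (by omega)
    have cE : Commute (E (m + 2)) R := commute_jwElt fun i hi =>
      h.comm _ _ hm (by omega) (by unfold NAdj; omega)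
    have cF : Commute (forkElt E (m + 2)) R := commute_jwElt fun i hi =>
      (h.commute_forkElt_low (by omega) (by omega) hm).symm
    have e1 := h.braid (m + 2) (m + 1) hm (by omega) (by unfold NAdj; omega)
    have e2 : E (m + 2) * forkElt E (m + 1) * E (m + 2) = forkElt E (m + 2) := rfl
    have f1 := h.mul_mul_forkElt_succ (by omega : 1 ≤ m + 1) hm
    have f2 := h.mul_forkElt_mul_forkElt (by omega : 1 ≤ m + 1) hm
    have gen : ∀ X Y : B, Commute X R → E (m + 2) * (R * Y * R) * X * P =
        R * (E (m + 2) * Y * X) * P := by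
      intro X Y hX
      calc _ = (E (m + 2) * R) * Y * (R * X) * P := by simp only [mul_assoc]
        _ = R * (E (m + 2) * Y * X) * (R * P) := by
          rw [cE.eq, ← hX.eq]; simp only [mul_assoc]
        _ = _ := by rw [hRP]
    have gen1 : ∀ X : B, Commute X R → E (m + 2) * R * X * P = E (m + 2) * X * P := by
      intro X hX
      rw [mul_assoc _ R X, ← hX.eq, mul_assoc, mul_assoc, hRP, mul_assoc]
    have abE : R * E (m + 2) * P = E (m + 2) * P := by rw [← cE.eq, mul_assoc, hRP]
    have abF : R * forkElt E (m + 2) * P = forkElt E (m + 2) * P := by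
      rw [← cF.eq, mul_assoc, hRP]
    constructor
    -- Only the left factor `P` is to be expanded; the last factor is folded back so that it can
    -- absorb `R`.
    · conv_lhs => rw [hPR]
      conv_lhs => enter [2]; rw [← hPR]
      simp only [mul_add, add_mul, mul_smul_comm, smul_mul_assoc]
      rw [gen1 _ cE, gen _ _ cE, gen _ _ cE, e1, e2, abE, abF, hEE, smul_mul_assoc]
      module
    · conv_lhs => rw [hPR]
      conv_lhs => enter [2]; rw [← hPR]
      simp only [mul_add, add_mul, mul_smul_comm, smul_mul_assoc]
      rw [gen1 _ cF, gen _ _ cF, gen _ _ cF, f1, f2, hEF, mul_smul_comm, smul_mul_assoc,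
        smul_mul_assoc, abF]
      module

theorem IsTLDSystem.mul_jwElt (h : IsTLDSystem N E) {n : ℕ} (hn : n < N) {i : ℕ} (hi : i ≤ n) :
    E i * jwElt E n = 0 := by
  have hs := qint_two_ne_zero
  have base : ∀ j, j < N → E j * (1 + (qint 2)⁻¹ • E j) = 0 := by
    intro j hj
    rw [mul_add, mul_one, mul_smul_comm, h.sq j hj, smul_smul, mul_neg, inv_mul_cancel₀ hs]
    simp
  induction n generalizing i with
  | zero =>
    obtain rfl : i = 0 := by omega
    exact base 0 hn
  | succ n ih =>
    rcases Nat.eq_zero_or_pos n with rfl | hn0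
    · have h01 := h.comm 0 1 (by omega) (by omega) (by unfold NAdj; omega)
      rw [jwElt]
      rcases Nat.eq_zero_or_pos i with rfl | hi0
      · rw [← mul_assoc, base 0 (by omega), zero_mul]
      · obtain rfl : i = 1 := by omega
        have : E 1 * (1 + (qint 2)⁻¹ • E 0) = (1 + (qint 2)⁻¹ • E 0) * E 1 := by
          rw [mul_add, add_mul, mul_smul_comm, smul_mul_assoc, h01, mul_one, one_mul]
        rw [← mul_assoc, this, mul_assoc, base 1 hn, mul_zero]
    · obtain ⟨m, rfl⟩ := Nat.exists_eq_succ_of_ne_zero (by omega : n ≠ 0)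
      simp only [Nat.succ_eq_add_one] at *
      have hk : ∀ i ≤ m + 1, E i * jwElt E (m + 1) = 0 := fun i hi => ih (by omega) hi
      rcases Nat.lt_or_ge i (m + 2) with hi' | hi'
      · have := hk i (by omega)
        rw [jwElt_succ E hn0, mul_add, mul_add, mul_smul_comm, mul_smul_comm]
        simp only [← mul_assoc]
        rw [this]
        simp
      · obtain rfl : i = m + 2 := by omega
        obtain ⟨h1, h2⟩ := h.mul_jwElt_succ hn hk
        rw [jwElt_succ E hn0, mul_add, mul_add, mul_smul_comm, mul_smul_comm]
        simp only [← mul_assoc]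
        rw [h1, h2, add_mul, smul_mul_assoc, smul_mul_assoc, smul_mul_assoc, smul_add, smul_smul,
          smul_smul, smul_smul]
        have r1 := jwCoef_rec m
        have r2 := jwForkCoef_rec m
        calc _ = (1 + jwCoef (m + 2) * (jwCoef (m + 1) - qint 2)) •
                (E (m + 2) * jwElt E (m + 1)) +
              (jwCoef (m + 2) * jwForkCoef (m + 1) + jwForkCoef (m + 2) *
                (jwCoef (m + 1) - qint 2 - qint 2 * jwForkCoef (m + 1))) •
                (forkElt E (m + 2) * jwElt E (m + 1)) := by module
          _ = 0 := by rw [r1, r2, zero_smul, zero_smul, add_zero]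

theorem IsTLDSystem.jwElt_op (h : IsTLDSystem N E) (hN : 2 ≤ N) (n : ℕ) :
    jwElt (fun i => MulOpposite.op (E i)) n = MulOpposite.op (jwElt E n) := by
  induction n with
  | zero => simp [jwElt]
  | succ n ih =>
    rcases Nat.eq_zero_or_pos n with rfl | hn
    · have h01 := h.comm 0 1 (by omega) (by omega) (by unfold NAdj; omega)
      simp only [jwElt, ← MulOpposite.op_one, ← MulOpposite.op_smul, ← MulOpposite.op_add,
        ← MulOpposite.op_mul]
      congr 1
      simp only [mul_add, add_mul, mul_one, one_mul, mul_smul_comm, smul_mul_assoc, h01, smul_add]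
      abel
    · rw [jwElt_succ _ hn, jwElt_succ _ hn, ih, h.forkElt_op hN]
      simp only [← MulOpposite.op_smul, ← MulOpposite.op_add, ← MulOpposite.op_mul, mul_assoc]

theorem IsTLDSystem.jwElt_mul (h : IsTLDSystem N E) {n : ℕ} (hn : n < N) {i : ℕ} (hi : i ≤ n) :
    jwElt E n * E i = 0 := by
  rcases Nat.lt_or_ge 1 N with hN | hN
  · have := h.op.mul_jwElt hn hi
    rw [h.jwElt_op hN, ← MulOpposite.op_mul] at this
    exact MulOpposite.op_injective this
  · obtain rfl : n = 0 := by omega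
    obtain rfl : i = 0 := by omega
    have : jwElt E 0 * E 0 = E 0 * jwElt E 0 := by
      rw [jwElt, add_mul, mul_add, one_mul, mul_one, smul_mul_assoc, mul_smul_comm]
    rw [this, h.mul_jwElt hn le_rfl]

end Fork

/-! # Monomials and their reduction -/

section Monomials

variable {B : Type*} [Ring B] [Algebra Kq B] {N : ℕ} {E : ℕ → B}

/-- The scalar multiples of the words in `E 0, …, E (k - 1)`. -/
def monomials (E : ℕ → B) (k : ℕ) : Submonoid B :=
  Submonoid.closure (Set.range (algebraMap Kq B) ∪ E '' Set.Iio k)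

theorem algebraMap_mem_monomials (c : Kq) (k : ℕ) : algebraMap Kq B c ∈ monomials E k :=
  Submonoid.subset_closure (Or.inl ⟨c, rfl⟩)

theorem mem_monomials {i k : ℕ} (h : i < k) : E i ∈ monomials E k :=
  Submonoid.subset_closure (Or.inr ⟨i, h, rfl⟩)

theorem smul_mem_monomials {k : ℕ} {x : B} (c : Kq) (h : x ∈ monomials E k) :
    c • x ∈ monomials E k := by
  rw [Algebra.smul_def]
  exact mul_mem (algebraMap_mem_monomials c k) h

theorem monomials_mono {k l : ℕ} (h : k ≤ l) : monomials E k ≤ monomials E l :=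
  Submonoid.closure_mono (Set.union_subset_union_right _
    (Set.image_mono (Set.Iio_subset_Iio h)))

theorem commute_of_mem_monomials {k : ℕ} {x y : B} (hy : ∀ i < k, Commute y (E i))
    (hx : x ∈ monomials E k) : Commute y x := by
  induction hx using Submonoid.closure_induction with
  | mem z hz =>
    rcases hz with ⟨c, rfl⟩ | ⟨i, hi, rfl⟩
    · exact (Algebra.commutes c y).symm
    · exact hy i hi
  | one => exact Commute.one_right y
  | mul a b _ _ ha hb => exact ha.mul_right hb

theorem monomials_succ_induction {k : ℕ} {P : B → Prop} (h1 : P 1)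
    (hm : ∀ a ∈ monomials E k, ∀ b, P b → P (a * b)) (hE : ∀ b, P b → P (E k * b)) {x : B}
    (hx : x ∈ monomials E (k + 1)) : P x := by
  induction hx using Submonoid.closure_induction_left with
  | one => exact h1
  | mul_left a ha b _ hb =>
    rcases ha with ⟨c, rfl⟩ | ⟨i, hi, rfl⟩
    · exact hm _ (algebraMap_mem_monomials c k) b hb
    · rcases Nat.lt_succ_iff_lt_or_eq.mp hi with hi | rfl
      · exact hm _ (mem_monomials hi) b hb
      · exact hE b hb

/-- The number of generators that are needed for the part of `E_m TL E_m` that commutes with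
`E_m`. -/
def lowIndex (m : ℕ) : ℕ := if m = 2 then 0 else m - 1

/-- Sandwiching a monomial in the generators below `m` between `E_m` and `E_m`, or between `E_m` and
`forkElt E m`, gives a multiple of `E_m` or `forkElt E m`. -/
def Sandwich (E : ℕ → B) (m : ℕ) : Prop :=
  ∀ t ∈ monomials E m,
    (∃ u ∈ monomials E (lowIndex m), E m * t * E m = u * E m ∨ E m * t * E m = u * forkElt E m) ∧
    ∃ u ∈ monomials E (lowIndex m), E m * t * forkElt E m = u * forkElt E m

theorem lowIndex_le (m : ℕ) : lowIndex m ≤ m := by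
  unfold lowIndex; split <;> omega

/-- A normal form with at most one factor `E_m` or `F_m`: whenever a second `E_m` appears on the
left, the hypothesis merges it with the existing factor. -/
theorem Sandwich.decomp {m : ℕ} (h : Sandwich E m) {t : B} (ht : t ∈ monomials E (m + 1)) :
    t ∈ monomials E m ∨ ∃ u ∈ monomials E m, ∃ v ∈ monomials E m,
      t = u * E m * v ∨ t = u * forkElt E m * v := by
  refine monomials_succ_induction (P := fun t => t ∈ monomials E m ∨ ∃ u ∈ monomials E m,
    ∃ v ∈ monomials E m, t = u * E m * v ∨ t = u * forkElt E m * v)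
    (Or.inl (one_mem _)) ?_ ?_ ht
  · rintro a ha b (hb | ⟨u, hu, v, hv, rfl | rfl⟩)
    · exact Or.inl (mul_mem ha hb)
    · exact Or.inr ⟨a * u, mul_mem ha hu, v, hv, Or.inl (by simp only [mul_assoc])⟩
    · exact Or.inr ⟨a * u, mul_mem ha hu, v, hv, Or.inr (by simp only [mul_assoc])⟩
  · rintro b (hb | ⟨u, hu, v, hv, rfl | rfl⟩)
    · exact Or.inr ⟨1, one_mem _, b, hb, Or.inl (by rw [one_mul])⟩
    · obtain ⟨⟨w, hw, e | e⟩, _⟩ := h u hu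
      · exact Or.inr ⟨w, monomials_mono (lowIndex_le m) hw, v, hv,
          Or.inl (by rw [← e]; simp only [mul_assoc])⟩
      · exact Or.inr ⟨w, monomials_mono (lowIndex_le m) hw, v, hv,
          Or.inr (by rw [← e]; simp only [mul_assoc])⟩
    · obtain ⟨_, w, hw, e⟩ := h u hu
      exact Or.inr ⟨w, monomials_mono (lowIndex_le m) hw, v, hv,
        Or.inr (by rw [← e]; simp only [mul_assoc])⟩

theorem IsTLDSystem.mem_monomials_two (h : IsTLDSystem N E) (hN : 2 ≤ N) {t : B}
    (ht : t ∈ monomials E 2) :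
    ∃ c : Kq, t = c • 1 ∨ t = c • E 0 ∨ t = c • E 1 ∨ t = c • (E 0 * E 1) := by
  have h01 := h.comm 0 1 (by omega) (by omega) (by unfold NAdj; omega)
  induction ht using Submonoid.closure_induction_left with
  | one => exact ⟨1, Or.inl (one_smul _ _).symm⟩
  | mul_left a ha b _ hb =>
    obtain ⟨c, hc⟩ := hb
    rcases ha with ⟨d, rfl⟩ | ⟨i, hi, rfl⟩
    · refine ⟨d * c, ?_⟩
      rcases hc with rfl | rfl | rfl | rfl <;>
        simp only [← Algebra.smul_def, smul_smul, true_or, or_true]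
    · have hi' : i = 0 ∨ i = 1 := by have : i < 2 := hi; omega
      have s0 := h.sq 0 (by omega)
      have s1 := h.sq 1 (by omega)
      rcases hi' with rfl | rfl
      · rcases hc with rfl | rfl | rfl | rfl
        · exact ⟨c, by simp⟩
        · exact ⟨c * -qint 2, by simp only [mul_smul_comm, s0, smul_smul, true_or, or_true]⟩
        · exact ⟨c, by simp⟩
        · exact ⟨c * -qint 2, by
            simp only [mul_smul_comm, ← mul_assoc, s0, smul_mul_assoc, smul_smul, or_true]⟩
      · rcases hc with rfl | rfl | rfl | rfl
        · exact ⟨c, by simp⟩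
        · exact ⟨c, by simp only [mul_smul_comm, h01, or_true]⟩
        · exact ⟨c * -qint 2, by simp only [mul_smul_comm, s1, smul_smul, true_or, or_true]⟩
        · exact ⟨c * -qint 2, by
            simp only [mul_smul_comm, h01, ← mul_assoc, s1, smul_mul_assoc, smul_smul, or_true]⟩

/-- Neither `E_0` nor `E_1` commutes with `E_2`, so only scalars survive here; this is why `lowIndex
2` is 0. The product `E_0 E_1` in the middle creates `F_2`. -/
theorem IsTLDSystem.sandwich_two (h : IsTLDSystem N E) (hN : 2 < N) : Sandwich E 2 := by
  have hEF := h.mul_forkElt_self (by omega) hN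
  intro t ht
  have hu : ∀ c : Kq, algebraMap Kq B c ∈ monomials E (lowIndex 2) := fun c =>
    algebraMap_mem_monomials c _
  obtain ⟨c, rfl | rfl | rfl | rfl⟩ := h.mem_monomials_two (by omega) ht
  · refine ⟨⟨_, hu (c * -qint 2), Or.inl ?_⟩, ⟨_, hu (c * -qint 2), ?_⟩⟩
    · rw [mul_smul_comm, mul_one, smul_mul_assoc, h.sq 2 hN, smul_smul, Algebra.smul_def]
    · rw [mul_smul_comm, mul_one, smul_mul_assoc, hEF, smul_smul, Algebra.smul_def]
  · refine ⟨⟨_, hu c, Or.inl ?_⟩, ⟨_, hu c, ?_⟩⟩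
    · rw [mul_smul_comm, smul_mul_assoc, h.braid 2 0 hN (by omega) (by unfold NAdj; omega),
        Algebra.smul_def]
    · rw [mul_smul_comm, smul_mul_assoc, mul_assoc,
        h.mul_mul_of_mul_eq hN (by omega) (by unfold NAdj; omega) hEF, Algebra.smul_def]
  · refine ⟨⟨_, hu c, Or.inl ?_⟩, ⟨_, hu c, ?_⟩⟩
    · rw [mul_smul_comm, smul_mul_assoc, h.braid 2 1 hN (by omega) (by unfold NAdj; omega),
        Algebra.smul_def]
    · rw [mul_smul_comm, smul_mul_assoc, mul_assoc,
        h.mul_mul_of_mul_eq hN (by omega) (by unfold NAdj; omega) hEF, Algebra.smul_def]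
  · refine ⟨⟨_, hu c, Or.inr ?_⟩, ⟨_, hu (c * -qint 2), ?_⟩⟩
    · rw [mul_smul_comm, smul_mul_assoc, Algebra.smul_def]; rfl
    · have := h.mul_forkElt_mul_forkElt le_rfl hN
      simp only [forkElt, Nat.reduceAdd] at this ⊢
      rw [mul_smul_comm, smul_mul_assoc, this, smul_smul, Algebra.smul_def]

/-- By the normal form the middle is `t`, `u E_m v` or `u F_m v`. The factors `t`, `u`, `v` use only
indices below `m` and commute with `E_{m+1}` and `F_{m+1}`, so the claim reduces to the products of
`E_{m+1}`, of `E_m` or `F_m`, and of `E_{m+1}` or `F_{m+1}`. -/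
theorem IsTLDSystem.sandwich_succ (h : IsTLDSystem N E) {m : ℕ} (hm : 2 ≤ m) (hN : m + 1 < N)
    (hs : Sandwich E m) : Sandwich E (m + 1) := by
  have hlow : lowIndex (m + 1) = m := by unfold lowIndex; rw [if_neg (by omega)]; omega
  have cE : ∀ u ∈ monomials E m, E (m + 1) * u = u * E (m + 1) := fun u hu =>
    commute_of_mem_monomials (fun i hi => h.comm _ _ hN (by omega) (by unfold NAdj; omega)) hu
  have cF : ∀ u ∈ monomials E m, forkElt E (m + 1) * u = u * forkElt E (m + 1) := fun u hu =>
    commute_of_mem_monomials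
      (fun i hi => (h.commute_forkElt_low (by omega) (by omega) hN).symm) hu
  have hEF := h.mul_forkElt_self (by omega) hN
  have hb := h.braid (m + 1) m hN (by omega) (by unfold NAdj; omega)
  have gen : ∀ u v X Y Z : B, u ∈ monomials E m → v ∈ monomials E m → X * v = v * X →
      E (m + 1) * Y * X = Z → Z * v = v * Z → E (m + 1) * (u * Y * v) * X = u * v * Z := by
    intro u v X Y Z hu hv hX hZ hZv
    calc _ = (E (m + 1) * u) * Y * (v * X) := by simp only [mul_assoc]
      _ = u * (E (m + 1) * Y * X) * v := by rw [cE u hu, ← hX]; simp only [mul_assoc]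
      _ = _ := by rw [hZ, mul_assoc, hZv, mul_assoc]
  intro t ht
  rw [hlow]
  rcases hs.decomp ht with ht | ⟨u, hu, v, hv, rfl | rfl⟩
  · refine ⟨⟨-qint 2 • t, smul_mem_monomials _ ht, Or.inl ?_⟩,
      ⟨-qint 2 • t, smul_mem_monomials _ ht, ?_⟩⟩
    · rw [cE t ht, mul_assoc, h.sq _ hN, mul_smul_comm, smul_mul_assoc]
    · rw [cE t ht, mul_assoc, hEF, mul_smul_comm, smul_mul_assoc]
  · exact ⟨⟨u * v, mul_mem hu hv, Or.inl (gen u v _ _ _ hu hv (cE v hv) hb (cE v hv))⟩,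
      ⟨u * v, mul_mem hu hv, gen u v _ _ _ hu hv (cF v hv)
        (h.mul_mul_forkElt_succ (by omega) hN) (cF v hv)⟩⟩
  · refine ⟨⟨u * v, mul_mem hu hv, Or.inr (gen u v _ _ _ hu hv (cE v hv)
      (forkElt_succ E (by omega)).symm (cF v hv))⟩,
      ⟨-qint 2 • (u * v), smul_mem_monomials _ (mul_mem hu hv), ?_⟩⟩
    rw [gen u v _ _ _ hu hv (cF v hv) (h.mul_forkElt_mul_forkElt (by omega) hN)
      (by rw [smul_mul_assoc, cF v hv, mul_smul_comm]), smul_mul_assoc, mul_smul_comm]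

theorem IsTLDSystem.sandwich (h : IsTLDSystem N E) {m : ℕ} (hm : 2 ≤ m) (hN : m < N) :
    Sandwich E m := by
  induction m, hm using Nat.le_induction with
  | base => exact h.sandwich_two hN
  | succ m hm ih => exact h.sandwich_succ hm hN (ih (by omega))

/-- In contrast to `Sandwich`, the middle may contain `E_m` itself; such factors are merged from the
left one at a time. -/
theorem IsTLDSystem.corner (h : IsTLDSystem N E) {m : ℕ} (hm : 2 ≤ m) (hN : m < N) {t : B}
    (ht : t ∈ monomials E (m + 1)) : ∃ u ∈ monomials E (lowIndex m),
      E m * t * E m = u * E m ∨ E m * t * E m = u * forkElt E m := by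
  have hs := h.sandwich hm hN
  have key : ∃ u ∈ monomials E m, t * E m = u * E m ∨ t * E m = u * forkElt E m := by
    refine monomials_succ_induction (P := fun t => ∃ u ∈ monomials E m,
      t * E m = u * E m ∨ t * E m = u * forkElt E m) ⟨1, one_mem _, Or.inl rfl⟩ ?_ ?_ ht
    · rintro a ha b ⟨u, hu, e | e⟩
      · exact ⟨a * u, mul_mem ha hu, Or.inl (by rw [mul_assoc, e, mul_assoc])⟩
      · exact ⟨a * u, mul_mem ha hu, Or.inr (by rw [mul_assoc, e, mul_assoc])⟩
    · rintro b ⟨u, hu, e | e⟩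
      · obtain ⟨⟨w, hw, e' | e'⟩, _⟩ := hs u hu
        · exact ⟨w, monomials_mono (lowIndex_le m) hw,
            Or.inl (by rw [mul_assoc, e, ← mul_assoc, e'])⟩
        · exact ⟨w, monomials_mono (lowIndex_le m) hw,
            Or.inr (by rw [mul_assoc, e, ← mul_assoc, e'])⟩
      · obtain ⟨_, w, hw, e'⟩ := hs u hu
        exact ⟨w, monomials_mono (lowIndex_le m) hw,
          Or.inr (by rw [mul_assoc, e, ← mul_assoc, e'])⟩
  obtain ⟨u, hu, e | e⟩ := key
  · obtain ⟨⟨w, hw, e'⟩, _⟩ := hs u hu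
    exact ⟨w, hw, by rwa [mul_assoc, e, ← mul_assoc]⟩
  · obtain ⟨_, w, hw, e'⟩ := hs u hu
    exact ⟨w, hw, Or.inr (by rw [mul_assoc, e, ← mul_assoc, e'])⟩

end Monomials

/-! # The type D algebra -/

/-- The generators of `TL^D_N`, indexed by the natural numbers and extended by zero. -/
noncomputable def genN (N i : ℕ) : TLD N := if h : i < N then genE ⟨i, h⟩ else 0

theorem genN_of_lt {N i : ℕ} (h : i < N) : genN N i = genE ⟨i, h⟩ := dif_pos h

theorem genN_val {N : ℕ} (i : Fin N) : genN N i.val = genE i := genN_of_lt i.2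

theorem isTLDSystem_genN (N : ℕ) : IsTLDSystem N (genN N) where
  sq i hi := by rw [genN_of_lt hi]; exact genE_sq _
  braid i j hi hj h := by
    rw [genN_of_lt hi, genN_of_lt hj]
    exact genE_braid h
  comm i j hi hj h := by
    rw [genN_of_lt hi, genN_of_lt hj]
    exact genE_comm h

/-- The homomorphism from `TL^D_N` given by elements that satisfy its relations. -/
noncomputable def liftTLD {B : Type*} [Ring B] [Algebra Kq B] {N : ℕ} {E : ℕ → B}
    (h : IsTLDSystem N E) : TLD N →ₐ[Kq] B :=
  RingQuot.liftAlgHom Kq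
    ⟨FreeAlgebra.lift Kq (fun i : Fin N => E i), by
      intro a b hab
      cases hab with
      | sq i =>
        rw [map_mul, map_smul, FreeAlgebra.lift_ι_apply]
        exact h.sq i i.2
      | braid i j hij => simpa using h.braid i j i.2 j.2 hij
      | comm i j hij => simpa using h.comm i j i.2 j.2 hij⟩

theorem liftTLD_genE {B : Type*} [Ring B] [Algebra Kq B] {N : ℕ} {E : ℕ → B}
    (h : IsTLDSystem N E) (i : Fin N) : liftTLD h (genE i) = E i := by
  simp [liftTLD, genE]

theorem liftTLD_genN {B : Type*} [Ring B] [Algebra Kq B] {N : ℕ} {E : ℕ → B}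
    (h : IsTLDSystem N E) {i : ℕ} (hi : i < N) : liftTLD h (genN N i) = E i := by
  rw [genN_of_lt hi, liftTLD_genE]

theorem inclTLD_genE {M N : ℕ} (h : M ≤ N) (i : Fin M) :
    inclTLD h (genE i) = genE (Fin.castLE h i) := by
  simp only [inclTLD, genE, RingQuot.liftAlgHom_mkAlgHom_apply, FreeAlgebra.lift_ι_apply]

theorem inclTLD_genN {M N : ℕ} (h : M ≤ N) {i : ℕ} (hi : i < M) :
    inclTLD h (genN M i) = genN N i := by
  rw [genN_of_lt hi, genN_of_lt (by omega), inclTLD_genE]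
  rfl

theorem wordE_cons {N : ℕ} (i : Fin N) (w : List (Fin N)) :
    wordE (i :: w) = genE i * wordE w := by simp [wordE]

theorem wordE_append {N : ℕ} (w w' : List (Fin N)) :
    wordE (w ++ w') = wordE w * wordE w' := by simp [wordE]

theorem TLD.induction {N : ℕ} {P : TLD N → Prop} (hadd : ∀ x y, P x → P y → P (x + y))
    (hsmul : ∀ (c : Kq) x, P x → P (c • x)) (hword : ∀ w, P (wordE w)) (x : TLD N) : P x := by
  obtain ⟨y, rfl⟩ := exists_reducedExpansion x
  have h0 : P 0 := by simpa using hsmul 0 _ (hword [])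
  exact Finset.sum_induction _ P hadd h0 fun v _ => hsmul _ _ (hword v.1)

/-! ### The augmentation, and existence and uniqueness of the projections. -/

theorem isTLDSystem_zero (N : ℕ) : IsTLDSystem N fun _ => (0 : Kq) :=
  ⟨by simp, by simp, by simp⟩

/-- The augmentation of `TL^D_N`, which sends every `E_i` to zero. -/
noncomputable def augTLD (N : ℕ) : TLD N →ₐ[Kq] Kq := liftTLD (isTLDSystem_zero N)

theorem augTLD_wordE_cons {N : ℕ} (i : Fin N) (w : List (Fin N)) :
    augTLD N (wordE (i :: w)) = 0 := by
  rw [wordE_cons, map_mul, augTLD, liftTLD_genE, zero_mul]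

theorem augTLD_wordE_nil {N : ℕ} : augTLD N (wordE ([] : List (Fin N))) = 1 := by
  simp [wordE]

/-- A nonempty word ends in a letter that kills `v`, so only the empty word contributes. The
uniqueness statements rest on this principle and its two variants for multiplication. -/
theorem smul_eq_of_kill {N : ℕ} {V : Type*} [AddCommGroup V] [Module Kq V]
    (f : TLD N →ₐ[Kq] Module.End Kq V) {v : V} (hv : ∀ i, f (genE i) v = 0) (x : TLD N) :
    f x v = augTLD N x • v := by
  induction x using TLD.induction with
  | hadd x y hx hy => rw [map_add, map_add, LinearMap.add_apply, hx, hy, add_smul]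
  | hsmul c x hx => rw [map_smul, map_smul, LinearMap.smul_apply, hx, smul_assoc]
  | hword w =>
    induction w with
    | nil => rw [augTLD_wordE_nil]; simp [wordE]
    | cons i w ih =>
      rw [augTLD_wordE_cons, zero_smul, wordE_cons, map_mul, Module.End.mul_apply, ih, map_smul,
        hv, smul_zero]

theorem mul_incl_of_kill {M N : ℕ} (h : M ≤ N) {Q : TLD N} (hQ : ∀ i, genE i * Q = 0)
    (x : TLD M) : inclTLD h x * Q = augTLD M x • Q := by
  induction x using TLD.induction with
  | hadd x y hx hy => rw [map_add, map_add, add_mul, hx, hy, add_smul]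
  | hsmul c x hx => rw [map_smul, map_smul, smul_mul_assoc, hx, smul_assoc]
  | hword w =>
    induction w with
    | nil => rw [augTLD_wordE_nil]; simp [wordE]
    | cons i w ih =>
      rw [augTLD_wordE_cons, zero_smul, wordE_cons, map_mul, mul_assoc, ih, mul_smul_comm,
        inclTLD_genE, hQ, smul_zero]

theorem incl_mul_of_kill {M N : ℕ} (h : M ≤ N) {Q : TLD N} (hQ : ∀ i, Q * genE i = 0)
    (x : TLD M) : Q * inclTLD h x = augTLD M x • Q := by
  induction x using TLD.induction with
  | hadd x y hx hy => rw [map_add, map_add, mul_add, hx, hy, add_smul]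
  | hsmul c x hx => rw [map_smul, map_smul, mul_smul_comm, hx, smul_assoc]
  | hword w =>
    cases w with
    | nil => rw [augTLD_wordE_nil]; simp [wordE]
    | cons i w =>
      rw [augTLD_wordE_cons, zero_smul, wordE_cons, map_mul, ← mul_assoc, inclTLD_genE, hQ,
        zero_mul]

/-- The Jones–Wenzl projection `Q_n` of type `D`. -/
noncomputable def jwD (n : ℕ) : TLD (n + 1) := jwElt (genN (n + 1)) n

theorem genE_mul_jwD {n : ℕ} (i : Fin (n + 1)) : genE i * jwD n = 0 := by
  rw [← genN_val]
  exact (isTLDSystem_genN (n + 1)).mul_jwElt (by omega) (by omega)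

theorem jwD_mul_genE {n : ℕ} (i : Fin (n + 1)) : jwD n * genE i = 0 := by
  rw [← genN_val]
  exact (isTLDSystem_genN (n + 1)).jwElt_mul (by omega) (by omega)

theorem map_jwElt_eq_one {B C : Type*} [Ring B] [Algebra Kq B] [Ring C] [Algebra Kq C]
    (f : B →ₐ[Kq] C) {E : ℕ → B} {n : ℕ} (h : ∀ i ≤ n, f (E i) = 0) : f (jwElt E n) = 1 := by
  have main : ∀ j, j ≤ n → f (jwElt E j) = 1 := by
    intro j
    induction j with
    | zero => intro hj; simp [jwElt, h 0 hj]
    | succ j ih =>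
      intro hj
      rcases Nat.eq_zero_or_pos j with rfl | hj0
      · simp [jwElt, h 0 (by omega), h 1 hj]
      · rw [jwElt_succ E hj0, forkElt_succ E hj0]
        simp [h _ hj, ih (by omega)]
  exact main n le_rfl

theorem augTLD_jwD (n : ℕ) : augTLD (n + 1) (jwD n) = 1 :=
  map_jwElt_eq_one _ fun i hi => liftTLD_genN _ (by omega)

theorem isJonesWenzlD_jwD : IsJonesWenzlD jwD := by
  intro n
  refine ⟨fun h => ?_, fun i hi => ⟨?_, ?_⟩, fun i => ⟨genE_mul_jwD i, jwD_mul_genE i⟩⟩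
  · have := augTLD_jwD n
    rw [h, map_zero] at this
    exact zero_ne_one this
  · rw [incl_mul_of_kill _ jwD_mul_genE, augTLD_jwD, one_smul]
  · rw [mul_incl_of_kill _ genE_mul_jwD, augTLD_jwD, one_smul]

theorem inclTLD_self {N : ℕ} (x : TLD N) : inclTLD le_rfl x = x := by
  induction x using TLD.induction with
  | hadd x y hx hy => rw [map_add, hx, hy]
  | hsmul c x hx => rw [map_smul, hx]
  | hword w =>
    induction w with
    | nil => simp [wordE]
    | cons i w ih => rw [wordE_cons, map_mul, ih, inclTLD_genE]; rfl

theorem eq_one_of_smul_eq {B : Type*} [Ring B] [Algebra Kq B] {c : Kq} {x : B} (h : c • x = x)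
    (hx : x ≠ 0) : c = 1 := by
  have : (c - 1) • x = 0 := by rw [sub_smul, h, one_smul, sub_self]
  exact sub_eq_zero.mp ((smul_eq_zero.mp this).resolve_right hx)

/-- Since `Q n` is a nonzero idempotent, its augmentation is 1. The product `jwD n * Q n` is then `Q
n` by the left factor and `jwD n` by the right one. -/
theorem IsJonesWenzlD.eq_jwD {Q : (n : ℕ) → TLD (n + 1)} (hQ : IsJonesWenzlD Q) : Q = jwD := by
  funext n
  obtain ⟨h0, hi, hE⟩ := hQ n
  have h1 : augTLD (n + 1) (Q n) • Q n = Q n := by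
    rw [← mul_incl_of_kill le_rfl (fun i => (hE i).1)]
    exact (hi n le_rfl).2
  have ha : augTLD (n + 1) (Q n) = 1 := eq_one_of_smul_eq h1 h0
  have e1 := mul_incl_of_kill le_rfl (fun i => (hE i).1) (jwD n)
  have e2 := incl_mul_of_kill le_rfl (fun i => jwD_mul_genE (n := n) i) (Q n)
  rw [inclTLD_self] at e1 e2
  rw [augTLD_jwD, one_smul] at e1
  rw [ha, one_smul] at e2
  rw [← e1, e2]

/-! # Rejoining strands -/

section Rejoin

variable {α : Type*} [DecidableEq α]

/-- Join the points `a` and `b` of a matching `m`, and join their former partners. -/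
def rejoin (m : α → α) (a b x : α) : α :=
  if x = a then b else if x = b then a
  else if x = m a then m b else if x = m b then m a
  else m x

/-- The dots after joining the points `a` and `b` by a strand with label `e`. -/
def redot (m : α → α) (dot : α → Bool) (a b : α) (e : Bool) (x : α) : Bool :=
  if x = a ∨ x = b then e
  else if x = m a ∨ x = m b then xor (xor (dot a) (dot b)) e
  else dot x

variable {m : α → α} {dot : α → Bool} {a b c d : α} {e f : Bool}

theorem rejoin_rejoin (hm : ∀ x, m (m x) = x) (hne : ∀ x, m x ≠ x) (hab : a ≠ b) (x : α) :
    rejoin m a b (rejoin m a b x) = x := by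
  have := hm a; have := hm b; have := hm x; have := hne a; have := hne b
  grind (splits := 40) (ematch := 20) (gen := 20) (instances := 5000) [rejoin]

theorem rejoin_ne (hm : ∀ x, m (m x) = x) (hne : ∀ x, m x ≠ x) (hab : a ≠ b) (x : α) :
    rejoin m a b x ≠ x := by
  have := hm a; have := hm b; have := hm x; have := hne x; have := hne a; have := hne b
  grind (splits := 40) (ematch := 20) (gen := 20) (instances := 5000) [rejoin]

theorem redot_rejoin (hm : ∀ x, m (m x) = x) (hne : ∀ x, m x ≠ x)
    (hd : ∀ x, dot (m x) = dot x) (hab : a ≠ b) (x : α) :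
    redot m dot a b e (rejoin m a b x) = redot m dot a b e x := by
  have := hm a; have := hm b; have := hm x; have := hd x; have := hd a; have := hd b
  have := hne a; have := hne b
  grind (splits := 40) (ematch := 20) (gen := 20) (instances := 5000) [rejoin, redot]

theorem rejoin_left : rejoin m a b a = b := by simp [rejoin]

theorem rejoin_right (hab : a ≠ b) : rejoin m a b b = a := by simp [rejoin, hab.symm]

theorem redot_left : redot m dot a b e a = e := by simp [redot]

theorem redot_right : redot m dot a b e b = e := by simp [redot]

theorem rejoin_of_eq (hm : ∀ x, m (m x) = x) (h : m a = b) : rejoin m a b = m := by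
  funext x
  have := hm a; have := hm x
  grind (splits := 40) (ematch := 20) (gen := 20) (instances := 5000) [rejoin]

theorem redot_of_eq (hm : ∀ x, m (m x) = x) (hd : ∀ x, dot (m x) = dot x) (h : m a = b)
    (he : dot a = e) : redot m dot a b e = dot := by
  funext x
  have := hm a; have := hd a
  grind [redot]

theorem rejoin_comm_of_disjoint (hm : ∀ x, m (m x) = x) (hne : ∀ x, m x ≠ x) (hab : a ≠ b)
    (hcd : c ≠ d) (hac : a ≠ c) (had : a ≠ d) (hbc : b ≠ c) (hbd : b ≠ d) :
    rejoin (rejoin m a b) c d = rejoin (rejoin m c d) a b := by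
  funext x
  have := hm a; have := hm b; have := hm c; have := hm d; have := hm x
  have := hne a; have := hne b; have := hne c; have := hne d; have := hne x
  grind (splits := 40) (ematch := 20) (gen := 20) (instances := 5000) [rejoin]

theorem redot_comm_of_disjoint (hm : ∀ x, m (m x) = x) (hne : ∀ x, m x ≠ x)
    (hd : ∀ x, dot (m x) = dot x) (hab : a ≠ b)
    (hcd : c ≠ d) (hac : a ≠ c) (had : a ≠ d) (hbc : b ≠ c) (hbd : b ≠ d) :
    redot (rejoin m a b) (redot m dot a b e) c d f =
      redot (rejoin m c d) (redot m dot c d f) a b e := by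
  funext x
  -- The label of a joined strand is hidden behind an abstract `X`, of which only symmetry and
  -- independence of the order of joining are kept; what remains is reasoning about equalities.
  obtain ⟨X, hX⟩ : ∃ X : Bool → Bool → Bool → Bool, X = fun p q e => xor (xor p q) e := ⟨_, rfl⟩
  have h1 : ∀ p q e, X p q e = X q p e := by subst hX; decide
  have h2 : ∀ p q r e f, X (X p q e) r f = X p (X q r f) e := by subst hX; decide
  have hr : ∀ (m : α → α) (dot : α → Bool) (a b : α) (e : Bool) (x : α), redot m dot a b e x =
      if x = a ∨ x = b then e else if x = m a ∨ x = m b then X (dot a) (dot b) e else dot x := by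
    intros; subst hX; rfl
  clear hX
  have hr1 := hr m dot a b e
  have hr2 := hr m dot c d f
  have hr3 := hr (rejoin m a b) (redot m dot a b e) c d f
  have hr4 := hr (rejoin m c d) (redot m dot c d f) a b e
  clear hr
  have := hm a; have := hm b; have := hm c; have := hm d; have := hm x
  have := hne a; have := hne b; have := hne c; have := hne d; have := hne x
  have := hd a; have := hd b; have := hd c; have := hd d; have := hd x
  grind (splits := 40) (ematch := 20) (gen := 20) (instances := 5000) [rejoin]

theorem rejoin_braid (hm : ∀ x, m (m x) = x) (hne : ∀ x, m x ≠ x) (hab : a ≠ b)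
    (hbc : b ≠ c) (hac : a ≠ c) :
    rejoin (rejoin (rejoin m a b) b c) a b = rejoin m a b := by
  funext x
  have := hm a; have := hm b; have := hm c; have := hm x
  have := hne a; have := hne b; have := hne c; have := hne x
  grind (splits := 40) (ematch := 20) (gen := 20) (instances := 5000) [rejoin]

theorem rejoin_braid' (hm : ∀ x, m (m x) = x) (hne : ∀ x, m x ≠ x) (hab : a ≠ b)
    (hbc : b ≠ c) (hac : a ≠ c) :
    rejoin (rejoin (rejoin m b c) a b) b c = rejoin m b c := by
  funext x
  have := hm a; have := hm b; have := hm c; have := hm x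
  have := hne a; have := hne b; have := hne c; have := hne x
  grind (splits := 40) (ematch := 20) (gen := 20) (instances := 5000) [rejoin]

end Rejoin

/-! ### Planarity and loop counts under rejoining. -/

section Noncrossing

variable {α : Type*} {m : α → α} {a b c d : α}

/-- Noncrossing is required in one direction only. If the strand at `y` reached out to the left of
`x`, the condition for its other end would contradict `y < m x`. -/
theorem noncrossing_inside [LinearOrder α] (hm : ∀ x, m (m x) = x)
    (hnc : ∀ x y, x < y → y < m x → m y < m x) {x y : α} (h1 : x < y) (h2 : y < m x) :
    x < m y := by
  have h3 := hnc x y h1 h2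
  rcases lt_trichotomy x (m y) with h | h | h
  · exact h
  · rw [h, hm] at h2; exact absurd h2 (lt_irrefl _)
  · have := hnc (m y) x h (by rw [hm]; exact h1)
    rw [hm] at this
    exact absurd (h2.trans this) (lt_irrefl _)

/-- By `hcov` no point lies between `a` and `b`, so the new strand encloses nothing, and the strand
that joins their partners runs along the old ones. -/
theorem rejoin_noncrossing [LinearOrder α] (hm : ∀ x, m (m x) = x) (hne : ∀ x, m x ≠ x)
    (hnc : ∀ x y, x < y → y < m x → m y < m x) (hab : a < b) (hcov : ∀ z, z ≤ a ∨ b ≤ z)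
    (x y : α) (h1 : x < y) (h2 : y < rejoin m a b x) : rejoin m a b y < rejoin m a b x := by
  have hin : ∀ x y, x < y → y < m x → x < m y := fun x y => noncrossing_inside hm hnc
  have e1 := hm a; have e2 := hm b; have e3 := hm x; have e4 := hm y
  have n1 := hne a; have n2 := hne b; have n3 := hne x; have n4 := hne y
  have c1 := hcov x; have c2 := hcov y; have c3 := hcov (m a); have c4 := hcov (m b)
  have c5 := hcov (m x); have c6 := hcov (m y)
  grind (splits := 40) [rejoin]

variable [DecidableEq α]

/-- The number of loops does not depend on the order. In the essential case `h3` neither pair is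
joined at first, and a loop closes in either order when the strands at `a`, `b` end at `c`, `d`. -/
theorem rejoin_weight_comm (s : Kq) (hm : ∀ x, m (m x) = x) (hac : a ≠ c) (had : a ≠ d)
    (hbc : b ≠ c) (hbd : b ≠ d) :
    (if m a = b then s else 1) * (if rejoin m a b c = d then s else 1) =
      (if m c = d then s else 1) * (if rejoin m c d a = b then s else 1) := by
  have e1 := hm a; have e2 := hm b; have e3 := hm c; have e4 := hm d
  have h1 : m a = b → (rejoin m a b c = d ↔ m c = d) := by grind [rejoin]
  have h2 : m c = d → (rejoin m c d a = b ↔ m a = b) := by grind [rejoin]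
  have h3 : m a ≠ b → m c ≠ d → (rejoin m a b c = d ↔ rejoin m c d a = b) := by grind [rejoin]
  have h4 : m a ≠ b → m c = d → rejoin m a b c = d := by grind [rejoin]
  have h5 : m c ≠ d → m a = b → rejoin m c d a = b := by grind [rejoin]
  grind

/-- Rejoining treats the pair `a`, `b` and the pair of their partners alike. On the identity diagram
this turns a generator at the top into the same generator at the bottom. -/
theorem rejoin_partners (hm : ∀ x, m (m x) = x) (hne : ∀ x, m x ≠ x) (hab : a ≠ b) :
    rejoin m (m b) (m a) = rejoin m a b := by
  funext x
  have e1 := hm a; have e2 := hm b; have e3 := hm x; have e4 := hne a; have e5 := hne b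
  grind [rejoin]

end Noncrossing

/-! # The type A representation -/

namespace TLDiagram

variable {N : ℕ}

/-- Put a cup and a cap on the boundary points `a`, `a + 1`. -/
def act (D : TLDiagram N) (a : ℕ) (h : a + 1 < 2 * N) : TLDiagram N where
  mate := rejoin D.mate ⟨a, by omega⟩ ⟨a + 1, h⟩
  mate_mate := rejoin_rejoin D.mate_mate D.mate_ne (by simp)
  mate_ne := rejoin_ne D.mate_mate D.mate_ne (by simp)
  noncrossing := rejoin_noncrossing D.mate_mate D.mate_ne D.noncrossing
    (by simp [Fin.lt_def]) (fun z => by simp only [Fin.le_def]; omega)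

/-- The factor that arises when a cup and a cap are put on the points `a`, `a + 1`. -/
noncomputable def weight (D : TLDiagram N) (a : ℕ) (h : a + 1 < 2 * N) : Kq :=
  if D.mate ⟨a, by omega⟩ = ⟨a + 1, h⟩ then -qint 2 else 1

theorem weight_act {D : TLDiagram N} {a : ℕ} {h : a + 1 < 2 * N} :
    (D.act a h).weight a h = -qint 2 := if_pos rejoin_left

theorem act_of_mate {D : TLDiagram N} {a : ℕ} {h : a + 1 < 2 * N}
    (hD : D.mate ⟨a, by omega⟩ = ⟨a + 1, h⟩) : D.act a h = D :=
  TLDiagram.ext (rejoin_of_eq D.mate_mate hD)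

theorem act_act_self {D : TLDiagram N} {a : ℕ} {h : a + 1 < 2 * N} :
    (D.act a h).act a h = D.act a h := act_of_mate rejoin_left

theorem act_comm {D : TLDiagram N} {a b : ℕ} {ha : a + 1 < 2 * N} {hb : b + 1 < 2 * N}
    (hab : a + 2 ≤ b) : (D.act a ha).act b hb = (D.act b hb).act a ha :=
  TLDiagram.ext (rejoin_comm_of_disjoint D.mate_mate D.mate_ne (by simp)
    (by simp) (by rw [Ne, Fin.mk.injEq]; omega) (by rw [Ne, Fin.mk.injEq]; omega)
    (by rw [Ne, Fin.mk.injEq]; omega) (by rw [Ne, Fin.mk.injEq]; omega))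

theorem weight_comm {D : TLDiagram N} {a b : ℕ} {ha : a + 1 < 2 * N} {hb : b + 1 < 2 * N}
    (hab : a + 2 ≤ b) : D.weight a ha * (D.act a ha).weight b hb =
      D.weight b hb * (D.act b hb).weight a ha :=
  rejoin_weight_comm _ D.mate_mate
    (by rw [Ne, Fin.mk.injEq]; omega) (by rw [Ne, Fin.mk.injEq]; omega)
    (by rw [Ne, Fin.mk.injEq]; omega) (by rw [Ne, Fin.mk.injEq]; omega)

theorem act_braid {D : TLDiagram N} {a b : ℕ} {ha : a + 1 < 2 * N} {hb : b + 1 < 2 * N}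
    (hab : b = a + 1 ∨ a = b + 1) : ((D.act a ha).act b hb).act a ha = D.act a ha := by
  apply TLDiagram.ext
  rcases hab with rfl | rfl
  · exact rejoin_braid D.mate_mate D.mate_ne (by simp) (by simp) (by simp [Nat.add_assoc])
  · exact rejoin_braid' D.mate_mate D.mate_ne (by simp) (by simp) (by simp [Nat.add_assoc])

theorem weight_braid {D : TLDiagram N} {a b : ℕ} {ha : a + 1 < 2 * N} {hb : b + 1 < 2 * N}
    (hab : b = a + 1 ∨ a = b + 1) : (D.act a ha).weight b hb = 1 := by
  apply if_neg
  rcases hab with rfl | rfl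
  · intro h
    rw [show (D.act a ha).mate ⟨a + 1, by omega⟩ = _ from rejoin_right (by simp)] at h
    simp [Nat.add_assoc] at h
  · intro h
    have h' := congrArg (D.act (b + 1) ha).mate h
    rw [mate_mate, show (D.act (b + 1) ha).mate ⟨b + 1, by omega⟩ = _ from rejoin_left] at h'
    simp [Nat.add_assoc] at h'

/-- The operator that puts a cup and a cap on the boundary points `a`, `a + 1`. -/
noncomputable def capCup (N a : ℕ) : Module.End Kq (TLDiagram N →₀ Kq) :=
  if h : a + 1 < 2 * N then
    Finsupp.linearCombination Kq fun D => D.weight a h • Finsupp.single (D.act a h) 1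
  else 0

theorem capCup_single {a : ℕ} (h : a + 1 < 2 * N) (D : TLDiagram N) :
    capCup N a (Finsupp.single D 1) = D.weight a h • Finsupp.single (D.act a h) 1 := by
  rw [capCup, dif_pos h, Finsupp.linearCombination_single, one_smul]

theorem end_ext {ι V : Type*} [AddCommGroup V] [Module Kq V] {f g : (ι →₀ Kq) →ₗ[Kq] V}
    (h : ∀ D, f (Finsupp.single D 1) = g (Finsupp.single D 1)) : f = g :=
  Finsupp.lhom_ext' fun D => LinearMap.ext_ring (h D)

theorem capCup_sq {a : ℕ} (h : a + 1 < 2 * N) :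
    capCup N a * capCup N a = -qint 2 • capCup N a := by
  refine end_ext fun D => ?_
  rw [Module.End.mul_apply, LinearMap.smul_apply, capCup_single h, map_smul, capCup_single h,
    weight_act, act_act_self, smul_comm]

theorem capCup_comm {a b : ℕ} (ha : a + 1 < 2 * N) (hb : b + 1 < 2 * N)
    (hab : a + 2 ≤ b ∨ b + 2 ≤ a) : capCup N a * capCup N b = capCup N b * capCup N a := by
  refine end_ext fun D => ?_
  simp only [Module.End.mul_apply, capCup_single ha, capCup_single hb, map_smul, smul_smul]
  rcases hab with hab | hab
  · rw [act_comm hab, ← weight_comm hab]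
  · rw [act_comm hab, weight_comm hab]

theorem capCup_braid {a b : ℕ} (ha : a + 1 < 2 * N) (hb : b + 1 < 2 * N)
    (hab : b = a + 1 ∨ a = b + 1) : capCup N a * capCup N b * capCup N a = capCup N a := by
  refine end_ext fun D => ?_
  simp only [Module.End.mul_apply, capCup_single ha, capCup_single hb, map_smul, smul_smul]
  have h := weight_braid (D := D.act b hb) (ha := hb) (hb := ha) hab.symm
  have h2 : ((D.act a ha).act b hb).weight a ha = 1 :=
    weight_braid (D := D.act a ha) (ha := hb) (hb := ha) hab.symm
  rw [weight_braid hab, h2, act_braid hab, mul_one, mul_one]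

/-- Since `max i 1 - 1` is 0 for both `i = 0` and `i = 1`, the generators `E_0` and `E_1` act by the
same operator, and all other relations are those of type A. -/
theorem isTLDSystem_capCup (hN : 2 ≤ N) : IsTLDSystem N fun i => capCup N (max i 1 - 1) where
  sq i hi := capCup_sq (by omega)
  braid i j hi hj hij := capCup_braid (by omega) (by omega) (by unfold NAdj at hij; omega)
  comm i j hi hj hij := by
    by_cases h : max i 1 = max j 1
    · rw [h]
    · exact capCup_comm (by omega) (by omega) (by unfold NAdj at hij; omega)

/-- The representation of `TL^D_N` on the undotted diagrams, in which `E_0` acts as `E_1`. -/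
noncomputable def repA (hN : 2 ≤ N) : TLD N →ₐ[Kq] Module.End Kq (TLDiagram N →₀ Kq) :=
  liftTLD (isTLDSystem_capCup hN)

theorem repA_genE (hN : 2 ≤ N) (i : Fin N) :
    repA hN (genE i) = capCup N (max i.val 1 - 1) := liftTLD_genE _ i

/-! ## The identity diagram -/

/-- If `x` is not joined to its neighbour, the strand at `x + 1` is nested inside and shorter. -/
theorem exists_top_cup_of_lt (D : TLDiagram N) (x : Fin (2 * N)) (hx : x < D.mate x)
    (hN : (D.mate x).val < N) :
    ∃ (a : ℕ) (ha : a + 1 < N), D.mate ⟨a, by omega⟩ = ⟨a + 1, by omega⟩ := by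
  obtain ⟨k, hk⟩ : ∃ k, (D.mate x).val - x.val = k := ⟨_, rfl⟩
  induction k using Nat.strong_induction_on generalizing x with
  | _ k ih =>
    rw [Fin.lt_def] at hx
    by_cases h : (D.mate x).val = x.val + 1
    · exact ⟨x.val, by omega, Fin.ext h⟩
    · have h1 : x < (⟨x.val + 1, by omega⟩ : Fin (2 * N)) := by simp [Fin.lt_def]
      have h2 : (⟨x.val + 1, by omega⟩ : Fin (2 * N)) < D.mate x := by
        rw [Fin.lt_def]; simp only; omega
      set y : Fin (2 * N) := ⟨x.val + 1, by omega⟩ with hy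
      have h3 := D.noncrossing x y h1 h2
      have h4 := noncrossing_inside D.mate_mate D.noncrossing h1 h2
      have h5 := D.mate_ne y
      have hyv : y.val = x.val + 1 := rfl
      rw [Fin.lt_def] at h3 h4
      have h6 : y.val ≠ (D.mate y).val := fun e => h5 (Fin.ext e.symm)
      exact ih ((D.mate y).val - y.val) (by omega) y (by rw [Fin.lt_def]; omega) (by omega) rfl

/-- By planarity `mate` is strictly decreasing from the `N` top points to the `N` bottom points,
which forces the reversal; `hup` and `hdown` are the two bounds. -/
theorem eq_one_of_forall (D : TLDiagram N) (h : ∀ x, x.val < N → N ≤ (D.mate x).val) :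
    D = one N := by
  have hanti : ∀ x y : Fin (2 * N), x < y → y.val < N → D.mate y < D.mate x := by
    intro x y hxy hy
    have := h x (by rw [Fin.lt_def] at hxy; omega)
    exact D.noncrossing x y hxy (by rw [Fin.lt_def]; omega)
  have hup : ∀ k, ∀ hk : k < N, (D.mate ⟨k, by omega⟩).val + k + 1 ≤ 2 * N := by
    intro k
    induction k with
    | zero => intro hk; have := (D.mate ⟨0, by omega⟩).2; omega
    | succ k ih =>
      intro hk
      have h1 := ih (by omega)
      have h2 := hanti ⟨k, by omega⟩ ⟨k + 1, by omega⟩ (by simp [Fin.lt_def]) hk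
      rw [Fin.lt_def] at h2
      omega
  have hdown : ∀ j k, ∀ hk : k < N, k + j + 1 = N → 2 * N ≤ (D.mate ⟨k, by omega⟩).val + k + 1 := by
    intro j
    induction j with
    | zero => intro k hk hj; have := h ⟨k, by omega⟩ hk; omega
    | succ j ih =>
      intro k hk hj
      have h1 := ih (k + 1) (by omega) (by omega)
      have h2 := hanti ⟨k, by omega⟩ ⟨k + 1, by omega⟩ (by simp [Fin.lt_def]) (by simp only; omega)
      rw [Fin.lt_def] at h2
      omega
  have key : ∀ x : Fin (2 * N), x.val < N → D.mate x = x.rev := by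
    intro x hx
    have h1 := hup x hx
    have h2 := hdown (N - 1 - x) x hx (by omega)
    apply Fin.ext
    rw [Fin.val_rev]
    simp only [Fin.eta] at h1 h2
    omega
  apply TLDiagram.ext
  funext x
  change D.mate x = x.rev
  rcases Nat.lt_or_ge x.val N with hx | hx
  · exact key x hx
  · have h1 : (x.rev).val < N := by rw [Fin.val_rev]; omega
    have h2 := key x.rev h1
    rw [Fin.rev_rev] at h2
    rw [← h2, D.mate_mate, h2]

theorem exists_top_cup {D : TLDiagram N} (hD : D ≠ one N) :
    ∃ (a : ℕ) (ha : a + 1 < N), D.mate ⟨a, by omega⟩ = ⟨a + 1, by omega⟩ := by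
  by_contra hcon
  refine hD (eq_one_of_forall D fun x hx => ?_)
  by_contra hlt
  rw [not_le] at hlt
  rcases lt_trichotomy x (D.mate x) with h | h | h
  · exact hcon (exists_top_cup_of_lt D x h hlt)
  · exact D.mate_ne x h.symm
  · exact hcon (exists_top_cup_of_lt D (D.mate x) (by rwa [D.mate_mate]) (by rwa [D.mate_mate]))

theorem act_one {a : ℕ} (ha : a + 2 ≤ 2 * N) :
    (one N).act a (by omega) = (one N).act (2 * N - 2 - a) (by omega) := by
  apply TLDiagram.ext
  have := rejoin_partners (one N).mate_mate (one N).mate_ne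
    (a := ⟨a, by omega⟩) (b := ⟨a + 1, by omega⟩) (by rw [Ne, Fin.mk.injEq]; omega)
  change rejoin (one N).mate _ _ = rejoin (one N).mate _ _
  rw [← this]
  congr 1
  · apply Fin.ext; change (Fin.rev _).val = _; rw [Fin.val_rev]; simp only; omega
  · apply Fin.ext; change (Fin.rev _).val = _; rw [Fin.val_rev]; simp only; omega

theorem weight_one {a : ℕ} (ha : a + 1 < 2 * N) (h : a + 1 ≠ N) : (one N).weight a ha = 1 := by
  apply if_neg
  intro e
  have := congrArg Fin.val e
  change (Fin.rev _).val = _ at this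
  rw [Fin.val_rev] at this
  simp only at this
  omega

/-- A diagram other than the identity has an inner-most cup, so it is a multiple of some `E_{a+1}
D`, which is killed by the projection. -/
theorem repA_jwD_single {n : ℕ} (hn : 2 ≤ n + 1) {D : TLDiagram (n + 1)} (hD : D ≠ one (n + 1)) :
    repA hn (jwD n) (Finsupp.single D 1) = 0 := by
  obtain ⟨a, ha, h⟩ := exists_top_cup hD
  have h1 : repA hn (genE ⟨a + 1, by omega⟩) (Finsupp.single D 1) =
      -qint 2 • Finsupp.single D 1 := by
    have ha' : max (a + 1) 1 - 1 = a := by omega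
    rw [repA_genE]
    simp only [ha']
    rw [capCup_single (by omega), act_of_mate h]
    exact congrArg (· • _) (if_pos h)
  have h2 : repA hn (jwD n * genE ⟨a + 1, by omega⟩) (Finsupp.single D 1) = 0 := by
    rw [jwD_mul_genE, map_zero, LinearMap.zero_apply]
  rw [map_mul, Module.End.mul_apply, h1, map_smul] at h2
  exact (smul_eq_zero.mp h2).resolve_left (neg_ne_zero.mpr qint_two_ne_zero)

theorem repA_jwD_apply {n : ℕ} (hn : 2 ≤ n + 1) (p : TLDiagram (n + 1) →₀ Kq) :
    repA hn (jwD n) p = p (one (n + 1)) • repA hn (jwD n) (Finsupp.single (one (n + 1)) 1) := by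
  classical
  have : repA hn (jwD n) = (LinearMap.toSpanSingleton Kq _
      (repA hn (jwD n) (Finsupp.single (one (n + 1)) 1))).comp (Finsupp.lapply (one (n + 1))) := by
    refine end_ext fun D => ?_
    rw [LinearMap.comp_apply, Finsupp.lapply_apply, LinearMap.toSpanSingleton_apply]
    by_cases hD : D = one (n + 1)
    · subst hD; rw [Finsupp.single_eq_same, one_smul]
    · rw [repA_jwD_single hn hD, Finsupp.single_eq_of_ne (Ne.symm hD), zero_smul]
  conv_lhs => rw [this]
  rfl

/-- The projection fixes `p`, because `p` is killed by the generators. It also kills every diagram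
in `p` except the identity. -/
theorem eq_repA_jwD {n : ℕ} (hn : 2 ≤ n + 1) {p : TLDiagram (n + 1) →₀ Kq}
    (hp : ∀ a, a + 1 < n + 1 → capCup (n + 1) a p = 0) (h1 : p (one (n + 1)) = 1) :
    p = repA hn (jwD n) (Finsupp.single (one (n + 1)) 1) := by
  have h := smul_eq_of_kill (repA hn) (v := p)
    (fun i => by rw [repA_genE]; exact hp _ (by omega)) (jwD n)
  rw [augTLD_jwD, one_smul, repA_jwD_apply, h1, one_smul] at h
  exact h.symm

theorem capCup_repA_comm {a : ℕ} (hN : 2 ≤ N) (ha : N ≤ a) (ha' : a + 1 < 2 * N) (x : TLD N) :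
    capCup N a * repA hN x = repA hN x * capCup N a := by
  induction x using TLD.induction with
  | hadd x y hx hy => rw [map_add, mul_add, add_mul, hx, hy]
  | hsmul c x hx => rw [map_smul, mul_smul_comm, smul_mul_assoc, hx]
  | hword w =>
    induction w with
    | nil => simp [wordE]
    | cons i w ih =>
      rw [wordE_cons, map_mul, ← mul_assoc, repA_genE,
        capCup_comm ha' (by omega) (Or.inr (by omega)), mul_assoc, ih, mul_assoc]

/-- Being killed at the top implies being killed at the bottom: `p` is `Q` applied to the identity,
operators at bottom positions commute with the action, and on the identity they agree with a
generator at the top, where `Q E_i = 0`. -/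
theorem capCup_bottom {n : ℕ} (hn : 2 ≤ n + 1) {p : TLDiagram (n + 1) →₀ Kq}
    (hp : ∀ a, a + 1 < n + 1 → capCup (n + 1) a p = 0) (h1 : p (one (n + 1)) = 1) {a : ℕ}
    (ha : n + 1 ≤ a) (ha' : a + 1 < 2 * (n + 1)) : capCup (n + 1) a p = 0 := by
  have hi : 2 * (n + 1) - 1 - a < n + 1 := by omega
  have e : max (2 * (n + 1) - 1 - a) 1 - 1 = 2 * (n + 1) - 2 - a := by omega
  have h2 : capCup (n + 1) a (Finsupp.single (one (n + 1)) 1) =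
      repA hn (genE ⟨_, hi⟩) (Finsupp.single (one (n + 1)) 1) := by
    rw [repA_genE]
    simp only [e]
    rw [capCup_single ha', capCup_single (by omega), act_one (by omega),
      weight_one _ (by omega), weight_one _ (by omega)]
  rw [eq_repA_jwD hn hp h1, ← Module.End.mul_apply, capCup_repA_comm hn ha ha',
    Module.End.mul_apply, h2, ← Module.End.mul_apply, ← map_mul, jwD_mul_genE, map_zero,
    LinearMap.zero_apply]

end TLDiagram

/-! # Inserting an innermost strand -/

namespace TLDiagram

variable {N : ℕ}

theorem skip_cases {g : ℕ} (hg : g ≤ 2 * N) (x : Fin (2 * (N + 1))) :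
    x = ⟨g, by omega⟩ ∨ x = ⟨g + 1, by omega⟩ ∨ ∃ y : Fin (2 * N), x = skip g y := by
  by_cases h1 : x.val = g
  · exact Or.inl (Fin.ext h1)
  by_cases h2 : x.val = g + 1
  · exact Or.inr (Or.inl (Fin.ext h2))
  refine Or.inr (Or.inr ⟨⟨if x.val < g then x.val else x.val - 2, by split <;> omega⟩, ?_⟩)
  apply Fin.ext
  simp only [skip]
  split_ifs <;> omega

/-- The matching obtained by inserting two joined neighbouring points at `g`, `g + 1`. -/
def insertMate (m : Fin (2 * N) → Fin (2 * N)) (g : ℕ) (hg : g ≤ 2 * N) (x : Fin (2 * (N + 1))) :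
    Fin (2 * (N + 1)) :=
  if h₀ : x.val = g then ⟨g + 1, by omega⟩ else if h : x.val = g + 1 then ⟨g, by omega⟩ else
  if h' : x.val < g then skip g (m ⟨x.val, by omega⟩)
  else skip g (m ⟨x.val - 2, by omega⟩)

theorem insertMate_left (m : Fin (2 * N) → Fin (2 * N)) {g : ℕ} (hg : g ≤ 2 * N) :
    insertMate m g hg ⟨g, by omega⟩ = ⟨g + 1, by omega⟩ := by simp [insertMate]

theorem insertMate_right (m : Fin (2 * N) → Fin (2 * N)) {g : ℕ} (hg : g ≤ 2 * N) :
    insertMate m g hg ⟨g + 1, by omega⟩ = ⟨g, by omega⟩ := by simp [insertMate]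

theorem insertMate_skip (m : Fin (2 * N) → Fin (2 * N)) {g : ℕ} (hg : g ≤ 2 * N)
    (y : Fin (2 * N)) : insertMate m g hg (skip g y) = skip g (m y) := by
  have h := skip_ne (p := g) y
  rw [insertMate, dif_neg h.1, dif_neg h.2]
  split_ifs with h'
  · congr 2; apply Fin.ext
    simp only [skip] at h' ⊢; split_ifs at h' ⊢ <;> omega
  · congr 2; apply Fin.ext
    simp only [skip] at h' ⊢; split_ifs at h' ⊢ <;> omega

/-- Insert two joined neighbouring boundary points at `g`, `g + 1`. -/
def insertArc (D : TLDiagram N) (g : ℕ) (hg : g ≤ 2 * N) : TLDiagram (N + 1) where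
  mate := insertMate D.mate g hg
  mate_mate x := by
    rcases skip_cases hg x with rfl | rfl | ⟨y, rfl⟩
    · rw [insertMate_left, insertMate_right]
    · rw [insertMate_right, insertMate_left]
    · rw [insertMate_skip, insertMate_skip, D.mate_mate]
  mate_ne x := by
    rcases skip_cases hg x with rfl | rfl | ⟨y, rfl⟩
    · rw [insertMate_left]; simp
    · rw [insertMate_right]; simp
    · rw [insertMate_skip]; exact fun h => D.mate_ne y (skip_injective h)
  noncrossing x y := by
    rcases skip_cases hg x with rfl | rfl | ⟨x, rfl⟩
    · rw [insertMate_left]; simp only [Fin.lt_def]; omega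
    · rw [insertMate_right]; simp only [Fin.lt_def]; omega
    · rw [insertMate_skip]
      rcases skip_cases hg y with rfl | rfl | ⟨y, rfl⟩
      · rw [insertMate_left]; have := skip_ne (p := g) (D.mate x); simp only [Fin.lt_def]; omega
      · rw [insertMate_right]; simp only [Fin.lt_def]; omega
      · rw [insertMate_skip]; simp only [skip_lt_skip]; exact D.noncrossing x y

theorem insertArc_mate_left {D : TLDiagram N} {g : ℕ} {hg : g ≤ 2 * N} :
    (D.insertArc g hg).mate ⟨g, by omega⟩ = ⟨g + 1, by omega⟩ := insertMate_left _ hg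

theorem insertArc_mate_right {D : TLDiagram N} {g : ℕ} {hg : g ≤ 2 * N} :
    (D.insertArc g hg).mate ⟨g + 1, by omega⟩ = ⟨g, by omega⟩ := insertMate_right _ hg

theorem insertArc_mate_skip {D : TLDiagram N} {g : ℕ} {hg : g ≤ 2 * N} (y : Fin (2 * N)) :
    (D.insertArc g hg).mate (skip g y) = skip g (D.mate y) := insertMate_skip _ hg y

theorem eq_insertArc {D : TLDiagram (N + 1)} {D' : TLDiagram N} {g : ℕ} (hg : g ≤ 2 * N)
    (h1 : D.mate ⟨g, by omega⟩ = ⟨g + 1, by omega⟩)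
    (h2 : ∀ y, D.mate (skip g y) = skip g (D'.mate y)) : D = D'.insertArc g hg := by
  apply TLDiagram.ext
  funext x
  rcases skip_cases hg x with rfl | rfl | ⟨y, rfl⟩
  · rw [h1, insertArc_mate_left]
  · rw [insertArc_mate_right, ← h1, D.mate_mate]
  · rw [h2, insertArc_mate_skip]

theorem insertArc_injective {g : ℕ} (hg : g ≤ 2 * N) :
    Function.Injective fun D : TLDiagram N => D.insertArc g hg := by
  intro D D' h
  apply TLDiagram.ext
  funext y
  apply skip_injective (p := g)
  rw [← insertArc_mate_skip (hg := hg), ← insertArc_mate_skip (hg := hg)]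
  exact congrArg (fun D : TLDiagram (N + 1) => D.mate (skip g y)) h

theorem insertArc_remove {D : TLDiagram (N + 1)} {i : ℕ} (h : D.HasInnermostCap i) :
    D = (D.remove i h).insertArc (2 * N + 1 - i) (by have := h.1; omega) := by
  refine eq_insertArc _ ?_ fun y => (skip_remove_mate D i h y).symm
  obtain ⟨h1, h2, x, hx, hx'⟩ := h
  have : (⟨2 * N + 1 - i, by omega⟩ : Fin (2 * (N + 1))) = x := Fin.ext (by simp only; omega)
  rw [this]
  apply Fin.ext
  simp only
  omega

theorem hasInnermostCap_insertArc (D : TLDiagram N) {i : ℕ} (h1 : 1 ≤ i) (h2 : i ≤ N + 1) :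
    (D.insertArc (2 * N + 1 - i) (by omega)).HasInnermostCap i :=
  ⟨h1, h2, ⟨2 * N + 1 - i, by omega⟩, by simp only; omega, by rw [insertArc_mate_left]⟩

theorem insertArc_one (N : ℕ) : (one N).insertArc N (by omega) = one (N + 1) := by
  symm
  refine eq_insertArc _ ?_ fun y => ?_
  · apply Fin.ext
    change (Fin.rev _).val = _
    rw [Fin.val_rev]
    simp only
    omega
  · apply Fin.ext
    change (Fin.rev _).val = (skip N (Fin.rev y)).val
    have := Fin.val_rev y
    simp only [Fin.val_rev, skip]
    split_ifs <;> omega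

theorem act_mate_of_ne {D : TLDiagram N} {a : ℕ} {h : a + 1 < 2 * N} {x : Fin (2 * N)}
    (h1 : x.val ≠ a) (h2 : x.val ≠ a + 1) (h3 : x ≠ D.mate ⟨a, by omega⟩)
    (h4 : x ≠ D.mate ⟨a + 1, h⟩) : (D.act a h).mate x = D.mate x := by
  change rejoin _ _ _ _ = _
  rw [rejoin, if_neg (fun e => h1 (congrArg Fin.val e)), if_neg (fun e => h2 (congrArg Fin.val e)),
    if_neg h3, if_neg h4]

theorem skip_of_lt {g a : ℕ} (h : a < g) (ha : a < 2 * N) :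
    skip g (⟨a, ha⟩ : Fin (2 * N)) = ⟨a, by omega⟩ := by
  apply Fin.ext; simp [skip, h]

theorem act_insertArc_of_lt {D : TLDiagram N} {a g : ℕ} (hag : a + 2 ≤ g) (hg : g ≤ 2 * N) :
    (D.insertArc g hg).act a (by omega) = (D.act a (by omega)).insertArc g hg := by
  have ea : (⟨a, by omega⟩ : Fin (2 * (N + 1))) = skip g (⟨a, by omega⟩ : Fin (2 * N)) :=
    (skip_of_lt (by omega) _).symm
  have eb : (⟨a + 1, by omega⟩ : Fin (2 * (N + 1))) = skip g (⟨a + 1, by omega⟩ : Fin (2 * N)) :=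
    (skip_of_lt (by omega) _).symm
  refine eq_insertArc hg ?_ fun y => ?_
  · rw [act_mate_of_ne (by simp only; omega) (by simp only; omega), insertArc_mate_left]
    · rw [ea, insertArc_mate_skip]
      exact fun e => (skip_ne _).1 (congrArg Fin.val e).symm
    · rw [eb, insertArc_mate_skip]
      exact fun e => (skip_ne _).1 (congrArg Fin.val e).symm
  · change rejoin _ _ _ _ = skip g (rejoin _ _ _ _)
    simp only [rejoin, ea, eb, insertArc_mate_skip, skip_injective.eq_iff]
    split_ifs <;> rfl

theorem weight_insertArc_of_lt {D : TLDiagram N} {a g : ℕ} (hag : a + 2 ≤ g) (hg : g ≤ 2 * N) :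
    (D.insertArc g hg).weight a (by omega) = D.weight a (by omega) := by
  have ea : (⟨a, by omega⟩ : Fin (2 * (N + 1))) = skip g (⟨a, by omega⟩ : Fin (2 * N)) :=
    (skip_of_lt (by omega) _).symm
  have eb : (⟨a + 1, by omega⟩ : Fin (2 * (N + 1))) = skip g (⟨a + 1, by omega⟩ : Fin (2 * N)) :=
    (skip_of_lt (by omega) _).symm
  simp only [weight, ea, eb, insertArc_mate_skip, skip_injective.eq_iff]

/-- This is the straightening of a zigzag: the cup takes the place of the arc, shifted by one, and
the strand at `a` continues to the point on the other side of the new arc. -/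
theorem act_insertArc_succ {D : TLDiagram N} {a : ℕ} (hg : a + 1 ≤ 2 * N) :
    (D.insertArc (a + 1) hg).act a (by omega) = D.insertArc a (by omega) := by
  refine eq_insertArc (by omega) rejoin_left fun y => ?_
  have ea : (⟨a, by omega⟩ : Fin (2 * (N + 1))) = skip (a + 1) (⟨a, by omega⟩ : Fin (2 * N)) :=
    (skip_of_lt (by omega) _).symm
  change rejoin _ _ _ _ = _
  have hy := skip_ne (p := a) y
  rw [rejoin, if_neg (fun e => hy.1 (congrArg Fin.val e)),
    if_neg (fun e => hy.2 (congrArg Fin.val e)), insertArc_mate_left, ea, insertArc_mate_skip]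
  have key : ∀ z : Fin (2 * N), z.val ≠ a → skip a z = skip (a + 1) z := by
    intro z hz
    apply Fin.ext
    simp only [skip]
    split_ifs <;> omega
  have hsa : skip a (⟨a, by omega⟩ : Fin (2 * N)) = ⟨a + 1 + 1, by omega⟩ := by
    apply Fin.ext; simp [skip]
  by_cases h1 : y.val = a
  · have : y = ⟨a, by omega⟩ := Fin.ext h1
    rw [this, hsa, if_neg, if_pos rfl, key _ (fun e => D.mate_ne _ (Fin.ext e))]
    intro e
    exact (skip_ne _).2 (congrArg Fin.val e).symm
  · rw [key y h1]
    by_cases h2 : y = D.mate ⟨a, by omega⟩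
    · rw [if_pos (by rw [h2]), h2, D.mate_mate, hsa]
    · rw [if_neg (fun e => h2 (skip_injective e)),
        if_neg (fun e => (skip_ne y).2 (congrArg Fin.val e)),
        insertArc_mate_skip, key]
      intro e
      apply h2
      rw [← D.mate_mate y]
      congr 1
      exact Fin.ext e

theorem weight_insertArc_succ {D : TLDiagram N} {a : ℕ} (hg : a + 1 ≤ 2 * N) :
    (D.insertArc (a + 1) hg).weight a (by omega) = 1 := by
  apply if_neg
  intro e
  have := congrArg (D.insertArc (a + 1) hg).mate e
  rw [mate_mate, insertArc_mate_left] at this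
  have := congrArg Fin.val this
  simp only at this
  omega

theorem insertArc_insertArc {D : TLDiagram N} {a g : ℕ} (hag : a ≤ g) (hg : g ≤ 2 * N) :
    (D.insertArc a (by omega)).insertArc (g + 2) (by omega) =
      (D.insertArc g hg).insertArc a (by omega) := by
  have e1 : ∀ y : Fin (2 * N), skip (g + 2) (skip a y) = skip a (skip g y) := by
    intro y
    apply Fin.ext
    simp only [skip]
    split_ifs <;> omega
  refine eq_insertArc _ ?_ fun x => ?_
  · have h1 : (⟨a, by omega⟩ : Fin (2 * (N + 1 + 1))) =
        skip (g + 2) (⟨a, by omega⟩ : Fin (2 * (N + 1))) :=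
      (skip_of_lt (by omega) _).symm
    have h2 : (⟨a + 1, by omega⟩ : Fin (2 * (N + 1 + 1))) =
        skip (g + 2) (⟨a + 1, by omega⟩ : Fin (2 * (N + 1))) :=
      (skip_of_lt (by omega) _).symm
    rw [h1, insertArc_mate_skip, insertArc_mate_left, h2]
  · have h1 : skip a (⟨g, by omega⟩ : Fin (2 * (N + 1))) = ⟨g + 2, by omega⟩ := by
      apply Fin.ext; simp only [skip]; split_ifs <;> omega
    have h2 : skip a (⟨g + 1, by omega⟩ : Fin (2 * (N + 1))) = ⟨g + 2 + 1, by omega⟩ := by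
      apply Fin.ext; simp only [skip]; split_ifs <;> omega
    rcases skip_cases hg x with rfl | rfl | ⟨y, rfl⟩
    · rw [h1, insertArc_mate_left, insertArc_mate_left, h2]
    · rw [h2, insertArc_mate_right, insertArc_mate_right, h1]
    · rw [← e1, insertArc_mate_skip, insertArc_mate_skip, insertArc_mate_skip, e1]

/-- The linear extension of `insertArc`. -/
noncomputable def insertL (N g : ℕ) : (TLDiagram N →₀ Kq) →ₗ[Kq] (TLDiagram (N + 1) →₀ Kq) :=
  if h : g ≤ 2 * N then Finsupp.lmapDomain Kq Kq fun D => D.insertArc g h else 0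

theorem insertL_single {g : ℕ} (h : g ≤ 2 * N) (D : TLDiagram N) :
    insertL N g (Finsupp.single D 1) = Finsupp.single (D.insertArc g h) 1 := by
  rw [insertL, dif_pos h, Finsupp.lmapDomain_apply, Finsupp.mapDomain_single]

theorem insertL_apply {g : ℕ} (h : g ≤ 2 * N) (p : TLDiagram N →₀ Kq) (D : TLDiagram N) :
    insertL N g p (D.insertArc g h) = p D := by
  rw [insertL, dif_pos h, Finsupp.lmapDomain_apply]
  exact Finsupp.mapDomain_apply (insertArc_injective h) p D

theorem insertL_apply_of_ne {g : ℕ} (h : g ≤ 2 * N) (p : TLDiagram N →₀ Kq)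
    {D : TLDiagram (N + 1)} (hD : ∀ D' : TLDiagram N, D'.insertArc g h ≠ D) :
    insertL N g p D = 0 := by
  rw [insertL, dif_pos h, Finsupp.lmapDomain_apply]
  exact Finsupp.mapDomain_of_notMem_range _ _ (by rintro ⟨D', h'⟩; exact hD D' h')

theorem capCup_insertL_of_lt {a g : ℕ} (hag : a + 2 ≤ g) (hg : g ≤ 2 * N)
    (p : TLDiagram N →₀ Kq) :
    capCup (N + 1) a (insertL N g p) = insertL N g (capCup N a p) := by
  have : (capCup (N + 1) a).comp (insertL N g) = (insertL N g).comp (capCup N a) := by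
    refine end_ext fun D => ?_
    rw [LinearMap.comp_apply, LinearMap.comp_apply, insertL_single hg, capCup_single (by omega),
      capCup_single (by omega), map_smul, insertL_single hg, act_insertArc_of_lt hag,
      weight_insertArc_of_lt hag]
  exact LinearMap.congr_fun this p

theorem capCup_insertL_succ {a : ℕ} (hg : a + 1 ≤ 2 * N) (p : TLDiagram N →₀ Kq) :
    capCup (N + 1) a (insertL N (a + 1) p) = insertL N a p := by
  have : (capCup (N + 1) a).comp (insertL N (a + 1)) = insertL N a := by
    refine end_ext fun D => ?_
    rw [LinearMap.comp_apply, insertL_single hg, capCup_single (by omega),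
      act_insertArc_succ, weight_insertArc_succ, one_smul, insertL_single (by omega)]
  exact LinearMap.congr_fun this p

theorem capCup_insertL_self {a : ℕ} (hg : a ≤ 2 * N) (p : TLDiagram N →₀ Kq) :
    capCup (N + 1) a (insertL N a p) = -qint 2 • insertL N a p := by
  have : (capCup (N + 1) a).comp (insertL N a) = -qint 2 • insertL N a := by
    refine end_ext fun D => ?_
    rw [LinearMap.comp_apply, LinearMap.smul_apply, insertL_single hg, capCup_single (by omega),
      act_of_mate insertArc_mate_left]
    exact congrArg (· • _) (if_pos insertArc_mate_left)
  exact LinearMap.congr_fun this p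

theorem insertL_insertL {a g : ℕ} (hag : a ≤ g) (hg : g ≤ 2 * N) (p : TLDiagram N →₀ Kq) :
    insertL (N + 1) (g + 2) (insertL N a p) = insertL (N + 1) a (insertL N g p) := by
  have : (insertL (N + 1) (g + 2)).comp (insertL N a) =
      (insertL (N + 1) a).comp (insertL N g) := by
    refine end_ext fun D => ?_
    rw [LinearMap.comp_apply, LinearMap.comp_apply, insertL_single (by omega), insertL_single hg,
      insertL_single (by omega), insertL_single (by omega), insertArc_insertArc hag]
  exact LinearMap.congr_fun this p

/-! ## The type A Jones–Wenzl vector -/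

/-- The type A Jones–Wenzl projection, defined by the recursion for its coefficients. -/
noncomputable def jwA : (N : ℕ) → TLDiagram N →₀ Kq
  | 0 => Finsupp.single (one 0) 1
  | N + 1 => ∑ i ∈ Finset.Icc 1 (N + 1), (qint i / qint (N + 1)) • insertL N (2 * N + 1 - i) (jwA N)

/-- The `i`-th summand contains `D` only if `D` has an inner-most cap at `i`, and then only through
`D.remove i`, because inserting an arc is injective. -/
theorem jwA_succ_apply (D : TLDiagram (N + 1)) :
    jwA (N + 1) D = ∑ i ∈ D.capPositions.attach, qint i.1 / qint (N + 1) *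
      jwA N (D.remove i.1 (hasInnermostCap_of_mem i.2)) := by
  classical
  rw [jwA, Finsupp.finsetSum_apply]
  have hsub : D.capPositions ⊆ Finset.Icc 1 (N + 1) := Finset.filter_subset _ _
  rw [← Finset.sum_subset hsub, ← Finset.sum_attach]
  · refine Finset.sum_congr rfl fun i _ => ?_
    have h := hasInnermostCap_of_mem i.2
    have h1 := h.1
    rw [Finsupp.smul_apply, smul_eq_mul]
    congr 1
    refine Eq.trans (congrArg _ (insertArc_remove h)) (insertL_apply _ _ _)
  · intro i hi hn
    rw [Finset.mem_Icc] at hi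
    rw [Finsupp.smul_apply, insertL_apply_of_ne (by omega), smul_zero]
    rintro D' rfl
    exact hn (Finset.mem_filter.mpr ⟨Finset.mem_Icc.mpr hi,
      hasInnermostCap_insertArc D' hi.1 hi.2⟩)

theorem capPositions_one (N : ℕ) : (one (N + 1)).capPositions = {N + 1} := by
  classical
  ext i
  rw [capPositions, Finset.mem_filter, Finset.mem_Icc, Finset.mem_singleton]
  constructor
  · rintro ⟨-, h1, h2, x, hx, hx'⟩
    change (Fin.rev x).val = _ at hx'
    rw [Fin.val_rev] at hx'
    omega
  · rintro rfl
    refine ⟨⟨by omega, le_rfl⟩, by omega, le_rfl, ⟨N, by omega⟩, by simp only; omega, ?_⟩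
    change (Fin.rev _).val = _
    rw [Fin.val_rev]
    simp only
    omega

theorem jwA_one (N : ℕ) : jwA N (one N) = 1 := by
  classical
  induction N with
  | zero => rw [jwA, Finsupp.single_eq_same]
  | succ N ih =>
    have hN := qint_ne_zero (m := N + 1) (by omega)
    rw [jwA, Finsupp.finsetSum_apply, Finset.sum_eq_single (N + 1)]
    · rw [Finsupp.smul_apply, div_self hN, one_smul]
      have e : 2 * N + 1 - (N + 1) = N := by omega
      rw [e, ← insertArc_one, insertL_apply, ih]
    · intro i hi hne
      rw [Finset.mem_Icc] at hi
      rw [Finsupp.smul_apply, insertL_apply_of_ne (by omega), smul_zero]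
      intro D' hD
      have := hasInnermostCap_insertArc D' hi.1 hi.2
      rw [hD] at this
      have hm : i ∈ (one (N + 1)).capPositions :=
        Finset.mem_filter.mpr ⟨Finset.mem_Icc.mpr hi, this⟩
      rw [capPositions_one, Finset.mem_singleton] at hm
      exact hne hm
    · intro h; simp at h

/-- With `N + 2` strands the position `N + 1` joins the right-most top and bottom points, so this is
the partial trace. In the summands with `i ≤ N` the operator passes the inserted arc and meets a
bottom position of `jwA (N + 1)`. The other two combine by `[N+1] - [2][N+2] = -[N+3]`. -/
theorem capCup_jwA_corner
    (hp : ∀ a, N + 1 ≤ a → a + 1 < 2 * (N + 1) → capCup (N + 1) a (jwA (N + 1)) = 0) :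
    capCup (N + 2) (N + 1) (jwA (N + 2)) =
      -(qint (N + 3) / qint (N + 2)) • insertL (N + 1) (N + 1) (jwA (N + 1)) := by
  have hN := qint_ne_zero (m := N + 2) (by omega)
  rw [jwA, map_sum, Finset.sum_Icc_succ_top (by omega), Finset.sum_Icc_succ_top (by omega),
    Finset.sum_eq_zero, zero_add]
  · have e1 : 2 * (N + 1) + 1 - (N + 1) = N + 1 + 1 := by omega
    have e2 : 2 * (N + 1) + 1 - (N + 1 + 1) = N + 1 := by omega
    rw [e1, e2, map_smul, map_smul, capCup_insertL_succ (by omega), capCup_insertL_self (by omega),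
      smul_smul, ← add_smul]
    congr 1
    have := qint_two_mul_qint (N + 1)
    simp only [add_assoc, Nat.reduceAdd] at this ⊢
    field_simp
    linear_combination -this
  · intro i hi
    rw [Finset.mem_Icc] at hi
    rw [map_smul, capCup_insertL_of_lt (by omega) (by omega), hp _ le_rfl (by omega), map_zero,
      smul_zero]

theorem capCup_one_zero : capCup 1 0 (jwA 1) = -(qint 2 / qint 1) • insertL 0 0 (jwA 0) := by
  have : jwA 1 = insertL 0 0 (jwA 0) := by
    change ∑ i ∈ Finset.Icc 1 (0 + 1), (qint i / qint (0 + 1)) •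
      insertL 0 (2 * 0 + 1 - i) (jwA 0) = _
    rw [Finset.Icc_self, Finset.sum_singleton]
    exact (congrArg (· • _) (div_self (qint_ne_zero one_ne_zero))).trans (one_smul _ _)
  rw [this, capCup_insertL_self (by omega), qint_one, div_one]

/-- At positions away from the last one the operator passes all inserted arcs and kills the smaller
vector. At the last position the top summand `i = N` becomes `jwA (N - 1)` with an arc inserted at
`a`. By the partial trace formula and the recursion for `jwA (N - 1)`, the other summands add up to
the negative of this. -/
theorem capCup_jwA (N : ℕ) : ∀ a, a + 1 < N → capCup N a (jwA N) = 0 := by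
  induction N using Nat.strong_induction_on with
  | _ N ih =>
    intro a ha
    obtain ⟨M, rfl⟩ : ∃ M, N = M + 1 := ⟨N - 1, by omega⟩
    have ihM := ih M (by omega)
    rw [jwA, map_sum]
    rcases Nat.lt_or_ge (a + 1) M with haM | haM
    · refine Finset.sum_eq_zero fun i hi => ?_
      rw [Finset.mem_Icc] at hi
      rw [map_smul, capCup_insertL_of_lt (by omega) (by omega), ihM a haM, map_zero, smul_zero]
    · obtain ⟨L, rfl⟩ : ∃ L, M = L + 1 := ⟨M - 1, by omega⟩
      obtain rfl : a = L := by omega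
      have corner : capCup (a + 1) a (jwA (a + 1)) =
          -(qint (a + 2) / qint (a + 1)) • insertL a a (jwA a) := by
        rcases Nat.eq_zero_or_pos a with rfl | ha0
        · exact capCup_one_zero
        · obtain ⟨b, rfl⟩ : ∃ b, a = b + 1 := ⟨a - 1, by omega⟩
          refine capCup_jwA_corner fun c hc hc' => ?_
          exact capCup_bottom (by omega) (ih (b + 1) (by omega)) (jwA_one _) hc hc'
      have h1 := qint_ne_zero (m := a + 1) (by omega)
      have h2 := qint_ne_zero (m := a + 2) (by omega)
      rw [Finset.sum_Icc_succ_top (by omega)]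
      have e : 2 * (a + 1) + 1 - (a + 1 + 1) = a + 1 := by omega
      rw [e, map_smul, capCup_insertL_succ (by omega), div_self h2, one_smul]
      have hrest : ∑ i ∈ Finset.Icc 1 (a + 1), capCup (a + 1 + 1) a
          ((qint i / qint (a + 1 + 1)) • insertL (a + 1) (2 * (a + 1) + 1 - i) (jwA (a + 1))) =
          ∑ i ∈ Finset.Icc 1 (a + 1), -insertL (a + 1) a
            ((qint i / qint (a + 1)) • insertL a (2 * a + 1 - i) (jwA a)) := by
        refine Finset.sum_congr rfl fun i hi => ?_
        rw [Finset.mem_Icc] at hi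
        have e2 : 2 * (a + 1) + 1 - i = (2 * a + 1 - i) + 2 := by omega
        rw [map_smul, capCup_insertL_of_lt (by omega) (by omega), corner, map_smul, e2,
          insertL_insertL (by omega) (by omega), map_smul, smul_smul, ← neg_smul]
        congr 1
        field_simp
      rw [hrest, Finset.sum_neg_distrib, ← map_sum, ← jwA, neg_add_cancel]

theorem repA_jwD_one {n : ℕ} (hn : 2 ≤ n + 1) :
    repA hn (jwD n) (Finsupp.single (one (n + 1)) 1) = jwA (n + 1) :=
  (eq_repA_jwD hn (capCup_jwA (n + 1)) (jwA_one _)).symm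

end TLDiagram

/-! ### Dots and loop weights under rejoining. -/

section Rejoin

variable {α : Type*} [DecidableEq α] {m : α → α} {dot : α → Bool} {a b c d : α} {e f : Bool}

theorem redot_braid (hm : ∀ x, m (m x) = x) (hne : ∀ x, m x ≠ x)
    (hd : ∀ x, dot (m x) = dot x) (hab : a ≠ b) (hbc : b ≠ c) (hac : a ≠ c) :
    redot (rejoin (rejoin m a b) b c) (redot (rejoin m a b) (redot m dot a b e) b c f) a b e =
      redot m dot a b e ∧
    redot (rejoin (rejoin m b c) a b) (redot (rejoin m b c) (redot m dot b c e) a b f) b c e =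
      redot m dot b c e := by
  obtain ⟨X, hX⟩ : ∃ X : Bool → Bool → Bool → Bool, X = fun p q e => xor (xor p q) e := ⟨_, rfl⟩
  have h1 : ∀ p q e, X p q e = X q p e := by subst hX; decide
  have h2 : ∀ p e f, X (X e p f) f e = p := by subst hX; decide
  have hr : ∀ (m : α → α) (dot : α → Bool) (a b : α) (e : Bool) (x : α), redot m dot a b e x =
      if x = a ∨ x = b then e else if x = m a ∨ x = m b then X (dot a) (dot b) e else dot x := by
    intros; subst hX; rfl
  clear hX
  have ma := hm a; have mb := hm b; have mc := hm c
  have na := hne a; have nb := hne b; have nc := hne c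
  have da := hd a; have db := hd b; have dc := hd c
  constructor
  · funext x
    have mx := hm x; have dx := hd x; have nx := hne x
    have hr1 := hr m dot a b e
    have hr2 := hr (rejoin m a b) (redot m dot a b e) b c f
    have hr3 := hr (rejoin (rejoin m a b) b c)
      (redot (rejoin m a b) (redot m dot a b e) b c f) a b e
    clear hr
    grind (splits := 40) (ematch := 20) (gen := 20) (instances := 5000) [rejoin]
  · funext x
    have mx := hm x; have dx := hd x; have nx := hne x
    have hr1 := hr m dot b c e
    have hr2 := hr (rejoin m b c) (redot m dot b c e) a b f
    have hr3 := hr (rejoin (rejoin m b c) a b)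
      (redot (rejoin m b c) (redot m dot b c e) a b f) b c e
    clear hr
    grind (splits := 40) (ematch := 20) (gen := 20) (instances := 5000) [rejoin]

/-- The factor that arises from closing up the strands at `a` and `b` by a strand with label `e`:
a loop with an odd number of dots is zero. -/
noncomputable def loopWeight (m : α → α) (dot : α → Bool) (a b : α) (e : Bool) : Kq :=
  if m a = b then if dot a = e then -qint 2 else 0 else 1

/-- As for undotted loops, but the labels matter too. By `k5`, a loop that closes only in the second
step collects the same labels in both orders. -/
theorem loopWeight_comm (hm : ∀ x, m (m x) = x) (hd : ∀ x, dot (m x) = dot x) (hac : a ≠ c)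
    (had : a ≠ d) (hbc : b ≠ c) (hbd : b ≠ d) :
    loopWeight m dot a b e * loopWeight (rejoin m a b) (redot m dot a b e) c d f =
      loopWeight m dot c d f * loopWeight (rejoin m c d) (redot m dot c d f) a b e := by
  have e1 := hm a; have e2 := hm b; have e3 := hm c; have e4 := hm d
  have d1 := hd a; have d2 := hd b; have d3 := hd c; have d4 := hd d
  have h1 : m a = b → (rejoin m a b c = d ↔ m c = d) := by grind [rejoin]
  have h2 : m c = d → (rejoin m c d a = b ↔ m a = b) := by grind [rejoin]
  have h3 : m a ≠ b → m c ≠ d → (rejoin m a b c = d ↔ rejoin m c d a = b) := by grind [rejoin]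
  have h4 : m a ≠ b → m c = d → rejoin m a b c = d := by grind [rejoin]
  have h5 : m c ≠ d → m a = b → rejoin m c d a = b := by grind [rejoin]
  obtain ⟨X, hX⟩ : ∃ X : Bool → Bool → Bool → Bool, X = fun p q e => xor (xor p q) e := ⟨_, rfl⟩
  have x1 : ∀ p q e, X p q e = X q p e := by subst hX; decide
  have x2 : ∀ p q e f, X p q e = f → X p q f = e := by subst hX; decide
  have hr : ∀ (m : α → α) (dot : α → Bool) (a b : α) (e : Bool) (x : α), redot m dot a b e x =
      if x = a ∨ x = b then e else if x = m a ∨ x = m b then X (dot a) (dot b) e else dot x := by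
    intros; subst hX; rfl
  clear hX
  have k1 : m a = b → redot m dot a b e c = dot c := by rw [hr]; grind
  have k2 : m c = d → redot m dot c d f a = dot a := by rw [hr]; grind
  have k3 : m a ≠ b → m c = d → redot m dot a b e c = dot c := by rw [hr]; grind
  have k4 : m c ≠ d → m a = b → redot m dot c d f a = dot a := by rw [hr]; grind
  have k5 : m a ≠ b → m c ≠ d → rejoin m a b c = d →
      (redot m dot a b e c = f ↔ redot m dot c d f a = e) := by
    rw [hr, hr]; grind [rejoin]
  unfold loopWeight
  by_cases hab : m a = b <;> by_cases hcd : m c = d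
  · simp only [hab, hcd, if_true, h1 hab, h2 hcd, k1 hab, k2 hcd]; rw [mul_comm]
  · simp only [hab, hcd, if_true, if_false, h1 hab, h5 hcd hab, k4 hcd hab, mul_one, one_mul]
  · simp only [hab, hcd, if_true, if_false, h2 hcd, h4 hab hcd, k3 hab hcd, mul_one, one_mul]
  · by_cases hj : rejoin m a b c = d
    · simp only [hab, hcd, if_false, one_mul, if_pos hj, if_pos ((h3 hab hcd).mp hj), k5 hab hcd hj]
    · simp only [hab, hcd, if_false, one_mul, if_neg hj, if_neg (fun h => hj ((h3 hab hcd).mpr h))]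

end Rejoin

/-! # Dotted strands -/

/-- A perfect matching of a set of points in which each strand may carry a dot. -/
@[ext] structure Strands (α : Type) where
  /-- The other end of the strand at a point. -/
  mate : α → α
  /-- Whether the strand at a point carries a dot. -/
  dot : α → Bool
  mate_mate : ∀ x, mate (mate x) = x
  mate_ne : ∀ x, mate x ≠ x
  dot_mate : ∀ x, dot (mate x) = dot x

section LoopWeight

variable {α : Type*} [DecidableEq α] {m : α → α} {dot : α → Bool} {a b : α} {e : Bool}

theorem loopWeight_of_ne (h : m a ≠ b) : loopWeight m dot a b e = 1 := if_neg h

theorem loopWeight_of_eq (h : m a = b) (he : dot a = e) : loopWeight m dot a b e = -qint 2 := by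
  rw [loopWeight, if_pos h, if_pos he]

theorem loopWeight_of_dot_ne (h : m a = b) (he : dot a ≠ e) : loopWeight m dot a b e = 0 := by
  rw [loopWeight, if_pos h, if_neg he]

end LoopWeight

namespace Strands

variable {α : Type} [DecidableEq α] {a b c d : α} {e f : Bool}

/-- Put a cup and a cap with label `e` on the points `a`, `b`. -/
def act (D : Strands α) (hab : a ≠ b) (e : Bool) : Strands α where
  mate := rejoin D.mate a b
  dot := redot D.mate D.dot a b e
  mate_mate := rejoin_rejoin D.mate_mate D.mate_ne hab
  mate_ne := rejoin_ne D.mate_mate D.mate_ne hab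
  dot_mate := redot_rejoin D.mate_mate D.mate_ne D.dot_mate hab

theorem act_mate_left (D : Strands α) (hab : a ≠ b) (e : Bool) : (D.act hab e).mate a = b :=
  rejoin_left

theorem act_dot_left (D : Strands α) (hab : a ≠ b) (e : Bool) : (D.act hab e).dot a = e :=
  redot_left

/-- The operator that puts a cup and a cap with label `e` on the points `a`, `b`. -/
noncomputable def op (a b : α) (e : Bool) : Module.End Kq (Strands α →₀ Kq) :=
  if hab : a ≠ b then
    Finsupp.linearCombination Kq fun D =>
      loopWeight D.mate D.dot a b e • Finsupp.single (D.act hab e) 1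
  else 0

theorem op_single (hab : a ≠ b) (e : Bool) (D : Strands α) : op a b e (Finsupp.single D 1) =
    loopWeight D.mate D.dot a b e • Finsupp.single (D.act hab e) 1 := by
  rw [op, dif_pos hab, Finsupp.linearCombination_single, one_smul]

theorem op_single_of_mate (hab : a ≠ b) {D : Strands α} (h : D.mate a = b) (he : D.dot a = e) :
    op a b e (Finsupp.single D 1) = -qint 2 • Finsupp.single D 1 := by
  rw [op_single hab, loopWeight_of_eq h he]
  congr 2
  exact Strands.ext (rejoin_of_eq D.mate_mate h) (redot_of_eq D.mate_mate D.dot_mate h he)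

theorem op_single_of_dot_ne (hab : a ≠ b) {D : Strands α} (h : D.mate a = b) (he : D.dot a ≠ e) :
    op a b e (Finsupp.single D 1) = 0 := by
  rw [op_single hab, loopWeight_of_dot_ne h he, zero_smul]

theorem op_sq (hab : a ≠ b) : op a b e * op a b e = -qint 2 • op a b e := by
  refine TLDiagram.end_ext fun D => ?_
  rw [Module.End.mul_apply, LinearMap.smul_apply, op_single hab, map_smul,
    op_single_of_mate (D := D.act hab e) hab rejoin_left redot_left, smul_comm]

theorem op_mul_of_ne (hab : a ≠ b) (hef : e ≠ f) : op a b e * op a b f = 0 := by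
  refine TLDiagram.end_ext fun D => ?_
  rw [Module.End.mul_apply, LinearMap.zero_apply, op_single hab, map_smul,
    op_single_of_dot_ne (D := D.act hab f) hab rejoin_left
      (by rw [show (D.act hab f).dot a = f from redot_left]; exact hef.symm), smul_zero]

theorem op_comm (hab : a ≠ b) (hcd : c ≠ d) (hac : a ≠ c) (had : a ≠ d) (hbc : b ≠ c)
    (hbd : b ≠ d) : op a b e * op c d f = op c d f * op a b e := by
  refine TLDiagram.end_ext fun D => ?_
  have h1 : (D.act hcd f).act hab e = (D.act hab e).act hcd f :=
    Strands.ext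
      (rejoin_comm_of_disjoint D.mate_mate D.mate_ne hab hcd hac had hbc hbd).symm
      (redot_comm_of_disjoint D.mate_mate D.mate_ne D.dot_mate hab hcd hac had hbc hbd).symm
  simp only [Module.End.mul_apply, op_single hab, op_single hcd, map_smul, smul_smul, h1]
  congr 1
  exact (loopWeight_comm D.mate_mate D.dot_mate hac had hbc hbd).symm

theorem op_braid (hab : a ≠ b) (hbc : b ≠ c) (hac : a ≠ c) :
    op a b e * op b c f * op a b e = op a b e ∧ op b c f * op a b e * op b c f = op b c f := by
  constructor
  · refine TLDiagram.end_ext fun D => ?_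
    have h1 : ((D.act hab e).act hbc f).act hab e = D.act hab e :=
      Strands.ext (rejoin_braid D.mate_mate D.mate_ne hab hbc hac)
        (redot_braid D.mate_mate D.mate_ne D.dot_mate hab hbc hac).1
    have w1 : loopWeight (D.act hab e).mate (D.act hab e).dot b c f = 1 :=
      loopWeight_of_ne (by rw [show (D.act hab e).mate b = a from rejoin_right hab]; exact hac)
    have w2 : loopWeight ((D.act hab e).act hbc f).mate ((D.act hab e).act hbc f).dot a b e = 1 :=
      loopWeight_of_ne fun h => hac (by
        rw [← mate_mate ((D.act hab e).act hbc f) a, h]; exact rejoin_left)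
    simp only [Module.End.mul_apply, op_single hab, op_single hbc, map_smul, h1, w1, w2, one_smul]
  · refine TLDiagram.end_ext fun D => ?_
    have h1 : ((D.act hbc f).act hab e).act hbc f = D.act hbc f :=
      Strands.ext (rejoin_braid' D.mate_mate D.mate_ne hab hbc hac)
        (redot_braid D.mate_mate D.mate_ne D.dot_mate hab hbc hac).2
    have w1 : loopWeight (D.act hbc f).mate (D.act hbc f).dot a b e = 1 :=
      loopWeight_of_ne fun h => hac (by
        rw [← mate_mate (D.act hbc f) a, h]; exact rejoin_left)
    have w2 : loopWeight ((D.act hbc f).act hab e).mate ((D.act hbc f).act hab e).dot b c f = 1 :=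
      loopWeight_of_ne (by
        rw [show ((D.act hbc f).act hab e).mate b = a from rejoin_right hab]; exact hac)
    simp only [Module.End.mul_apply, op_single hab, op_single hbc, map_smul, h1, w1, w2, one_smul]

/-- Any labels are admissible. The only new case is the pair of indices 0 and 1 at the same place:
either the labels agree, or both products close a loop with one dot and vanish. -/
theorem isTLDSystem_op {pts : ℕ → α} (hp : Function.Injective pts) (lab : ℕ → Bool) (N : ℕ) :
    IsTLDSystem N fun i => op (pts (max i 1 - 1)) (pts (max i 1)) (lab i) where
  sq i _ := op_sq (hp.ne (by omega))
  braid i j hi hj hij := by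
    unfold NAdj at hij
    rcases (by omega : max i 1 = max j 1 - 1 ∨ max j 1 = max i 1 - 1) with h | h
    · simp only [h]
      exact (op_braid (hp.ne (by omega)) (hp.ne (by omega)) (hp.ne (by omega))).1
    · simp only [h]
      exact (op_braid (hp.ne (by omega)) (hp.ne (by omega)) (hp.ne (by omega))).2
  comm i j hi hj hij := by
    unfold NAdj at hij
    by_cases h : max i 1 = max j 1
    · simp only [h]
      by_cases hl : lab i = lab j
      · rw [hl]
      · rw [op_mul_of_ne (hp.ne (by omega)) hl, op_mul_of_ne (hp.ne (by omega)) (Ne.symm hl)]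
    · exact op_comm (hp.ne (by omega)) (hp.ne (by omega)) (hp.ne (by omega)) (hp.ne (by omega))
        (hp.ne (by omega)) (hp.ne (by omega))

/-- The representation of `TL^D_N` on the dotted strands on a set with distinguished points
`pts 0, pts 1, …`, in which the cup and the cap of the `i`-th generator have the label `lab i`. -/
noncomputable def rep {pts : ℕ → α} (hp : Function.Injective pts) (lab : ℕ → Bool) (N : ℕ) :
    TLD N →ₐ[Kq] Module.End Kq (Strands α →₀ Kq) := liftTLD (isTLDSystem_op hp lab N)

variable {pts : ℕ → α} {hp : Function.Injective pts} {lab : ℕ → Bool} {N : ℕ}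

theorem rep_genE (i : Fin N) : rep hp lab N (genE i) =
    op (pts (max i.val 1 - 1)) (pts (max i.val 1)) (lab i) := liftTLD_genE _ i

theorem rep_genN {i : ℕ} (hi : i < N) : rep hp lab N (genN N i) =
    op (pts (max i 1 - 1)) (pts (max i 1)) (lab i) := liftTLD_genN _ hi

theorem rep_incl {M : ℕ} (h : M ≤ N) (x : TLD M) :
    rep hp lab N (inclTLD h x) = rep hp lab M x := by
  induction x using TLD.induction with
  | hadd x y hx hy => rw [map_add, map_add, hx, hy, map_add]
  | hsmul c x hx => rw [map_smul, map_smul, hx, map_smul]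
  | hword w =>
    induction w with
    | nil => simp [wordE]
    | cons i w ih =>
      rw [wordE_cons, map_mul, map_mul, ih, map_mul, inclTLD_genE, rep_genE, rep_genE]
      rfl

/-- The strands on `α × Bool` that join `(x, false)` to `(x, true)`, without dots. -/
def straight (α : Type) : Strands (α × Bool) where
  mate x := (x.1, !x.2)
  dot _ := false
  mate_mate x := by simp
  mate_ne x h := by simpa using congrArg Prod.snd h
  dot_mate _ := rfl

theorem op_apply_of_mate_ne (hab : a ≠ b) {D : Strands α} (h : D.mate a ≠ b)
    (p : Strands α →₀ Kq) : op a b e p D = 0 := by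
  have : (Finsupp.lapply D).comp (op a b e) = (0 : (Strands α →₀ Kq) →ₗ[Kq] Kq) := by
    refine TLDiagram.end_ext fun D' => ?_
    rw [LinearMap.comp_apply, op_single hab, map_smul, Finsupp.lapply_apply,
      Finsupp.single_eq_of_ne, smul_zero, LinearMap.zero_apply]
    rintro rfl
    exact h rejoin_left
  exact congrArg (fun g => g p) this

/-- A nonempty word creates a strand between two points with second component `true`, and `straight`
has none. So the augmentation is visible in the representation. -/
theorem rep_straight_apply (hp : Function.Injective fun n : ℕ => (n, true)) (x : TLD N) :
    rep hp lab N x (Finsupp.single (straight ℕ) 1) (straight ℕ) = augTLD N x := by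
  induction x using TLD.induction with
  | hadd x y hx hy => rw [map_add, LinearMap.add_apply, Finsupp.add_apply, hx, hy, map_add]
  | hsmul c x hx => rw [map_smul, LinearMap.smul_apply, Finsupp.smul_apply, hx, map_smul]
  | hword w =>
    cases w with
    | nil => rw [augTLD_wordE_nil]; simp [wordE]
    | cons i w =>
      rw [augTLD_wordE_cons, wordE_cons, map_mul, rep_genE, Module.End.mul_apply]
      exact op_apply_of_mate_ne (hp.ne (by omega)) (by simp [straight]) _

end Strands

/-- The element `x` acts as zero on all dotted strands, if the cup and the cap of the `i`-th
generator have the label `lab i`. -/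
def Vanishes (lab : ℕ → Bool) {N : ℕ} (x : TLD N) : Prop :=
  ∀ (α : Type) [DecidableEq α] (pts : ℕ → α) (hp : Function.Injective pts),
    Strands.rep hp lab N x = 0

namespace Vanishes

variable {lab : ℕ → Bool} {N : ℕ} {x y : TLD N}

theorem add (hx : Vanishes lab x) (hy : Vanishes lab y) : Vanishes lab (x + y) :=
  fun α _ pts hp => by rw [map_add, hx, hy, add_zero]

theorem smul (c : Kq) (hx : Vanishes lab x) : Vanishes lab (c • x) :=
  fun α _ pts hp => by rw [map_smul, hx, smul_zero]

theorem mul_left (hx : Vanishes lab x) (y : TLD N) : Vanishes lab (y * x) :=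
  fun α _ pts hp => by rw [map_mul, hx, mul_zero]

theorem mul_right (hx : Vanishes lab x) (y : TLD N) : Vanishes lab (x * y) :=
  fun α _ pts hp => by rw [map_mul, hx, zero_mul]

theorem augTLD_eq_zero (hx : Vanishes lab x) : augTLD N x = 0 := by
  have hp : Function.Injective fun n : ℕ => (n, true) := fun a b h => congrArg Prod.fst h
  rw [← Strands.rep_straight_apply (lab := lab) hp, hx, LinearMap.zero_apply, Finsupp.zero_apply]

end Vanishes

/-! ## Adding a strand -/

theorem rejoin_sumMap {α β : Type*} [DecidableEq α] [DecidableEq β] (m : α → α) (n : β → β)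
    (a b : α) : rejoin (Sum.map m n) (Sum.inl a) (Sum.inl b) = Sum.map (rejoin m a b) n := by
  funext x
  rcases x with x | x
  · simp only [rejoin, Sum.map_inl, Sum.inl.injEq]
    split_ifs <;> rfl
  · simp [rejoin]

theorem redot_sumElim {α β : Type*} [DecidableEq α] [DecidableEq β] (m : α → α) (n : β → β)
    (dot : α → Bool) (dot' : β → Bool) (a b : α) (e : Bool) :
    redot (Sum.map m n) (Sum.elim dot dot') (Sum.inl a) (Sum.inl b) e =
      Sum.elim (redot m dot a b e) dot' := by
  funext x
  rcases x with x | x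
  · simp [redot]
  · simp [redot]

namespace Strands

variable {α : Type} {a b : α} {e : Bool}

/-- Add two points and a strand with label `e` that joins them. -/
def extend (e : Bool) (D : Strands α) : Strands (α ⊕ Bool) where
  mate := Sum.map D.mate not
  dot := Sum.elim D.dot fun _ => e
  mate_mate x := by rcases x with x | x <;> simp [D.mate_mate]
  mate_ne x := by rcases x with x | x <;> simp [D.mate_ne]
  dot_mate x := by rcases x with x | x <;> simp [D.dot_mate]

theorem extend_injective : Function.Injective (extend (α := α) e) := by
  intro D D' h
  have h1 : ∀ x, (D.extend e).mate (Sum.inl x) = (D'.extend e).mate (Sum.inl x) := by simp [h]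
  have h2 : ∀ x, (D.extend e).dot (Sum.inl x) = (D'.extend e).dot (Sum.inl x) := by simp [h]
  exact Strands.ext (funext fun x => Sum.inl_injective (h1 x)) (funext h2)

theorem op_extend [DecidableEq α] (hab : a ≠ b) (f : Bool) (p : Strands α →₀ Kq) :
    op (Sum.inl a) (Sum.inl b) f (Finsupp.lmapDomain Kq Kq (extend e) p) =
      Finsupp.lmapDomain Kq Kq (extend e) (op a b f p) := by
  have hab' : (Sum.inl a : α ⊕ Bool) ≠ Sum.inl b := Sum.inl_injective.ne hab
  have : (op (Sum.inl a) (Sum.inl b) f).comp (Finsupp.lmapDomain Kq Kq (extend e)) =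
      (Finsupp.lmapDomain Kq Kq (extend e)).comp (op a b f) := by
    refine TLDiagram.end_ext fun D => ?_
    rw [LinearMap.comp_apply, LinearMap.comp_apply, op_single hab, map_smul,
      Finsupp.lmapDomain_apply, Finsupp.lmapDomain_apply, Finsupp.mapDomain_single,
      Finsupp.mapDomain_single, op_single hab']
    have h1 : (D.extend e).act hab' f = (D.act hab f).extend e :=
      Strands.ext (rejoin_sumMap _ _ _ _) (redot_sumElim D.mate not _ _ _ _ _)
    have h2 : loopWeight (D.extend e).mate (D.extend e).dot (Sum.inl a) (Sum.inl b) f =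
        loopWeight D.mate D.dot a b f := by
      simp only [loopWeight, extend, Sum.map_inl, Sum.elim_inl, Sum.inl.injEq]
      congr
    rw [h1, h2]
  exact congrArg (fun g => g p) this

/-- Insert the two new points as the points number `k` and `k + 1`. -/
def insertPts (pts : ℕ → α) (k i : ℕ) : α ⊕ Bool :=
  if i < k then Sum.inl (pts i) else if i = k then Sum.inr false
  else if i = k + 1 then Sum.inr true else Sum.inl (pts (i - 2))

theorem insertPts_injective {pts : ℕ → α} (hp : Function.Injective pts) (k : ℕ) :
    Function.Injective (insertPts pts k) := by
  intro i j h
  unfold insertPts at h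
  split_ifs at h <;> simp only [Sum.inl.injEq, Sum.inr.injEq, Bool.false_eq_true,
    Bool.true_eq_false] at h
  all_goals first | omega | (have := hp h; omega)

theorem rep_extend [DecidableEq α] {pts : ℕ → α} (hp : Function.Injective pts)
    {lab : ℕ → Bool} {j k : ℕ}
    (hj : ∀ i < j, max i 1 < k) (y : TLD j) (p : Strands α →₀ Kq) :
    rep (insertPts_injective hp k) lab j y (Finsupp.lmapDomain Kq Kq (extend e) p) =
      Finsupp.lmapDomain Kq Kq (extend e) (rep hp lab j y p) := by
  induction y using TLD.induction generalizing p with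
  | hadd x y hx hy =>
    rw [map_add, map_add, LinearMap.add_apply, hx, hy, LinearMap.add_apply, map_add]
  | hsmul c x hx =>
    rw [map_smul, map_smul, LinearMap.smul_apply, hx, LinearMap.smul_apply, map_smul]
  | hword w =>
    induction w with
    | nil => simp [wordE]
    | cons i w ih =>
      have hi := hj i i.2
      rw [wordE_cons, map_mul, map_mul, Module.End.mul_apply, ih, rep_genE, Module.End.mul_apply,
        rep_genE, ← op_extend (hp.ne (by omega))]
      simp only [insertPts, if_pos hi, if_pos (lt_of_le_of_lt (Nat.sub_le _ 1) hi)]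

end Strands

/-- Extend arbitrary strands by a separate strand with label `lab m` that joins the points number `m
- 1` and `m`. There `E_m` acts by `-[2]`, while `y` involves only earlier points and acts as before.
-/
theorem Vanishes.of_mul {lab : ℕ → Bool} {j m : ℕ} (hm : 2 ≤ m) (hj : ∀ i < j, max i 1 < m - 1)
    (h : j ≤ m + 1) {y : TLD j} (hy : Vanishes lab (inclTLD h y * genN (m + 1) m)) :
    Vanishes lab y := by
  intro α _ pts hp
  refine TLDiagram.end_ext fun D => ?_
  have h1 := hy _ _ (Strands.insertPts_injective hp (m - 1))
  have h2 := congrArg (fun g => g (Finsupp.lmapDomain Kq Kq (Strands.extend (lab m))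
    (Finsupp.single D 1))) h1
  have hm1 : max m 1 = m := by omega
  have e1 : Strands.insertPts pts (m - 1) (m - 1) = Sum.inr false := by simp [Strands.insertPts]
  have e2 : Strands.insertPts pts (m - 1) m = Sum.inr true := by
    rw [Strands.insertPts, if_neg (by omega), if_neg (by omega), if_pos (by omega)]
  have e3 := Strands.op_single_of_mate (α := α ⊕ Bool) (a := Sum.inr false) (b := Sum.inr true)
    (e := lab m) (by simp) (D := D.extend (lab m)) rfl rfl
  simp only [map_mul, Strands.rep_incl, Strands.rep_genN (Nat.lt_succ_self m), hm1, e1, e2,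
    Module.End.mul_apply, LinearMap.zero_apply] at h2
  rw [Finsupp.lmapDomain_apply, Finsupp.mapDomain_single, e3, map_smul] at h2
  have h3 := (smul_eq_zero.mp h2).resolve_left (neg_ne_zero.mpr qint_two_ne_zero)
  have h4 := Strands.rep_extend (e := lab m) hp (lab := lab) hj y (Finsupp.single D 1)
  rw [Finsupp.lmapDomain_apply, Finsupp.mapDomain_single, h3, Finsupp.lmapDomain_apply] at h4
  rw [LinearMap.zero_apply]
  exact Finsupp.mapDomain_injective Strands.extend_injective
    (h4.symm.trans Finsupp.mapDomain_zero.symm)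

/-! # Joint injectivity of the dotted and the undotted representation -/

/-- The labels of the type D representation: the generator `E_0` carries dots. -/
def labD (i : ℕ) : Bool := decide (i = 0)

/-- The labels of the type A representation: there are no dots. -/
def labA (_ : ℕ) : Bool := false

theorem map_forkElt {B C : Type*} [Ring B] [Algebra Kq B] [Ring C] [Algebra Kq C]
    (f : B →ₐ[Kq] C) (E : ℕ → B) (k : ℕ) : f (forkElt E k) = forkElt (fun i => f (E i)) k := by
  match k with
  | 0 => simp only [forkElt, map_mul]
  | 1 => simp only [forkElt, map_mul]
  | k + 2 => simp only [forkElt, map_mul, map_forkElt f E (k + 1)]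

theorem forkElt_congr {B : Type*} [Mul B] {E E' : ℕ → B} {N : ℕ} (hN : 2 ≤ N)
    (h : ∀ i < N, E i = E' i) {k : ℕ} (hk : k < N) : forkElt E k = forkElt E' k := by
  match k with
  | 0 => simp only [forkElt, h 0 (by omega), h 1 (by omega)]
  | 1 => simp only [forkElt, h 0 (by omega), h 1 (by omega)]
  | k + 2 => simp only [forkElt, h _ hk, forkElt_congr hN h (by omega : k + 1 < N)]

theorem inclTLD_forkElt {M N : ℕ} (h : M ≤ N) (hM : 2 ≤ M) {k : ℕ} (hk : k < M) :
    inclTLD h (forkElt (genN M) k) = forkElt (genN N) k := by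
  rw [map_forkElt]
  exact forkElt_congr hM (fun i hi => inclTLD_genN h hi) hk

theorem vanishes_forkElt {N : ℕ} (hN : 2 ≤ N) {k : ℕ} (hk : k < N) :
    Vanishes labD (forkElt (genN N) k) := by
  have h01 : Vanishes labD (genN N 0 * genN N 1) := by
    intro α _ pts hp
    rw [map_mul, Strands.rep_genN (by omega), Strands.rep_genN (by omega)]
    exact Strands.op_mul_of_ne (hp.ne (by omega)) (by decide)
  match k with
  | 0 => exact h01
  | 1 => exact h01
  | k + 2 => exact ((vanishes_forkElt hN (by omega : k + 1 < N)).mul_left _).mul_right _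

/-- Without dots `E_0 E_1` is a square, hence `-[2] E_1`; the outer factors contract by the braid
relation. Together with `vanishes_forkElt` this distinguishes `F_k` from `E_k`. -/
theorem rep_labA_forkElt {N : ℕ} (hN : 2 ≤ N) {k : ℕ} (hk : k < N) {α : Type} [DecidableEq α]
    {pts : ℕ → α} (hp : Function.Injective pts) :
    Strands.rep hp labA N (forkElt (genN N) k) = -qint 2 • Strands.rep hp labA N (genN N k) := by
  match k with
  | 0 | 1 =>
    rw [forkElt, map_mul, Strands.rep_genN (by omega), Strands.rep_genN (by omega)]
    exact Strands.op_sq (hp.ne (by omega))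
  | k + 2 =>
    have h := (isTLDSystem_genN N).braid (k + 2) (k + 1) hk (by omega) (by unfold NAdj; omega)
    conv_rhs => rw [← h]
    rw [forkElt, map_mul, map_mul, rep_labA_forkElt hN (by omega : k + 1 < N), mul_smul_comm,
      smul_mul_assoc, map_mul, map_mul]

theorem wordE_mem_monomials {N : ℕ} (w : List (Fin N)) : wordE w ∈ monomials (genN N) N := by
  induction w with
  | nil => exact one_mem _
  | cons i w ih =>
    rw [wordE_cons, ← genN_val]
    exact mul_mem (mem_monomials i.2) ih

theorem exists_inclTLD_eq {M N : ℕ} (h : M ≤ N) {u : TLD N} (hu : u ∈ monomials (genN N) M) :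
    ∃ y : TLD M, inclTLD h y = u := by
  induction hu using Submonoid.closure_induction with
  | mem z hz =>
    rcases hz with ⟨c, rfl⟩ | ⟨i, hi, rfl⟩
    · exact ⟨algebraMap Kq _ c, AlgHom.commutes _ c⟩
    · exact ⟨genN M i, inclTLD_genN h hi⟩
  | one => exact ⟨1, map_one _⟩
  | mul a b _ _ ha hb =>
    obtain ⟨y, rfl⟩ := ha
    obtain ⟨y', rfl⟩ := hb
    exact ⟨y * y', map_mul _ _ _⟩

theorem exists_corner {m : ℕ} (hm : 2 ≤ m) (h : lowIndex m ≤ m + 1) (x : TLD (m + 1)) :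
    ∃ y y' : TLD (lowIndex m), genN (m + 1) m * x * genN (m + 1) m =
      inclTLD h y * genN (m + 1) m + inclTLD h y' * forkElt (genN (m + 1)) m := by
  induction x using TLD.induction with
  | hadd x y hx hy =>
    obtain ⟨a, a', ha⟩ := hx
    obtain ⟨b, b', hb⟩ := hy
    refine ⟨a + b, a' + b', ?_⟩
    rw [mul_add, add_mul, ha, hb, map_add, map_add, add_mul, add_mul, add_add_add_comm]
  | hsmul c x hx =>
    obtain ⟨a, a', ha⟩ := hx
    refine ⟨c • a, c • a', ?_⟩
    rw [mul_smul_comm, smul_mul_assoc, ha, map_smul, map_smul, smul_mul_assoc, smul_mul_assoc,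
      smul_add]
  | hword w =>
    obtain ⟨u, hu, e | e⟩ := (isTLDSystem_genN (m + 1)).corner hm (by omega) (wordE_mem_monomials w)
    · obtain ⟨y, rfl⟩ := exists_inclTLD_eq h hu
      exact ⟨y, 0, by rw [e, map_zero, zero_mul, add_zero]⟩
    · obtain ⟨y, rfl⟩ := exists_inclTLD_eq h hu
      exact ⟨0, y, by rw [e, map_zero, zero_mul, zero_add]⟩

/-- Replace the last letter `E_i` of a word by `forkElt i`, up to a scalar. -/
theorem exists_fork_lift {m : ℕ} (h : lowIndex m ≤ m + 1) (y : TLD (lowIndex m)) :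
    ∃ y' : TLD (lowIndex m), Vanishes labD y' ∧
      (∀ (α : Type) [DecidableEq α] (pts : ℕ → α) (hp : Function.Injective pts),
        Strands.rep hp labA _ y = Strands.rep hp labA _ y' + augTLD _ y • 1) ∧
      inclTLD h y * forkElt (genN (m + 1)) m =
        inclTLD h y' * forkElt (genN (m + 1)) m + augTLD _ y • forkElt (genN (m + 1)) m ∧
      inclTLD h y' * genN (m + 1) m =
        -(qint 2)⁻¹ • (inclTLD h y' * forkElt (genN (m + 1)) m) := by
  induction y using TLD.induction with
  | hadd x y hx hy =>
    obtain ⟨a, a1, a2, a3, a4⟩ := hx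
    obtain ⟨b, b1, b2, b3, b4⟩ := hy
    refine ⟨a + b, a1.add b1, fun α _ pts hp => ?_, ?_, ?_⟩
    · rw [map_add, map_add, a2, b2, map_add, add_smul, add_add_add_comm]
    · rw [map_add, map_add, map_add, add_mul, a3, b3, add_mul, add_smul, add_add_add_comm]
    · rw [map_add, add_mul, a4, b4, add_mul, smul_add]
  | hsmul c x hx =>
    obtain ⟨a, a1, a2, a3, a4⟩ := hx
    refine ⟨c • a, a1.smul c, fun α _ pts hp => ?_, ?_, ?_⟩
    · rw [map_smul, map_smul, a2, map_smul, smul_add, smul_assoc]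
    · rw [map_smul, map_smul, map_smul, smul_mul_assoc, smul_mul_assoc, a3, smul_add, smul_assoc]
    · rw [map_smul, smul_mul_assoc, a4, smul_mul_assoc, smul_comm]
  | hword w =>
    rcases List.eq_nil_or_concat w with rfl | ⟨w, i, rfl⟩
    · refine ⟨0, fun α _ pts hp => map_zero _, fun α _ pts hp => ?_, ?_, ?_⟩
      · rw [augTLD_wordE_nil, map_zero, zero_add, one_smul]; simp [wordE]
      · rw [augTLD_wordE_nil, map_zero, zero_mul, zero_add, one_smul]; simp [wordE]
      · simp
    · have hi := i.2
      have hm : 3 ≤ m ∧ lowIndex m = m - 1 := by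
        unfold lowIndex at hi ⊢
        split_ifs at hi ⊢ <;> omega
      have h0 : augTLD _ (wordE (w.concat i)) = 0 := by
        rw [List.concat_eq_append, wordE_append, map_mul, augTLD_wordE_cons, mul_zero]
      have hw : wordE (w.concat i) = wordE w * genN (lowIndex m) i.val := by
        rw [List.concat_eq_append, wordE_append, wordE_cons, genN_val]; simp [wordE]
      have hF : inclTLD h (forkElt (genN (lowIndex m)) i.val) = forkElt (genN (m + 1)) i.val :=
        inclTLD_forkElt h (by omega) hi
      have hE : inclTLD h (genN (lowIndex m) i.val) = genN (m + 1) i.val := inclTLD_genN h hi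
      have hs := qint_two_ne_zero
      have sys := isTLDSystem_genN (m + 1)
      have hFF := sys.forkElt_mul_forkElt (i := i.val) hm.1 (by omega) (by omega : m < m + 1)
      have hEF := sys.mul_forkElt (i := i.val) hm.1 (by omega) (by omega : m < m + 1)
      have hss : -(qint 2)⁻¹ * -qint 2 = 1 := by field_simp
      refine ⟨-(qint 2)⁻¹ • (wordE w * forkElt (genN (lowIndex m)) i.val),
        ((vanishes_forkElt (by omega) hi).mul_left _).smul _, fun α _ pts hp => ?_, ?_, ?_⟩
      -- The last letter `E_i` is replaced by `-[2]⁻¹ F_i`. This is the same without dots, zero with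
      -- dots, and the same in front of `F_m` because `F_i F_m = -[2] E_i F_m`. The empty word has
      -- no last letter and accounts for the augmentation term.
      · rw [h0, zero_smul, add_zero, hw, map_smul, map_mul, map_mul,
          rep_labA_forkElt (by omega) hi, mul_smul_comm, smul_smul, hss, one_smul]
      · rw [h0, zero_smul, add_zero, hw, map_smul, map_mul, map_mul, hF, hE, smul_mul_assoc,
          mul_assoc, mul_assoc, hFF, mul_smul_comm, smul_smul, hss, one_smul]
      · rw [map_smul, map_mul, hF, smul_mul_assoc, smul_mul_assoc, mul_assoc, mul_assoc, hFF,
          mul_smul_comm, smul_smul (-(qint 2)⁻¹) (-qint 2), hss, one_smul, hEF]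

theorem eq_smul_of_add {B : Type*} [Ring B] [Algebra Kq B] {x y : B} {c : Kq}
    (h : x + -c • y = 0) : x = c • y := by
  rwa [neg_smul, ← sub_eq_add_neg, sub_eq_zero] at h

theorem add_neg_one_smul {B : Type*} [Ring B] [Algebra Kq B] (x : B) : x + -(1 : Kq) • x = 0 := by
  rw [neg_smul, one_smul, add_neg_cancel]

/-- Joint injectivity for `TL^D_N`. -/
def JointlyFaithful (N : ℕ) : Prop := ∀ x : TLD N, Vanishes labA x → Vanishes labD x → x = 0

theorem jointlyFaithful_zero : JointlyFaithful 0 := by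
  intro x hx _
  have h : ∀ x : TLD 0, x = augTLD 0 x • 1 := by
    intro x
    induction x using TLD.induction with
    | hadd x y hx hy => rw [map_add, add_smul, ← hx, ← hy]
    | hsmul c x hx => rw [map_smul, smul_assoc, ← hx]
    | hword w =>
      cases w with
      | nil => rw [augTLD_wordE_nil, one_smul]; rfl
      | cons i => exact i.elim0
  rw [h x, hx.augTLD_eq_zero, zero_smul]

/-- Write the corner as `y E_m + y' F_m`. With dots `F_m` is zero, so `y` vanishes there; without
dots `F_m` is `-[2] E_m`, so `y' - [2]⁻¹ y` vanishes there. Both have augmentation zero and can be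
lifted by `exists_fork_lift`. By induction `y` equals its lift, hence `y E_m = -[2]⁻¹ y F_m`, and
the corner is `(y' - [2]⁻¹ y) F_m`. The lift `u` of this last coefficient vanishes in both
representations, so it is zero. -/
theorem corner_eq_zero {m : ℕ} (hm : 2 ≤ m) (ih : JointlyFaithful (lowIndex m)) {x : TLD (m + 1)}
    (hA : Vanishes labA x) (hD : Vanishes labD x) :
    genN (m + 1) m * x * genN (m + 1) m = 0 := by
  have h : lowIndex m ≤ m + 1 := (lowIndex_le m).trans (by omega)
  have hlow : ∀ i < lowIndex m, max i 1 < m - 1 := by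
    intro i hi
    unfold lowIndex at hi
    split_ifs at hi <;> omega
  have hs := qint_two_ne_zero
  obtain ⟨y, y', e⟩ := exists_corner hm h x
  have zA := (hA.mul_left (genN (m + 1) m)).mul_right (genN (m + 1) m)
  have zD := (hD.mul_left (genN (m + 1) m)).mul_right (genN (m + 1) m)
  have yD : Vanishes labD y := Vanishes.of_mul hm hlow h fun α _ pts hp => by
    have h1 := zD α pts hp
    rwa [e, map_add, map_mul _ (inclTLD h y'), vanishes_forkElt (by omega) (by omega), mul_zero,
      add_zero] at h1
  have yA : Vanishes labA (y' + -(qint 2)⁻¹ • y) := by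
    refine Vanishes.of_mul hm hlow h fun α _ pts hp => ?_
    have h1 := zA α pts hp
    rw [e, map_add, map_mul, map_mul, rep_labA_forkElt (by omega) (by omega)] at h1
    have h2 : -(qint 2)⁻¹ • (Strands.rep hp labA (m + 1) (inclTLD h y) *
        Strands.rep hp labA (m + 1) (genN (m + 1) m) +
        Strands.rep hp labA (m + 1) (inclTLD h y') *
          (-qint 2 • Strands.rep hp labA (m + 1) (genN (m + 1) m))) = 0 := by
      rw [h1, smul_zero]
    have hss : -(qint 2)⁻¹ * -qint 2 = 1 := by field_simp
    rw [smul_add, mul_smul_comm, smul_smul, hss, one_smul, add_comm] at h2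
    rw [map_mul, map_add, map_smul, map_add, map_smul, add_mul, smul_mul_assoc]
    exact h2
  have step : ∀ z : TLD (lowIndex m), augTLD _ z = 0 → ∃ z' : TLD (lowIndex m), Vanishes labD z' ∧
      (∀ (α : Type) [DecidableEq α] (pts : ℕ → α) (hp : Function.Injective pts),
        Strands.rep hp labA _ z = Strands.rep hp labA _ z') ∧
      inclTLD h z * forkElt (genN (m + 1)) m = inclTLD h z' * forkElt (genN (m + 1)) m ∧
      inclTLD h z' * genN (m + 1) m =
        -(qint 2)⁻¹ • (inclTLD h z' * forkElt (genN (m + 1)) m) := by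
    intro z hz
    obtain ⟨z', h1, h2, h3, h4⟩ := exists_fork_lift h z
    simp only [hz, zero_smul, add_zero] at h2 h3
    exact ⟨z', h1, h2, h3, h4⟩
  obtain ⟨v, v1, v2, -, v4⟩ := step y yD.augTLD_eq_zero
  obtain rfl : y = v := by
    have := ih (y + -(1 : Kq) • v) (fun α _ pts hp => by
      rw [map_add, map_smul, v2]
      exact add_neg_one_smul (Strands.rep hp labA (lowIndex m) v)) (yD.add (v1.smul _))
    rw [eq_smul_of_add this, one_smul]
  obtain ⟨u, u1, u2, u3, -⟩ := step _ yA.augTLD_eq_zero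
  have hu : u = 0 := ih u (fun α _ pts hp => by rw [← u2, yA]) u1
  rw [hu, map_zero, zero_mul, map_add, map_smul, add_mul, smul_mul_assoc] at u3
  rw [e, v4]
  exact (add_comm _ _).trans u3

/-- Use `E_i = E_i E_j E_i` along the connected Dynkin diagram; every generator lies in the ideal
generated by `E_m`. -/
theorem IsTLDSystem.exists_eq_mul_mul {B : Type*} [Ring B] [Algebra Kq B] {N : ℕ} {E : ℕ → B}
    (h : IsTLDSystem N E) {m : ℕ} (hm : 2 ≤ m) (hN : m < N) {i : ℕ} (hi : i ≤ m) :
    ∃ a b, E i = a * E m * b := by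
  have key : ∀ d i, 1 ≤ i → i + d = m → ∃ a b, E i = a * E m * b := by
    intro d
    induction d with
    | zero => rintro i _ rfl; exact ⟨1, 1, by simp⟩
    | succ d ih =>
      intro i hi hd
      obtain ⟨a, b, e⟩ := ih (i + 1) (by omega) (by omega)
      refine ⟨E i * a, b * E i, ?_⟩
      have hb := h.braid i (i + 1) (by omega) (by omega) (by unfold NAdj; omega)
      rw [e] at hb
      conv_lhs => rw [← hb]
      simp only [mul_assoc]
  rcases Nat.eq_zero_or_pos i with rfl | h0
  · obtain ⟨a, b, e⟩ := key (m - 2) 2 (by omega) (by omega)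
    refine ⟨E 0 * a, b * E 0, ?_⟩
    have hb := h.braid 0 2 (by omega) (by omega) (by unfold NAdj; omega)
    rw [e] at hb
    conv_lhs => rw [← hb]
    simp only [mul_assoc]
  · exact key (m - i) i h0 (by omega)

theorem mul_eq_augTLD_smul {N : ℕ} {s : TLD N} (h : ∀ i, s * genE i = 0) (t : TLD N) :
    s * t = augTLD N t • s := by
  rw [← incl_mul_of_kill le_rfl h, inclTLD_self]

theorem mul_eq_augTLD_smul' {N : ℕ} {s : TLD N} (h : ∀ i, genE i * s = 0) (t : TLD N) :
    t * s = augTLD N t • s := by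
  rw [← mul_incl_of_kill le_rfl h, inclTLD_self]

/-- The corners of all `u x v` vanish, so `E_m u x` is killed by every generator on the right. It is
therefore fixed by the projection on the right, but `x` times the projection is the augmentation of
`x`, which is zero, times the projection. Hence all `E_i x` vanish, and the same argument on the
left gives `x = 0`. -/
theorem jointlyFaithful_succ {m : ℕ} (hm : 2 ≤ m) (ih : JointlyFaithful (lowIndex m)) :
    JointlyFaithful (m + 1) := by
  intro x hA hD
  have sys := isTLDSystem_genN (m + 1)
  have h1 : ∀ u v, genN (m + 1) m * (u * x * v) * genN (m + 1) m = 0 := fun u v =>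
    corner_eq_zero hm ih ((hA.mul_left u).mul_right v) ((hD.mul_left u).mul_right v)
  have h2 : ∀ u, genN (m + 1) m * u * x = 0 := by
    intro u
    have h3 : ∀ i, genN (m + 1) m * u * x * genE i = 0 := by
      intro i
      obtain ⟨a, b, e⟩ := sys.exists_eq_mul_mul hm (by omega) (Nat.lt_succ_iff.mp i.2)
      rw [← genN_val, e]
      have := congrArg (· * b) (h1 u a)
      simp only [zero_mul] at this
      simpa only [mul_assoc] using this
    have h4 := mul_eq_augTLD_smul h3 (jwD m)
    rw [augTLD_jwD, one_smul, mul_assoc, mul_eq_augTLD_smul' genE_mul_jwD x, hA.augTLD_eq_zero,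
      zero_smul, mul_zero] at h4
    exact h4.symm
  have h5 : ∀ i, genE i * x = 0 := by
    intro i
    obtain ⟨a, b, e⟩ := sys.exists_eq_mul_mul hm (by omega) (Nat.lt_succ_iff.mp i.2)
    rw [← genN_val, e, mul_assoc, mul_assoc, ← mul_assoc (genN (m + 1) m), h2, mul_zero]
  have h6 := mul_eq_augTLD_smul' h5 (jwD m)
  rw [augTLD_jwD, one_smul, mul_eq_augTLD_smul jwD_mul_genE, hA.augTLD_eq_zero, zero_smul] at h6
  exact h6.symm

theorem jointlyFaithful_two : JointlyFaithful 2 := by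
  intro x hA hD
  obtain ⟨a, b, c, d, e⟩ : ∃ a b c d : Kq, x = a • 1 + b • genN 2 0 + c • genN 2 1 +
      d • (genN 2 0 * genN 2 1) := by
    clear hA hD
    induction x using TLD.induction with
    | hadd x y hx hy =>
      obtain ⟨a, b, c, d, rfl⟩ := hx
      obtain ⟨a', b', c', d', rfl⟩ := hy
      refine ⟨a + a', b + b', c + c', d + d', ?_⟩
      simp only [add_smul]
      abel
    | hsmul r x hx =>
      obtain ⟨a, b, c, d, rfl⟩ := hx
      refine ⟨r * a, r * b, r * c, r * d, ?_⟩
      simp only [smul_add, smul_smul]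
    | hword w =>
      obtain ⟨c, h | h | h | h⟩ :=
        (isTLDSystem_genN 2).mem_monomials_two le_rfl (wordE_mem_monomials w)
      · exact ⟨c, 0, 0, 0, by simp [h]⟩
      · exact ⟨0, c, 0, 0, by simp [h]⟩
      · exact ⟨0, 0, c, 0, by simp [h]⟩
      · exact ⟨0, 0, 0, c, by simp [h]⟩
  have hp : Function.Injective fun n : ℕ => (n, true) := fun a b h => congrArg Prod.fst h
  have hne : ((0, true) : ℕ × Bool) ≠ (1, true) := by simp
  have ha : a = 0 := by
    have := hA.augTLD_eq_zero
    rw [e] at this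
    simpa [augTLD, liftTLD_genN] using this
  -- A strand with label `f` between the two points is a common eigenvector of both generators, with
  -- eigenvalue `-[2]` or 0. The labels `labD` give `b` and `c`, and `labA` gives `d`.
  have eig : ∀ lab : ℕ → Bool, Vanishes lab x → ∀ f : Bool,
      b * (if f = lab 0 then -qint 2 else 0) + c * (if f = lab 1 then -qint 2 else 0) +
        d * ((if f = lab 0 then -qint 2 else 0) * (if f = lab 1 then -qint 2 else 0)) = 0 := by
    intro lab hx f
    obtain ⟨D, hm, hd⟩ : ∃ D : Strands (ℕ × Bool), D.mate (0, true) = (1, true) ∧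
        D.dot (0, true) = f :=
      ⟨(Strands.straight ℕ).act hne f, Strands.act_mate_left _ _ _, Strands.act_dot_left _ _ _⟩
    have hop : ∀ e, Strands.op (0, true) (1, true) e (Finsupp.single D 1) =
        (if f = e then -qint 2 else 0) • Finsupp.single D (1 : Kq) := by
      intro e
      split_ifs with hf
      · exact Strands.op_single_of_mate hne hm (hd.trans hf)
      · rw [zero_smul]
        exact Strands.op_single_of_dot_ne hne hm (by rwa [hd])
    have h1 := congrArg (fun g => g (Finsupp.single D 1) D) (hx _ _ hp)
    rw [e] at h1
    simp only [map_add, map_smul, map_mul, Strands.rep_genN (Nat.zero_lt_two),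
      Strands.rep_genN (Nat.one_lt_two), LinearMap.add_apply, LinearMap.smul_apply,
      Module.End.mul_apply, LinearMap.zero_apply] at h1
    norm_num at h1
    rw [hop, hop, map_smul, hop] at h1
    simp only [ha, zero_add, Finsupp.smul_apply, Finsupp.single_eq_same, smul_eq_mul,
      mul_one] at h1
    linear_combination h1
  have hs := qint_two_ne_zero
  have e1 := eig _ hD true
  have e2 := eig _ hD false
  have e3 := eig _ hA false
  simp [labD, labA, hs] at e1 e2 e3
  subst e1 e2 ha
  have hd : d = 0 := by simpa [hs] using e3
  rw [e, hd]
  simp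

/-- The induction descends from `m + 1` to `lowIndex m`, which is 0 for `m = 2` and at least 2 for
`m ≥ 3`; it never meets `N = 1`. -/
theorem jointlyFaithful {N : ℕ} (hN : N ≠ 1) : JointlyFaithful N := by
  induction N using Nat.strong_induction_on with
  | _ N ih =>
    match N, hN with
    | 0, _ => exact jointlyFaithful_zero
    | 2, _ => exact jointlyFaithful_two
    | m + 3, _ =>
      refine jointlyFaithful_succ (by omega) (ih _ ?_ ?_)
      · have := lowIndex_le (m + 2); omega
      · unfold lowIndex; split_ifs <;> omega

/-! # Pictures of words -/

section Exposed

variable {α : Type*} [LinearOrder α] {m : α → α} {dot : α → Bool} {a b : α} {e : Bool}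

/-- Joining adjacent points keeps all dots accessible from the left border. -/
theorem exposed_rejoin (hm : ∀ x, m (m x) = x) (hne : ∀ x, m x ≠ x)
    (hnc : ∀ x y, x < y → y < m x → m y < m x) (hab : a < b)
    (hcov : ∀ z, z ≤ a ∨ b ≤ z) (hloop : m a ≠ b) (he : e = true → ∀ y, a ≤ y)
    (hx : ∀ x, dot x = true → ∀ y, ¬ (y < x ∧ y < m x ∧ x < m y ∧ m x < m y))
    (x : α) (hdx : redot m dot a b e x = true) (y : α) :
    ¬ (y < x ∧ y < rejoin m a b x ∧ x < rejoin m a b y ∧ rejoin m a b x < rejoin m a b y) := by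
  have hin : ∀ x y, x < y → y < m x → x < m y := fun x y => noncrossing_inside hm hnc
  have hout : ∀ x y, y < x → x < m y → y < m x ∧ m x < m y := fun x y h1 h2 =>
    ⟨hin y x h1 h2, hnc y x h1 h2⟩
  have e1 := hm a; have e2 := hm b; have n1 := hne a; have n2 := hne b
  have c1 := hcov (m a); have c2 := hcov (m b)
  have da := hx a; have db := hx b
  by_cases hxab : x = a ∨ x = b
  · have hex : e = true := by simpa [redot, hxab] using hdx
    have := he hex y
    rcases hxab with rfl | rfl
    · rintro ⟨h1, -⟩; exact absurd h1 (not_lt.mpr this)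
    · rintro ⟨-, h1, -⟩
      rw [rejoin_right hab.ne] at h1
      exact absurd h1 (not_lt.mpr this)
  · rw [not_or] at hxab
    by_cases hxm : x = m a ∨ x = m b
    · have hxor : xor (xor (dot a) (dot b)) e = true := by simpa [redot, hxab, hxm] using hdx
      -- A dot on the joined strand comes from one of its three pieces. By `key`, a strand outside
      -- the joined one would also be outside that piece.
      have hor : dot a = true ∨ dot b = true ∨ e = true := by
        revert hxor; cases dot a <;> cases dot b <;> cases e <;> simp
      by_cases hya : y = a ∨ y = b ∨ y = m a ∨ y = m b
      · have c3 := hcov x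
        clear hx hin hout hnc hdx da db
        grind [rejoin]
      · have h1 : rejoin m a b y = m y := by grind [rejoin]
        have h2 : (x = m a ∧ rejoin m a b x = m b) ∨ (x = m b ∧ rejoin m a b x = m a) := by
          grind [rejoin]
        rw [h1]
        have key : y < m a → y < m b → m a < m y → m b < m y → False := by
          intro k1 k2 k3 k4
          have k5 := hout (m a) y k1 k3
          have k6 := hout (m b) y k2 k4
          rw [e1] at k5
          rw [e2] at k6
          rcases hor with h | h | h
          · exact da h y ⟨k5.1, k1, k5.2, k3⟩
          · exact db h y ⟨k6.1, k2, k6.2, k4⟩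
          · exact absurd k5.1 (not_lt.mpr (he h y))
        rintro ⟨l1, l2, l3, l4⟩
        rcases h2 with ⟨r1, r2⟩ | ⟨r1, r2⟩
        · rw [r2] at l2 l4; rw [r1] at l1 l3; exact key l1 l2 l3 l4
        · rw [r2] at l2 l4; rw [r1] at l1 l3; exact key l2 l1 l4 l3
    · rw [not_or] at hxm
      have h1 : rejoin m a b x = m x := by grind [rejoin]
      have hdx' : dot x = true := by simpa [redot, hxab, hxm] using hdx
      rw [h1]
      have ex := hx x hdx'
      by_cases hya : y = a ∨ y = b ∨ y = m a ∨ y = m b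
      · have c3 := hcov x; have c4 := hcov (m x); have e3 := hm x
        have x1 := ex a; have x2 := ex b; have x3 := ex (m a); have x4 := ex (m b)
        have y1 := hnc a b; have y2 := hnc (m a) b; have y3 := hnc (m b) a
        have y4 := hnc (m a) x; have y5 := hnc b x; have y6 := hin (m a) x; have y7 := hin b x
        have y8 := hnc (m a) (m x); have y9 := hnc b (m x)
        have z1 := hout a x; have z2 := hout b x; have z3 := hout a (m x); have z4 := hout b (m x)
        clear hx hin hout hnc hdx da db hm hne hcov he
        grind (splits := 40) [rejoin]
      · have h2 : rejoin m a b y = m y := by grind [rejoin]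
        rw [h2]
        exact ex y

end Exposed

/-! ## The parity of the number of dots -/

namespace Picture

variable {N : ℕ} {m : Fin (2 * N) → Fin (2 * N)} {dot : Fin (2 * N) → Bool}

/-- The contribution of the point `x` to the number of dots. -/
def dotAt (m : Fin (2 * N) → Fin (2 * N)) (dot : Fin (2 * N) → Bool) (x : Fin (2 * N)) : ℕ :=
  if x < m x ∧ dot x = true then 1 else 0

theorem numDots_eq_sum : (Picture.mk m dot).numDots = ∑ x, dotAt m dot x :=
  Finset.card_filter _ _

theorem dotAt_add (hm : ∀ x, m (m x) = x) (hne : ∀ x, m x ≠ x) (hd : ∀ x, dot (m x) = dot x)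
    (x : Fin (2 * N)) : dotAt m dot x + dotAt m dot (m x) = (dot x).toNat := by
  unfold dotAt
  rw [hm, hd]
  rcases lt_trichotomy x (m x) with h | h | h
  · cases dot x <;> simp [h, h.le]
  · exact absurd h.symm (hne x)
  · cases dot x <;> simp [h, h.le]

variable {a b : Fin (2 * N)} {e : Bool}

/-- The labels `p`, `q` of the strands at `a`, `b` are replaced by `e` and `p + q + e`, which has
the same sum modulo 2. -/
theorem even_numDots_rejoin (hm : ∀ x, m (m x) = x) (hne : ∀ x, m x ≠ x)
    (hd : ∀ x, dot (m x) = dot x) (hab : a ≠ b) (hloop : m a ≠ b) :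
    Even (Picture.mk (rejoin m a b) (redot m dot a b e)).numDots ↔
      Even (Picture.mk m dot).numDots := by
  have hbm : b ≠ m a := hloop.symm
  have hab' : a ≠ m b := fun h => hloop (by rw [h, hm])
  have hmm : m a ≠ m b := fun h => hab (by rw [← hm a, h, hm])
  have split : ∀ f : Fin (2 * N) → ℕ, ∑ x, f x =
      (f a + f (m a)) + (f b + f (m b)) +
        ∑ x ∈ ({a, m a, b, m b} : Finset (Fin (2 * N)))ᶜ, f x := by
    intro f
    rw [← Finset.sum_add_sum_compl ({a, m a, b, m b} : Finset (Fin (2 * N))) f,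
      Finset.sum_insert, Finset.sum_insert, Finset.sum_insert, Finset.sum_singleton]
    · ring
    · simpa using (hne b).symm
    · simp [hbm.symm, hmm]
    · simp [(hne a).symm, hab, hab']
  have hrest : ∑ x ∈ ({a, m a, b, m b} : Finset (Fin (2 * N)))ᶜ,
      dotAt (rejoin m a b) (redot m dot a b e) x =
      ∑ x ∈ ({a, m a, b, m b} : Finset (Fin (2 * N)))ᶜ, dotAt m dot x := by
    refine Finset.sum_congr rfl fun x hx => ?_
    simp only [Finset.mem_compl, Finset.mem_insert, Finset.mem_singleton, not_or] at hx
    simp [dotAt, rejoin, redot, hx]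
  have r1 := dotAt_add (rejoin_rejoin hm hne hab) (rejoin_ne hm hne hab)
    (redot_rejoin (e := e) hm hne hd hab) a
  have r2 := dotAt_add (rejoin_rejoin hm hne hab) (rejoin_ne hm hne hab)
    (redot_rejoin (e := e) hm hne hd hab) (m a)
  have q1 : rejoin m a b a = b := rejoin_left
  have q2 : rejoin m a b (m a) = m b := by simp [rejoin, hne a, hbm.symm]
  have q3 : redot m dot a b e (m a) = xor (xor (dot a) (dot b)) e := by
    simp [redot, hne a, hbm.symm]
  rw [q1, redot_left] at r1
  rw [q2, q3] at r2
  have s1 := dotAt_add hm hne hd a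
  have s2 := dotAt_add hm hne hd b
  rw [numDots_eq_sum, numDots_eq_sum, split, split (dotAt m dot), hrest, s1, s2,
    show ∀ p q r s : ℕ, p + q + (r + s) = (p + r) + (q + s) from fun p q r s => by omega, r1, r2]
  cases dot a <;> cases dot b <;> cases e <;> simp [Nat.even_add_one, parity_simps]

/-- The cup at `a`, `b` disappears in the loop and is replaced by one with the other label, so
exactly one dot is gained or lost. -/
theorem even_numDots_rejoin_loop (hm : ∀ x, m (m x) = x) (hne : ∀ x, m x ≠ x)
    (hd : ∀ x, dot (m x) = dot x) (hloop : m a = b) (he : dot a ≠ e) :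
    Even (Picture.mk (rejoin m a b) (redot m dot a b e)).numDots ↔
      ¬ Even (Picture.mk m dot).numDots := by
  subst hloop
  have split : ∀ f : Fin (2 * N) → ℕ, ∑ x, f x =
      (f a + f (m a)) + ∑ x ∈ ({a, m a} : Finset (Fin (2 * N)))ᶜ, f x := by
    intro f
    rw [← Finset.sum_add_sum_compl ({a, m a} : Finset (Fin (2 * N))) f,
      Finset.sum_pair (hne a).symm]
  have hr : rejoin m a (m a) = m := rejoin_of_eq hm rfl
  have hrest : ∑ x ∈ ({a, m a} : Finset (Fin (2 * N)))ᶜ, dotAt m (redot m dot a (m a) e) x =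
      ∑ x ∈ ({a, m a} : Finset (Fin (2 * N)))ᶜ, dotAt m dot x := by
    refine Finset.sum_congr rfl fun x hx => ?_
    simp only [Finset.mem_compl, Finset.mem_insert, Finset.mem_singleton, not_or] at hx
    simp [dotAt, redot, hx, hm]
  have hd' := redot_rejoin (e := e) hm hne hd (hne a).symm
  rw [hr] at hd'
  have r1 := dotAt_add hm hne hd' a
  have s1 := dotAt_add hm hne hd a
  rw [redot_left] at r1
  rw [numDots_eq_sum, numDots_eq_sum, hr, split, split (dotAt m dot), hrest, s1, r1]
  revert he
  cases dot a <;> cases e <;> simp [Nat.even_add_one, parity_simps]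

end Picture

/-! # Reduced words and their pictures -/

section Words

variable {N : ℕ} {lab : ℕ → Bool} {i : Fin N} {w : List (Fin N)}

/-- The left one of the two points that the generator `E_i` joins. -/
def leftPt (i : Fin N) : Fin (2 * N) := ⟨max i.val 1 - 1, by omega⟩

/-- The right one of the two points that the generator `E_i` joins. -/
def rightPt (i : Fin N) : Fin (2 * N) := ⟨max i.val 1, by omega⟩

theorem leftPt_ne_rightPt (i : Fin N) : leftPt i ≠ rightPt i := by
  rw [leftPt, rightPt, Ne, Fin.mk.injEq]; omega

theorem leftPt_lt_rightPt (i : Fin N) : leftPt i < rightPt i := by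
  rw [leftPt, rightPt, Fin.mk_lt_mk]; omega

theorem rightPt_eq (i : Fin N) (h : max i.val 1 - 1 + 1 < 2 * N) :
    (⟨max i.val 1 - 1 + 1, h⟩ : Fin (2 * N)) = rightPt i :=
  Fin.ext (by rw [rightPt]; simp only; omega)

/-- The picture of a word without normalization of the dots. -/
def rawPicture (lab : ℕ → Bool) (w : List (Fin N)) : Strands (Fin (2 * N)) :=
  w.foldr (fun i D => D.act (leftPt_ne_rightPt i) (lab i))
    ⟨Fin.rev, fun _ => false, (TLDiagram.one N).mate_mate, (TLDiagram.one N).mate_ne, fun _ => rfl⟩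

/-- The diagram of type A of a word. -/
def wordShape (w : List (Fin N)) : TLDiagram N :=
  w.foldr (fun i D => D.act (max i.val 1 - 1) (by omega)) (TLDiagram.one N)

theorem rawPicture_mate (lab : ℕ → Bool) (w : List (Fin N)) :
    (rawPicture lab w).mate = (wordShape w).mate := by
  induction w with
  | nil => rfl
  | cons i w ih =>
    change rejoin (rawPicture lab w).mate _ _ = rejoin (wordShape w).mate _ _
    rw [ih, rightPt_eq]
    rfl

theorem wordShape_cons_mate (i : Fin N) (w : List (Fin N)) :
    (wordShape (i :: w)).mate = rejoin (wordShape w).mate (leftPt i) (rightPt i) := by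
  rw [← rawPicture_mate labA, ← rawPicture_mate labA]; rfl

theorem wordShape_cons_ne_one (hN : 2 ≤ N) (i : Fin N) (w : List (Fin N)) :
    wordShape (i :: w) ≠ TLDiagram.one N := by
  intro h
  have h1 : (wordShape (i :: w)).mate (leftPt i) = rightPt i := by
    rw [wordShape_cons_mate]; exact rejoin_left
  rw [h] at h1
  have h2 := congrArg Fin.val h1
  change (Fin.rev _).val = _ at h2
  rw [Fin.val_rev, leftPt, rightPt] at h2
  simp only at h2
  omega

theorem rawPicture_labA_dot (w : List (Fin N)) (x : Fin (2 * N)) :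
    (rawPicture labA w).dot x = false := by
  induction w generalizing x with
  | nil => rfl
  | cons i w ih =>
    change redot _ (rawPicture labA w).dot _ _ _ x = false
    simp only [redot, ih, labA]
    split_ifs <;> rfl

variable {α : Type} [DecidableEq α] {pts : ℕ → α} {hp : Function.Injective pts} {D : Strands α}

/-- The action of a word on strands, up to scalars. -/
def strandWord (hp : Function.Injective pts) (lab : ℕ → Bool) (w : List (Fin N)) (D : Strands α) :
    Strands α :=
  w.foldr (fun (i : Fin N) D => D.act (hp.ne (by omega : max i.val 1 - 1 ≠ max i.val 1)) (lab i)) D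

/-- The cups of the picture of a word persist when it acts on strands. -/
theorem strandWord_of_rawPicture (hN : 2 ≤ N) {x y : Fin (2 * N)} (hx : x.val < N) (hy : y.val < N)
    (h : (rawPicture lab w).mate x = y) :
    (strandWord hp lab w D).mate (pts x) = pts y ∧
      (strandWord hp lab w D).dot (pts x) = (rawPicture lab w).dot x := by
  induction w generalizing x y with
  | nil =>
    have h1 := congrArg Fin.val h
    change (Fin.rev _).val = _ at h1
    rw [Fin.val_rev] at h1
    omega
  | cons i w ih =>
    set P := rawPicture lab w with hP
    set S := strandWord hp lab w D with hS
    have ha : (leftPt i).val < N := by rw [leftPt]; simp only; omega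
    have hb : (rightPt i).val < N := by rw [rightPt]; simp only; omega
    change rejoin P.mate (leftPt i) (rightPt i) x = y at h
    change rejoin S.mate (pts (leftPt i)) (pts (rightPt i)) (pts x) = pts y ∧
      redot S.mate S.dot (pts (leftPt i)) (pts (rightPt i)) (lab i) (pts x) =
        redot P.mate P.dot (leftPt i) (rightPt i) (lab i) x
    have hab := leftPt_ne_rightPt i
    generalize leftPt i = a at *
    generalize rightPt i = b at *
    have inj : ∀ u v : Fin (2 * N), pts u = pts v ↔ u = v := fun u v =>
      ⟨fun h => Fin.ext (hp h), fun h => by rw [h]⟩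
    have ma := P.mate_mate a; have mb := P.mate_mate b; have mx := P.mate_mate x
    have sa := S.mate_mate (pts a); have sb := S.mate_mate (pts b)
    have sx := S.mate_mate (pts x)
    have nx := P.mate_ne x
    by_cases hxa : x = a
    · subst hxa
      have : y = b := by rw [← h]; exact rejoin_left
      subst this
      exact ⟨rejoin_left, by rw [redot_left, redot_left]⟩
    by_cases hxb : x = b
    · subst hxb
      have : y = a := by rw [← h]; exact rejoin_right hab
      subst this
      exact ⟨rejoin_right ((inj _ _).not.mpr hab), by rw [redot_right, redot_right]⟩
    by_cases hma : x = P.mate a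
    · have hmb : P.mate b = y := by rw [← h]; simp [rejoin, hxa, hxb, ← hma]
      have i1 := ih ha hx hma.symm
      have i2 := ih hb hy hmb
      simp [rejoin, redot, inj, hxa, hxb, i1, i2, ← hma]
    by_cases hmb : x = P.mate b
    · have hma' : P.mate a = y := by rw [← h]; simp [rejoin, hxa, hxb, hma, ← hmb]
      have i1 := ih hb hx hmb.symm
      have i2 := ih ha hy hma'
      have hxy : x ≠ y := by rw [← hma']; exact hma
      simp [rejoin, redot, inj, hxa, hxb, i1, i2, ← hmb, hxy]
    · have hxy : P.mate x = y := by rw [← h]; simp [rejoin, hxa, hxb, hma, hmb]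
      have i1 := ih hx hy hxy
      have k1 : pts x ≠ S.mate (pts a) := by
        intro hh
        have : S.mate (pts x) = pts a := by rw [hh, sa]
        rw [i1.1, inj] at this
        exact hma (by rw [← this, ← hxy, mx])
      have k2 : pts x ≠ S.mate (pts b) := by
        intro hh
        have : S.mate (pts x) = pts b := by rw [hh, sb]
        rw [i1.1, inj] at this
        exact hmb (by rw [← this, ← hxy, mx])
      simp [rejoin, redot, inj, hxa, hxb, hma, hmb, k1, k2, i1]

theorem rep_wordE_single (hp : Function.Injective pts) (lab : ℕ → Bool) (w : List (Fin N))
    (D : Strands α) : ∃ c : Kq, Strands.rep hp lab N (wordE w) (Finsupp.single D 1) =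
      c • Finsupp.single (strandWord hp lab w D) 1 := by
  induction w with
  | nil => exact ⟨1, by simp [wordE, strandWord]⟩
  | cons i w ih =>
    obtain ⟨c, hc⟩ := ih
    refine ⟨c * loopWeight (strandWord hp lab w D).mate (strandWord hp lab w D).dot
      (pts (max i.val 1 - 1)) (pts (max i.val 1)) (lab i), ?_⟩
    rw [wordE_cons, map_mul, Module.End.mul_apply, hc, map_smul, Strands.rep_genE,
      Strands.op_single (hp.ne (by omega)), smul_smul]
    rfl

/-- The loop closes on a cup of the picture of `w`. Cups persist on whatever strands the word acts,
so the factor is the same everywhere. -/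
theorem rep_wordE_cons_of_loop (hN : 2 ≤ N) (hp : Function.Injective pts)
    (h : (wordShape w).mate (leftPt i) = rightPt i)
    (hd : (rawPicture lab w).dot (leftPt i) = lab i) :
    Strands.rep hp lab N (wordE (i :: w)) = -qint 2 • Strands.rep hp lab N (wordE w) := by
  refine TLDiagram.end_ext fun D => ?_
  obtain ⟨c, hc⟩ := rep_wordE_single hp lab w D
  have ha : (leftPt i).val < N := by rw [leftPt]; simp only; omega
  have hb : (rightPt i).val < N := by rw [rightPt]; simp only; omega
  rw [← rawPicture_mate lab] at h
  have hs := strandWord_of_rawPicture (hp := hp) (D := D) hN ha hb h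
  have hs1 : (strandWord hp lab w D).mate (pts (max i.val 1 - 1)) = pts (max i.val 1) := hs.1
  have hs2 : (strandWord hp lab w D).dot (pts (max i.val 1 - 1)) =
    (rawPicture lab w).dot (leftPt i) := hs.2
  rw [wordE_cons, map_mul, Module.End.mul_apply, LinearMap.smul_apply, hc, map_smul,
    Strands.rep_genE, Strands.op_single_of_mate (hp.ne (by omega)) hs1 (hs2.trans hd), smul_comm]

theorem rep_wordE_cons_of_dot_ne (hN : 2 ≤ N) (hp : Function.Injective pts)
    (h : (wordShape w).mate (leftPt i) = rightPt i)
    (hd : (rawPicture lab w).dot (leftPt i) ≠ lab i) :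
    Strands.rep hp lab N (wordE (i :: w)) = 0 := by
  refine TLDiagram.end_ext fun D => ?_
  obtain ⟨c, hc⟩ := rep_wordE_single hp lab w D
  have ha : (leftPt i).val < N := by rw [leftPt]; simp only; omega
  have hb : (rightPt i).val < N := by rw [rightPt]; simp only; omega
  rw [← rawPicture_mate lab] at h
  have hs := strandWord_of_rawPicture (hp := hp) (D := D) hN ha hb h
  have hs1 : (strandWord hp lab w D).mate (pts (max i.val 1 - 1)) = pts (max i.val 1) := hs.1
  have hs2 : (strandWord hp lab w D).dot (pts (max i.val 1 - 1)) =
    (rawPicture lab w).dot (leftPt i) := hs.2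
  rw [wordE_cons, map_mul, Module.End.mul_apply, LinearMap.zero_apply, hc, map_smul,
    Strands.rep_genE, Strands.op_single_of_dot_ne (hp.ne (by omega)) hs1 (by rwa [hs2]), smul_zero]

end Words

/-! ### Loops in the pictures of reduced words. -/

section Reduced

variable {N : ℕ} {i : Fin N} {w : List (Fin N)}

/-- No closed loops arise in the picture of the word. -/
inductive IsLoopless : List (Fin N) → Prop
  | nil : IsLoopless []
  | cons {i : Fin N} {w : List (Fin N)} : IsLoopless w →
      (wordShape w).mate (leftPt i) ≠ rightPt i → IsLoopless (i :: w)

/-- Exactly one closed loop arises in the picture of the word, and it carries one dot. -/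
inductive HasDottedLoop : List (Fin N) → Prop
  | loop {i : Fin N} {w : List (Fin N)} : IsLoopless w →
      (wordShape w).mate (leftPt i) = rightPt i →
      (rawPicture labD w).dot (leftPt i) ≠ labD i → HasDottedLoop (i :: w)
  | cons {i : Fin N} {w : List (Fin N)} : HasDottedLoop w →
      (wordShape w).mate (leftPt i) ≠ rightPt i →
      HasDottedLoop (i :: w)

theorem eq_smul_of_rep (hN : 2 ≤ N) {x y : TLD N} {c : Kq}
    (hA : ∀ (α : Type) [DecidableEq α] (pts : ℕ → α) (hp : Function.Injective pts),
      Strands.rep hp labA N x = c • Strands.rep hp labA N y)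
    (hD : ∀ (α : Type) [DecidableEq α] (pts : ℕ → α) (hp : Function.Injective pts),
      Strands.rep hp labD N x = c • Strands.rep hp labD N y) : x = c • y := by
  refine eq_smul_of_add (jointlyFaithful (by omega) _ ?_ ?_)
  · intro α _ pts hp
    rw [map_add, map_smul, hA, ← add_smul, add_neg_cancel, zero_smul]
  · intro α _ pts hp
    rw [map_add, map_smul, hD, ← add_smul, add_neg_cancel, zero_smul]

theorem IsReducedWord.tail (h : IsReducedWord (i :: w)) : IsReducedWord w := by
  intro w' c hw
  have := h (i :: w') c (by rw [wordE_cons, hw, wordE_cons, mul_smul_comm])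
  simpa using this

theorem HasDottedLoop.rep_eq_zero (hN : 2 ≤ N) (h : HasDottedLoop w) : Vanishes labD (wordE w) := by
  induction h with
  | loop _ h1 h2 => exact fun α _ pts hp => rep_wordE_cons_of_dot_ne hN hp h1 h2
  | cons _ _ ih => rw [wordE_cons]; exact ih.mul_left _

/-- Without dots every loop is a factor `-[2]`. With dots the same factor arises from a loop whose
labels agree, and after a dotted loop both sides are zero. In these cases joint faithfulness gives
`E_i w = -[2] w` in the algebra, so the word is not reduced. -/
theorem IsReducedWord.isLoopless_or_hasDottedLoop (hN : 2 ≤ N) (h : IsReducedWord w) :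
    IsLoopless w ∨ HasDottedLoop w := by
  induction w with
  | nil => exact Or.inl IsLoopless.nil
  | cons i w ih =>
    have hw := ih h.tail
    by_cases hl : (wordShape w).mate (leftPt i) = rightPt i
    · have hA : ∀ (α : Type) [DecidableEq α] (pts : ℕ → α) (hp : Function.Injective pts),
          Strands.rep hp labA N (wordE (i :: w)) = -qint 2 • Strands.rep hp labA N (wordE w) :=
        fun α _ pts hp => rep_wordE_cons_of_loop hN hp hl (rawPicture_labA_dot _ _)
      have hcon : ¬ ∀ (α : Type) [DecidableEq α] (pts : ℕ → α) (hp : Function.Injective pts),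
          Strands.rep hp labD N (wordE (i :: w)) = -qint 2 • Strands.rep hp labD N (wordE w) := by
        intro hD
        have := h w _ (eq_smul_of_rep hN hA hD)
        simp at this
      rcases hw with hw | hw
      · by_cases hd : (rawPicture labD w).dot (leftPt i) = labD i
        · exact (hcon fun α _ pts hp => rep_wordE_cons_of_loop hN hp hl hd).elim
        · exact Or.inr (HasDottedLoop.loop hw hl hd)
      · refine (hcon fun α _ pts hp => ?_).elim
        rw [wordE_cons, map_mul, hw.rep_eq_zero hN, mul_zero, smul_zero]
    · exact hw.imp (fun hw => hw.cons hl) fun hw => hw.cons hl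

theorem capCup_single_wordShape (i : Fin N) (w : List (Fin N)) :
    TLDiagram.capCup N (max i.val 1 - 1) (Finsupp.single (wordShape w) 1) =
      (if (wordShape w).mate (leftPt i) = rightPt i then -qint 2 else 1) •
        Finsupp.single (wordShape (i :: w)) 1 := by
  rw [TLDiagram.capCup_single (by omega), TLDiagram.weight, rightPt_eq]
  rfl

theorem IsLoopless.repA_wordE (hN : 2 ≤ N) (h : IsLoopless w) :
    TLDiagram.repA hN (wordE w) (Finsupp.single (TLDiagram.one N) 1) =
      Finsupp.single (wordShape w) 1 := by
  induction h with
  | nil => simp [wordE, wordShape]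
  | cons _ hl ih =>
    rw [wordE_cons, map_mul, Module.End.mul_apply, ih, TLDiagram.repA_genE,
      capCup_single_wordShape, if_neg hl, one_smul]

theorem HasDottedLoop.repA_wordE (hN : 2 ≤ N) (h : HasDottedLoop w) :
    TLDiagram.repA hN (wordE w) (Finsupp.single (TLDiagram.one N) 1) =
      -qint 2 • Finsupp.single (wordShape w) 1 := by
  induction h with
  | loop h hl _ =>
    rw [wordE_cons, map_mul, Module.End.mul_apply, h.repA_wordE, TLDiagram.repA_genE,
      capCup_single_wordShape, if_pos hl]
  | cons _ hl ih =>
    rw [wordE_cons, map_mul, Module.End.mul_apply, ih, map_smul, TLDiagram.repA_genE,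
      capCup_single_wordShape, if_neg hl, one_smul]

/-! ## Dots -/

theorem Picture.normalize_of_even {P : Picture N} (h : Even P.numDots) : P.normalize = P := by
  rw [Picture.normalize, if_neg (Nat.not_odd_iff_even.mpr h)]

theorem Picture.normalize_of_not_even {P : Picture N} (h : ¬ Even P.numDots) :
    P.normalize = ⟨P.mate, fun x => decide (Picture.AtBottomLeft P.mate x)⟩ := by
  rw [Picture.normalize, if_pos (Nat.not_even_iff_odd.mp h)]

theorem rawPicture_cons_toPicture (lab : ℕ → Bool) (i : Fin N) (w : List (Fin N)) :
    (⟨(rawPicture lab (i :: w)).mate, (rawPicture lab (i :: w)).dot⟩ : Picture N) =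
      ⟨rejoin (rawPicture lab w).mate (leftPt i) (rightPt i),
        redot (rawPicture lab w).mate (rawPicture lab w).dot (leftPt i) (rightPt i) (lab i)⟩ := rfl

theorem IsLoopless.even_numDots (h : IsLoopless w) : Even (Picture.mk
    (rawPicture labD w).mate (rawPicture labD w).dot).numDots := by
  induction h with
  | nil => simp [Picture.numDots, rawPicture]
  | @cons i w _ hl ih =>
    rw [← rawPicture_mate labD] at hl
    rw [rawPicture_cons_toPicture, Picture.even_numDots_rejoin (rawPicture labD w).mate_mate
      (rawPicture labD w).mate_ne (rawPicture labD w).dot_mate (leftPt_ne_rightPt i) hl]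
    exact ih

theorem IsLoopless.ofWord (h : IsLoopless w) : Picture.ofWord w =
    ⟨(rawPicture labD w).mate, (rawPicture labD w).dot⟩ := by
  induction h with
  | nil => rfl
  | @cons i w h hl ih =>
    change Picture.stack i (Picture.ofWord w) = _
    rw [ih]
    exact Picture.normalize_of_even (h.cons hl).even_numDots

/-- The dotted loop makes the number of dots odd. Later letters keep it odd, so the dots are
normalized again at each step. -/
theorem HasDottedLoop.ofWord (hN : 0 < N) (h : HasDottedLoop w) : Picture.ofWord w =
    ⟨(wordShape w).mate, fun x => decide (Picture.AtBottomLeft (wordShape w).mate x)⟩ := by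
  induction h with
  | @loop i w h hl hd =>
    change Picture.stack i (Picture.ofWord w) = _
    rw [h.ofWord, wordShape_cons_mate, ← rawPicture_mate labD]
    rw [← rawPicture_mate labD] at hl
    refine Picture.normalize_of_not_even ?_
    intro he
    exact (Picture.even_numDots_rejoin_loop (rawPicture labD w).mate_mate
      (rawPicture labD w).mate_ne (rawPicture labD w).dot_mate hl hd).mp he h.even_numDots
  | @cons i w h hl ih =>
    change Picture.stack i (Picture.ofWord w) = _
    rw [ih, wordShape_cons_mate]
    refine Picture.normalize_of_not_even ?_
    intro he
    have h1 := (Picture.even_numDots_rejoin (wordShape w).mate_mate (wordShape w).mate_ne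
      (fun x => ?_) (leftPt_ne_rightPt i) hl).mp he
    · rw [TLDiagram.numDots_bottomLeft _ hN] at h1
      exact absurd h1 (by decide)
    · rw [decide_eq_decide]
      unfold Picture.AtBottomLeft
      rw [(wordShape w).mate_mate]
      exact or_comm

theorem IsLoopless.exposed (h : IsLoopless w) {x : Fin (2 * N)}
    (hx : (rawPicture labD w).dot x = true) : (wordShape w).Exposed x := by
  induction h generalizing x with
  | nil => exact absurd hx (by simp [rawPicture])
  | @cons i w _ hl ih =>
    unfold TLDiagram.Exposed
    rw [wordShape_cons_mate]
    refine exposed_rejoin (wordShape w).mate_mate (wordShape w).mate_ne (wordShape w).noncrossing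
      (leftPt_lt_rightPt i) (fun z => ?_) hl (e := labD i) (dot := (rawPicture labD w).dot)
      (fun hi y => ?_) (fun x hx => ih hx) x ?_
    · rw [leftPt, rightPt, Fin.le_def, Fin.le_def]; simp only; omega
    · have : i.val = 0 := by simpa [labD] using hi
      rw [leftPt, Fin.le_def]; simp only; omega
    · rw [← rawPicture_mate labD]; exact hx

/-- The diagram of type D of a word without loops. -/
def IsLoopless.diagram (h : IsLoopless w) (h0 : wordShape w = TLDiagram.one N → w = []) :
    DottedDiagram N where
  shape := wordShape w
  dot := (rawPicture labD w).dot
  dot_mate x := by rw [← rawPicture_mate labD]; exact (rawPicture labD w).dot_mate x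
  parity := by rw [← rawPicture_mate labD]; exact Or.inr h.even_numDots
  even_exposed _ x hx := h.exposed hx
  odd_bottomLeft h1 := by
    rw [← rawPicture_mate labD] at h1
    have := h.even_numDots
    rw [h1] at this
    exact absurd this (by decide)
  one_undotted h1 x := by
    rw [h0 h1]; rfl

theorem IsLoopless.toPicture_diagram (h : IsLoopless w)
    (h0 : wordShape w = TLDiagram.one N → w = []) :
    (h.diagram h0).toPicture = Picture.ofWord w := by
  rw [h.ofWord, rawPicture_mate]; rfl

theorem IsLoopless.even_numDots_diagram (h : IsLoopless w)
    (h0 : wordShape w = TLDiagram.one N → w = []) : Even (h.diagram h0).numDots := by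
  rw [DottedDiagram.numDots, h.toPicture_diagram h0, h.ofWord]
  exact h.even_numDots

end Reduced

/-! # Linear combinations of coefficients -/

open Classical in
/-- The contribution of the word `w` to the combination of coefficients at `D`. -/
noncomputable def wordLiftValue {N : ℕ} (w : List (Fin N)) (D : TLDiagram N) : Kq :=
  ∑ D' ∈ D.evenLifts, (if Picture.ofWord w = D'.toPicture then 1 else 0) -
    qint 2 * (if h : D = TLDiagram.one N then 0 else
      if Picture.ofWord w = (D.oddLift h).toPicture then 1 else 0)

/-- The coefficients come from an arbitrary choice of expansion. A linear functional with the right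
values on reduced words evaluates all expansions alike, so linear independence of reduced words is
not needed. -/
theorem liftCombination_eq {N : ℕ} {D : TLDiagram N} (L : TLD N →ₗ[Kq] Kq)
    (hL : ∀ w, IsReducedWord w → L (wordE w) = wordLiftValue w D) (x : TLD N) :
    liftCombination x D = L x := by
  classical
  have hx := (exists_reducedExpansion x).choose_spec
  set y := (exists_reducedExpansion x).choose with hy
  conv_rhs => rw [← hx]
  rw [Finsupp.sum, map_sum]
  simp only [map_smul, hL _ (Subtype.prop _)]
  unfold liftCombination diagramCoef wordLiftValue
  rw [← hy]
  simp only [Finsupp.sum, smul_eq_mul, mul_sub, Finset.sum_sub_distrib, Finset.mul_sum]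
  congr 1
  · rw [Finset.sum_comm]
    refine Finset.sum_congr rfl fun w _ => Finset.sum_congr rfl fun D' _ => ?_
    split_ifs <;> simp
  · split_ifs with h
    · simp
    · rw [Finset.mul_sum]
      refine Finset.sum_congr rfl fun w _ => ?_
      split_ifs <;> simp [mul_comm]

/-! ### Comparison with the type A coefficients. -/

section Final

variable {N : ℕ} {w : List (Fin N)}

theorem IsLoopless.wordLiftValue_eq (h : IsLoopless w)
    (h0 : wordShape w = TLDiagram.one N → w = []) (D : TLDiagram N) :
    wordLiftValue w D = Finsupp.single (wordShape w) (1 : Kq) D := by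
  classical
  have h1 : ∀ hD : D ≠ TLDiagram.one N, Picture.ofWord w ≠ (D.oddLift hD).toPicture := by
    intro hD he
    have h2 := h.even_numDots
    rw [← h.ofWord, he] at h2
    have h3 : (D.oddLift hD).toPicture.numDots = 1 :=
      TLDiagram.numDots_bottomLeft D (TLDiagram.pos_of_ne_one hD)
    rw [h3] at h2
    exact absurd h2 (by decide)
  have h2 : ∀ D' : DottedDiagram N, Picture.ofWord w = D'.toPicture ↔ h.diagram h0 = D' := by
    intro D'
    rw [← h.toPicture_diagram h0]
    exact DottedDiagram.toPicture_injective.eq_iff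
  have h3 : (if hD : D = TLDiagram.one N then (0 : Kq) else
      if Picture.ofWord w = (D.oddLift hD).toPicture then 1 else 0) = 0 := by
    split_ifs with hD hw
    · rfl
    · exact absurd hw (h1 hD)
    · rfl
  have h4 : h.diagram h0 ∈ D.evenLifts ↔ wordShape w = D := by
    rw [TLDiagram.evenLifts, Finset.mem_filter]
    exact ⟨fun hh => hh.2.1, fun hh => ⟨Finset.mem_univ _, hh, h.even_numDots_diagram h0⟩⟩
  rw [wordLiftValue, h3, mul_zero, sub_zero]
  simp only [h2]
  rw [Finset.sum_ite_eq, Finsupp.single_apply]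
  simp only [h4]

/-- The factor `-[2]` in front of the single-dot lift is the value of the deleted loop once its dot
is forgotten, which agrees with `HasDottedLoop.repA_wordE`. -/
theorem HasDottedLoop.wordLiftValue_eq (hN : 2 ≤ N) (h : HasDottedLoop w) (D : TLDiagram N) :
    wordLiftValue w D = -qint 2 * Finsupp.single (wordShape w) (1 : Kq) D := by
  classical
  have hne : wordShape w ≠ TLDiagram.one N := by
    cases h with
    | loop => exact wordShape_cons_ne_one hN _ _
    | cons => exact wordShape_cons_ne_one hN _ _
  have h1 : ∑ D' ∈ D.evenLifts, (if Picture.ofWord w = D'.toPicture then (1 : Kq) else 0) = 0 := by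
    refine Finset.sum_eq_zero fun D' hD' => if_neg fun he => ?_
    have h2 := (Finset.mem_filter.mp hD').2.2
    rw [DottedDiagram.numDots, ← he, h.ofWord (by omega),
      TLDiagram.numDots_bottomLeft _ (by omega)] at h2
    exact absurd h2 (by decide)
  rw [wordLiftValue, h1, zero_sub, ← neg_mul, Finsupp.single_apply]
  congr 1
  by_cases hD : D = TLDiagram.one N
  · rw [dif_pos hD, if_neg fun hw => hne (hw.trans hD)]
  · rw [dif_neg hD]
    refine if_congr ⟨fun he => TLDiagram.ext ?_, ?_⟩ rfl rfl
    · have := congrArg Picture.mate he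
      rwa [h.ofWord (by omega)] at this
    · rintro rfl
      exact h.ofWord (by omega)

theorem liftCombination_eq_repA (hN : 2 ≤ N) (x : TLD N) (D : TLDiagram N) :
    liftCombination x D =
      TLDiagram.repA hN x (Finsupp.single (TLDiagram.one N) 1) D := by
  refine liftCombination_eq ((Finsupp.lapply D).comp ((LinearMap.applyₗ
    (Finsupp.single (TLDiagram.one N) 1)).comp (TLDiagram.repA hN).toLinearMap)) ?_ x
  intro w hw
  change TLDiagram.repA hN (wordE w) (Finsupp.single (TLDiagram.one N) 1) D = _
  rcases hw.isLoopless_or_hasDottedLoop hN with h | h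
  · rw [h.repA_wordE, h.wordLiftValue_eq]
    intro h1
    cases w with
    | nil => rfl
    | cons => exact absurd h1 (wordShape_cons_ne_one hN _ _)
  · rw [h.repA_wordE, h.wordLiftValue_eq hN, Finsupp.smul_apply, smul_eq_mul]

theorem TLDiagram.eq_one_of_strand (D : TLDiagram 1) : D = TLDiagram.one 1 := by
  refine TLDiagram.eq_one_of_forall D fun x hx => ?_
  have h := D.mate_ne x
  rw [Ne, Fin.ext_iff] at h
  omega

/-- The type A representation needs two strands. With one strand the only diagram is the undotted
identity, while every nonempty word is depicted with a dot, so only the empty word counts. -/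
theorem liftCombination_one_strand (x : TLD 1) (D : TLDiagram 1) :
    liftCombination x D = augTLD 1 x := by
  refine liftCombination_eq (augTLD 1).toLinearMap (fun w _ => ?_) x
  change augTLD 1 (wordE w) = _
  cases w with
  | nil =>
    rw [augTLD_wordE_nil, IsLoopless.nil.wordLiftValue_eq (fun _ => rfl),
      D.eq_one_of_strand, wordShape, List.foldr_nil, Finsupp.single_eq_same]
  | cons i w =>
    have key : ∃ x, (Picture.ofWord (i :: w)).dot x = true := by
      change ∃ x, (Picture.stack i (Picture.ofWord w)).dot x = true
      unfold Picture.stack Picture.normalize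
      simp only
      split_ifs
      · exact ⟨⟨1, by omega⟩, by simp [Picture.AtBottomLeft]⟩
      · exact ⟨⟨0, by omega⟩, by simp⟩
    obtain ⟨x, hx⟩ := key
    rw [augTLD_wordE_cons, wordLiftValue, dif_pos D.eq_one_of_strand, mul_zero, sub_zero,
      Finset.sum_eq_zero]
    intro D' _
    refine if_neg fun he => ?_
    have h1 := D'.one_undotted D'.shape.eq_one_of_strand x
    rw [he] at hx
    exact absurd (hx.symm.trans h1) (by decide)

theorem liftCombination_jwD (n : ℕ) (D : TLDiagram (n + 1)) :
    liftCombination (jwD n) D = TLDiagram.jwA (n + 1) D := by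
  rcases n with _ | n
  · rw [liftCombination_one_strand, augTLD_jwD, D.eq_one_of_strand, TLDiagram.jwA_one]
  · rw [liftCombination_eq_repA (by omega), TLDiagram.repA_jwD_one]

end Final

theorem mainTheorem4 :
    ∃ Q : (n : ℕ) → TLD (n + 1),
      IsJonesWenzlD Q ∧ (∀ Q' : (n : ℕ) → TLD (n + 1), IsJonesWenzlD Q' → Q' = Q) ∧
      ∀ (n : ℕ) (D : TLDiagram (n + 2)),
        liftCombination (Q (n + 1)) D =
          ∑ i ∈ D.capPositions.attach, qint i.1 / qint (n + 2) *
            liftCombination (Q n) (D.remove i.1 (TLDiagram.hasInnermostCap_of_mem i.2)) := by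
  refine ⟨jwD, isJonesWenzlD_jwD, fun Q' hQ' => hQ'.eq_jwD, fun n D => ?_⟩
  rw [liftCombination_jwD, TLDiagram.jwA_succ_apply]
  exact Finset.sum_congr rfl fun i _ => by rw [liftCombination_jwD]
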